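/- Let $q\in\mathbb C\setminus\{0,\pm1,\pm i\}$. Let $\mathcal A=\mathrm{Fun}_q(GL(3,\mathbb C))$ be the algebra generated by $z^i{}_j$ ($1\le i,j\le 3$) and $\mathcal D^{-1}$ with the relations $z^i_jz^i_k=q\,z^i_kz^i_j$ ($j<k$), $z^i_jz^k_j=q\,z^k_jz^i_j$ ($i<k$), $z^i_jz^k_l=z^k_lz^i_j$ ($i<k$, $j>l$), $z^i_jz^k_l=z^k_lz^i_j+(q-q^{-1})z^k_jz^i_l$ ($i<k$, $j<l$), and $\mathcal D\mathcal D^{-1}=\mathcal D^{-1}\mathcal D=1$, where $\mathcal D=z^1_1z^2_2z^3_3+q^2z^1_2z^2_3z^3_1+q^2z^1_3z^2_1z^3_2-qz^1_1z^2_3z^3_2-q^3z^1_3z^2_2z^3_1-qz^1_2z^2_1z^3_3$; the coproduct is $\Delta(z^i_j)=\sum_kz^i_k\otimes z^k_j$. Let $\mathcal B=\mathrm{Fun}_q(SL(3,\mathbb C))=\mathcal A/(\mathcal D-1)$ with the induced coproduct. A first order differential calculus $(\Gamma,\mathrm d)$ over an algebra $A$ is an $A$-bimodule with a linear map $\mathrm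 d:A\to\Gamma$ such that $\mathrm d(ab)=(\mathrm da)b+a\,\mathrm db$ and $\mathrm dA$ generates $\Gamma$ as a left module; two calculi are equivalent if a bimodule isomorphism intertwines the differentials. For a bialgebra $A$ it is bicovariant if there are linear maps $\Delta_L:\Gamma\to A\otimes\Gamma$, $\Delta_R:\Gamma\to\Gamma\otimes A$ with $\Delta_L(a\,\mathrm db)=\Delta(a)(\mathrm{id}\otimes\mathrm d)\Delta(b)$ and $\Delta_R(a\,\mathrm db)=\Delta(a)(\mathrm d\otimes\mathrm{id})\Delta(b)$. A calculus $\Gamma$ over $\mathcal A$ induces on $\mathcal B$ the quotient calculus obtained by dividing $\Gamma$ by the sub-bimodule generated by $(\mathcal D-1)\Gamma$, $\Gamma(\mathcal D-1)$ and $\mathrm d\mathcal D$. We say that $\Gamma$ *descends to $SL_q(3)$* (is consistent with $\mathcal D=1$, $\mathrm d\mathcal D=0$) if the induced calculus is bicovariant and the nine forms $\mathrm dz^i_j$ are a left $\mathcal B$-basis of it. Let $\theta^i_j=\sum_kS(z^i_k)\,\mathrm dz^k_j$, where $S(Z)$ is the inverse matrix of $Z=(z^i_j)$, and $T=q^4\theta^1_1+q^2\theta^2_2+\theta^3_3$.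 Call $t\in\mathbb C\setminus\{0\}$ admissible for $\nu=1$ if $(q^6+q^4+1)t\ne q^6+q^4+q^2$, and admissible for $\nu=2$ if $(q^6+q^2+1)t\ne q^4+q^2+1$. For admissible $t$, $\Gamma_\nu(t)$ denotes a bicovariant calculus over $\mathcal A$ in which the nine forms $\mathrm dz^i_j$ are a left $\mathcal A$-basis and the following relations hold. For $\nu=1$, with $N=q^4(q^2+1)(t-1)-q^2+t$, $\sigma=(q^2-t)(t-1)/N$, $\beta=t(q^2-1)(t-1)/N$: * $(\mathrm dz^i_j)z^i_j=(tq^{-2}+t-1)z^i_j\mathrm dz^i_j+\sigma z^i_jz^i_jT$; * $(\mathrm dz^i_j)z^k_l=tq^{-1}z^k_l\mathrm dz^i_j+(t-1)z^i_j\mathrm dz^k_l+\sigma z^i_jz^k_lT$ if $i=k$, $j<l$ or $i<k$, $j=l$; * $(\mathrm dz^i_j)z^k_l=tz^k_l\mathrm dz^i_j+(t-1)z^i_j\mathrm dz^k_l+\sigma z^i_jz^k_lT-\beta(z^i_jz^k_l-qz^i_lz^k_j)T$ if $i<k$, $j<l$; * $(\mathrm dz^i_j)z^k_l=tz^k_l\mathrm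 dz^i_j+(t-1)z^i_j\mathrm dz^k_l+\sigma z^i_jz^k_lT-t(q-q^{-1})z^k_j\mathrm dz^i_l+q\beta(z^i_lz^k_j-qz^i_jz^k_l)T$ if $i<k$, $j>l$. For $\nu=2$, with $\hat N=q^4(q^2t-1)+(q^2+1)(t-1)$, $\hat\sigma=-(q^2t-1)(t-1)/\hat N$, $\hat\beta=-t(q^2-1)(t-1)/\hat N$: * $(\mathrm dz^i_j)z^i_j=(tq^2+t-1)z^i_j\mathrm dz^i_j+\hat\sigma z^i_jz^i_jT$; * $(\mathrm dz^i_j)z^k_l=tq\,z^k_l\mathrm dz^i_j+(tq^2-1)z^i_j\mathrm dz^k_l+\hat\sigma z^i_jz^k_lT$ if $i=k$, $j<l$ or $i<k$, $j=l$; * $(\mathrm dz^i_j)z^k_l=tz^k_l\mathrm dz^i_j+(t-1)z^i_j\mathrm dz^k_l+\hat\sigma z^i_jz^k_lT+t(q-q^{-1})(z^i_l\mathrm dz^k_j+z^k_j\mathrm dz^i_l)+t(q-q^{-1})^2z^i_j\mathrm dz^k_l-q^{-2}\hat\beta(z^i_jz^k_l-qz^i_lz^k_j)T$ if $i<k$,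 $j<l$; * $(\mathrm dz^i_j)z^k_l=tz^k_l\mathrm dz^i_j+(t-1)z^i_j\mathrm dz^k_l+\hat\sigma z^i_jz^k_lT+t(q-q^{-1})z^i_l\mathrm dz^k_j+q^{-1}\hat\beta(z^i_lz^k_j-qz^i_jz^k_l)T$ if $i<k$, $j>l$. **Proposition.** 1. For $\nu=1,2$ and every admissible $t$ the calculus $\Gamma_\nu(t)$ exists and is unique up to equivalence. $\Gamma_1(t)$ descends to $SL_q(3)$ if and only if $t^3=q^2$, and $\Gamma_2(t)$ descends to $SL_q(3)$ if and only if $t^3=q^{-2}$; for all other admissible $t$ the induced calculus on $SL_q(3)$ is zero. 2. A bicovariant calculus over $\mathcal A$ that is generated by the $\mathrm dz^i_j$ as a left module descends to $SL_q(3)$ if and only if it is a $\Gamma_1(t)$ with $t$ admissible and $t^3=q^2$, or a $\Gamma_2(t)$ with $t$ admissible and $t^3=q^{-2}$. 3. The number of equivalence classes of bicovariant calculi on $SL_q(3,\mathbb C)$ with left basis $\mathrm dz^i_j$ that are induced by bicovariant calculi over $\mathcal A$ generated by the $\mathrm dz^i_j$ as left modules equals the number of admissible solutions $t$ of $t^3=q^2$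 (for $\nu=1$) plus the number of admissible solutions $t$ of $t^3=q^{-2}$ (for $\nu=2$). Hence for generic $q$, i.e. for all but finitely many $q\in\mathbb C\setminus\{0\}$, there are exactly six such calculi. -/

import Mathlib

set_option linter.unusedSimpArgs false
set_option linter.unreachableTactic false
set_option linter.unusedTactic false

open scoped TensorProduct

/-! ### Quantum matrices and the quantum determinant -/

/-- The commutation relations of the entries of a quantum `3 × 3` matrix
(rows and columns are numbered `0, 1, 2`). -/
structure IsQMatrix (q : ℂˣ) {R : Type*} [Ring R] [Algebra ℂ R]
    (z : Fin 3 → Fin 3 → R) : Prop where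
  row : ∀ i j k, j < k → z i j * z i k = (q : ℂ) • (z i k * z i j)
  col : ∀ i j k, i < k → z i j * z k j = (q : ℂ) • (z k j * z i j)
  comm : ∀ i j k l, i < k → l < j → z i j * z k l = z k l * z i j
  cross : ∀ i j k l, i < k → j < l →
    z i j * z k l = z k l * z i j + ((q : ℂ) - (q : ℂ)⁻¹) • (z k j * z i l)

/-- The quantum determinant. -/
def qDet (q : ℂˣ) {R : Type*} [Ring R] [Algebra ℂ R] (z : Fin 3 → Fin 3 → R) : R :=
  z 0 0 * z 1 1 * z 2 2
    + (q : ℂ) ^ 2 • (z 0 1 * z 1 2 * z 2 0)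
    + (q : ℂ) ^ 2 • (z 0 2 * z 1 0 * z 2 1)
    - (q : ℂ) • (z 0 0 * z 1 2 * z 2 1)
    - (q : ℂ) ^ 3 • (z 0 2 * z 1 1 * z 2 0)
    - (q : ℂ) • (z 0 1 * z 1 0 * z 2 2)

section QMatrixLemmas

variable {q : ℂˣ} {R : Type*} [Ring R] [Algebra ℂ R] {z w : Fin 3 → Fin 3 → R}

theorem IsQMatrix.row' (h : IsQMatrix q z) (i j k : Fin 3) (hjk : j < k) :
    z i k * z i j = (q : ℂ)⁻¹ • (z i j * z i k) := by
  rw [h.row i j k hjk, smul_smul, inv_mul_cancel₀ q.ne_zero, one_smul]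

theorem IsQMatrix.col' (h : IsQMatrix q z) (i j k : Fin 3) (hik : i < k) :
    z k j * z i j = (q : ℂ)⁻¹ • (z i j * z k j) := by
  rw [h.col i j k hik, smul_smul, inv_mul_cancel₀ q.ne_zero, one_smul]

theorem IsQMatrix.comm' (h : IsQMatrix q z) (i j k l : Fin 3) (hik : i < k) (hlj : l < j) :
    z k l * z i j = z i j * z k l := (h.comm i j k l hik hlj).symm

theorem IsQMatrix.cross' (h : IsQMatrix q z) (i j k l : Fin 3) (hik : i < k) (hjl : j < l) :
    z k l * z i j = z i j * z k l - ((q : ℂ) - (q : ℂ)⁻¹) • (z i l * z k j) := by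
  rw [h.cross i j k l hik hjl, h.comm i l k j hik hjl]; abel

theorem QMatrix.assoc_rw {R : Type*} [Ring R] {a b c : R} (h : a * b = c) (r : R) : a * (b * r) = c * r := by
  rw [← mul_assoc, h]

theorem QMatrix.fin3 (i : Fin 3) : i = 0 ∨ i = 1 ∨ i = 2 := by
  revert i; decide


set_option maxHeartbeats 4000000 in
theorem IsQMatrix.mul (hz : IsQMatrix q z) (hw : IsQMatrix q w)
    (hc : ∀ i j k l, w k l * z i j = z i j * w k l) :
    IsQMatrix q (fun i j => ∑ k, z i k * w k j) := by
  have hq := q.ne_zero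
  have hc' := fun i j k l => QMatrix.assoc_rw (hc i j k l)
  have z1 := fun i j k h => QMatrix.assoc_rw (hz.row' i j k h)
  have z2 := fun i j k h => QMatrix.assoc_rw (hz.col' i j k h)
  have z3 := fun i j k l h h' => QMatrix.assoc_rw (hz.comm' i j k l h h')
  have z4 := fun i j k l h h' => QMatrix.assoc_rw (hz.cross' i j k l h h')
  have w1 := hw.row'
  have w2 := hw.col'
  have w30101 := hw.comm' 0 1 1 0 (by decide) (by decide)
  have w30102 := hw.comm' 0 2 1 0 (by decide) (by decide)
  have w30112 := hw.comm' 0 2 1 1 (by decide) (by decide)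
  have w30201 := hw.comm' 0 1 2 0 (by decide) (by decide)
  have w30202 := hw.comm' 0 2 2 0 (by decide) (by decide)
  have w30212 := hw.comm' 0 2 2 1 (by decide) (by decide)
  have w31201 := hw.comm' 1 1 2 0 (by decide) (by decide)
  have w31202 := hw.comm' 1 2 2 0 (by decide) (by decide)
  have w31212 := hw.comm' 1 2 2 1 (by decide) (by decide)
  have w4 := hw.cross'
  constructor
  · intro i j k hjk
    rcases QMatrix.fin3 i with rfl | rfl | rfl <;> rcases QMatrix.fin3 j with rfl | rfl | rfl <;> rcases QMatrix.fin3 k with rfl | rfl | rfl <;>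
      first
      | exact absurd hjk (by decide)
      | (simp (disch := decide) only [          Fin.sum_univ_three, add_mul, mul_add, mul_assoc, hc', z1, z2, z3, z4, w1, w2, w4,
          w30101, w30102, w30112, w30201, w30202, w30212, w31201, w31202, w31212,
          smul_mul_assoc, mul_smul_comm, smul_add, smul_sub, mul_sub, sub_mul, smul_smul]
         match_scalars <;> field_simp <;> ring)
  · intro i j k hik
    rcases QMatrix.fin3 i with rfl | rfl | rfl <;> rcases QMatrix.fin3 j with rfl | rfl | rfl <;> rcases QMatrix.fin3 k with rfl | rfl | rfl <;>
      first
      | exact absurd hik (by decide)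
      | (simp (disch := decide) only [          Fin.sum_univ_three, add_mul, mul_add, mul_assoc, hc', z1, z2, z3, z4, w1, w2, w4,
          w30101, w30102, w30112, w30201, w30202, w30212, w31201, w31202, w31212,
          smul_mul_assoc, mul_smul_comm, smul_add, smul_sub, mul_sub, sub_mul, smul_smul]
         match_scalars <;> field_simp <;> ring)
  · intro i j k l hik hlj
    rcases QMatrix.fin3 i with rfl | rfl | rfl <;> rcases QMatrix.fin3 k with rfl | rfl | rfl <;> first
      | exact absurd hik (by decide)
      | (rcases QMatrix.fin3 j with rfl | rfl | rfl <;> rcases QMatrix.fin3 l with rfl | rfl | rfl <;> first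
          | exact absurd hlj (by decide)
          | (simp (disch := decide) only [              Fin.sum_univ_three, add_mul, mul_add, mul_assoc, hc', z1, z2, z3, z4, w1, w2, w4,
          w30101, w30102, w30112, w30201, w30202, w30212, w31201, w31202, w31212,
              smul_mul_assoc, mul_smul_comm, smul_add, smul_sub, mul_sub, sub_mul, smul_smul]
             match_scalars <;> field_simp <;> ring))
  · intro i j k l hik hlj
    rcases QMatrix.fin3 i with rfl | rfl | rfl <;> rcases QMatrix.fin3 k with rfl | rfl | rfl <;> first
      | exact absurd hik (by decide)
      | (rcases QMatrix.fin3 j with rfl | rfl | rfl <;> rcases QMatrix.fin3 l with rfl | rfl | rfl <;> first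
          | exact absurd hlj (by decide)
          | (simp (disch := decide) only [              Fin.sum_univ_three, add_mul, mul_add, mul_assoc, hc', z1, z2, z3, z4, w1, w2, w4,
          w30101, w30102, w30112, w30201, w30202, w30212, w31201, w31202, w31212,
              smul_mul_assoc, mul_smul_comm, smul_add, smul_sub, mul_sub, sub_mul, smul_smul]
             match_scalars <;> field_simp <;> ring))

/-- The `q`-determinant of the matrix with rows `a`, `b`, `c` of a `q`-matrix. -/
theorem IsQMatrix.qDet_rows (h : IsQMatrix q w) (a b c : Fin 3) :
    qDet q (fun i => w (![a, b, c] i)) =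
      (if (a, b, c) = (0, 1, 2) then 1 else if (a, b, c) = (1, 2, 0) then (q : ℂ) ^ 2 else
        if (a, b, c) = (2, 0, 1) then (q : ℂ) ^ 2 else if (a, b, c) = (0, 2, 1) then -(q : ℂ) else
        if (a, b, c) = (2, 1, 0) then -(q : ℂ) ^ 3 else
        if (a, b, c) = (1, 0, 2) then -(q : ℂ) else 0) • qDet q w := by
  have hq := q.ne_zero
  have z1 := fun i j k h' => QMatrix.assoc_rw (h.row' i j k h')
  have z2 := fun i j k h' => QMatrix.assoc_rw (h.col' i j k h')
  have z3 := fun i j k l h' h'' => QMatrix.assoc_rw (h.comm' i j k l h' h'')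
  have z4 := fun i j k l h' h'' => QMatrix.assoc_rw (h.cross' i j k l h' h'')
  have w1 := h.row'
  have w2 := h.col'
  have w30101 := h.comm' 0 1 1 0 (by decide) (by decide)
  have w30102 := h.comm' 0 2 1 0 (by decide) (by decide)
  have w30112 := h.comm' 0 2 1 1 (by decide) (by decide)
  have w30201 := h.comm' 0 1 2 0 (by decide) (by decide)
  have w30202 := h.comm' 0 2 2 0 (by decide) (by decide)
  have w30212 := h.comm' 0 2 2 1 (by decide) (by decide)
  have w31201 := h.comm' 1 1 2 0 (by decide) (by decide)
  have w31202 := h.comm' 1 2 2 0 (by decide) (by decide)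
  have w31212 := h.comm' 1 2 2 1 (by decide) (by decide)
  have w4 := h.cross'
  rcases QMatrix.fin3 a with rfl | rfl | rfl <;> rcases QMatrix.fin3 b with rfl | rfl | rfl <;> rcases QMatrix.fin3 c with rfl | rfl | rfl <;>
    (simp [qDet]
     try simp (disch := decide) only [mul_assoc, z1, z2, z3, z4, w1, w2, w4,
          w30101, w30102, w30112, w30201, w30202, w30212, w31201, w31202, w31212, smul_mul_assoc,
       mul_smul_comm, smul_add, smul_sub, mul_sub, sub_mul, smul_smul]
     try (match_scalars <;> field_simp <;> try ring))

theorem qDet_mul_aux (hc : ∀ i j k l, w k l * z i j = z i j * w k l) :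
    qDet q (fun i j => ∑ k, z i k * w k j) =
      ∑ a, ∑ b, ∑ c, z 0 a * z 1 b * z 2 c * qDet q (fun i => w (![a, b, c] i)) := by
  have hc' := fun i j k l => QMatrix.assoc_rw (hc i j k l)
  simp only [qDet, Fin.sum_univ_three, add_mul, mul_add, mul_assoc, hc', smul_mul_assoc,
    mul_smul_comm, smul_add, mul_sub, Matrix.cons_val_zero, Matrix.cons_val_one,
    Matrix.cons_val]
  abel

theorem IsQMatrix.qDet_mul (hw : IsQMatrix q w)
    (hc : ∀ i j k l, w k l * z i j = z i j * w k l) :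
    qDet q (fun i j => ∑ k, z i k * w k j) = qDet q z * qDet q w := by
  rw [qDet_mul_aux hc]
  simp only [hw.qDet_rows, Fin.sum_univ_three]
  generalize qDet q w = X
  simp [qDet, add_mul, sub_mul]
  abel

theorem map_qDet {S : Type*} [Ring S] [Algebra ℂ S] (f : R →ₐ[ℂ] S) :
    f (qDet q z) = qDet q (fun i j => f (z i j)) := by
  simp [qDet]

theorem IsQMatrix.map {S : Type*} [Ring S] [Algebra ℂ S] (f : R →ₐ[ℂ] S)
    (h : IsQMatrix q z) : IsQMatrix q (fun i j => f (z i j)) where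
  row i j k hjk := by rw [← map_mul, h.row i j k hjk, map_smul, map_mul]
  col i j k hik := by rw [← map_mul, h.col i j k hik, map_smul, map_mul]
  comm i j k l hik hlj := by rw [← map_mul, h.comm i j k l hik hlj, map_mul]
  cross i j k l hik hjl := by
    rw [← map_mul, h.cross i j k l hik hjl, map_add, map_smul, map_mul, map_mul]

theorem isQMatrix_one : IsQMatrix q (fun i j : Fin 3 => if i = j then (1 : ℂ) else 0) where
  row i j k h := by
    rcases eq_or_ne i j with rfl | hij
    · simp [h.ne]
    · simp [hij]
  col i j k h := by
    rcases eq_or_ne i j with rfl | hij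
    · simp [h.ne']
    · simp [hij]
  comm i j k l h h' := mul_comm _ _
  cross i j k l h h' := by
    have : ¬ (k = j ∧ i = l) := by rintro ⟨rfl, rfl⟩; exact lt_asymm h h'
    have h0 : (if k = j then (1 : ℂ) else 0) * (if i = l then 1 else 0) = 0 := by
      by_cases hk : k = j
      · have : i ≠ l := fun hl => this ⟨hk, hl⟩
        simp [this]
      · simp [hk]
    rw [h0, smul_zero, add_zero, mul_comm]

theorem qDet_one : qDet q (fun i j : Fin 3 => if i = j then (1 : ℂ) else 0) = 1 := by
  simp [qDet]

end QMatrixLemmas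

/-! ### The quantum groups `GL_q(3)` and `SL_q(3)` -/

/-- Generators of `Fun_q(GL(3, ℂ))`: the nine matrix entries and the inverse determinant. -/
inductive GLGen : Type
  | entry (i j : Fin 3) : GLGen
  | detInv : GLGen

/-- The defining relations of `Fun_q(GL(3, ℂ))`. -/
inductive GLRel (q : ℂˣ) : FreeAlgebra ℂ GLGen → FreeAlgebra ℂ GLGen → Prop
  | row (i j k : Fin 3) (h : j < k) : GLRel q
      (.ι ℂ (.entry i j) * .ι ℂ (.entry i k))
      ((q : ℂ) • (.ι ℂ (.entry i k) * .ι ℂ (.entry i j)))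
  | col (i j k : Fin 3) (h : i < k) : GLRel q
      (.ι ℂ (.entry i j) * .ι ℂ (.entry k j))
      ((q : ℂ) • (.ι ℂ (.entry k j) * .ι ℂ (.entry i j)))
  | comm (i j k l : Fin 3) (h : i < k) (h' : l < j) : GLRel q
      (.ι ℂ (.entry i j) * .ι ℂ (.entry k l))
      (.ι ℂ (.entry k l) * .ι ℂ (.entry i j))
  | cross (i j k l : Fin 3) (h : i < k) (h' : j < l) : GLRel q
      (.ι ℂ (.entry i j) * .ι ℂ (.entry k l))
      (.ι ℂ (.entry k l) * .ι ℂ (.entry i j) +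
        ((q : ℂ) - (q : ℂ)⁻¹) • (.ι ℂ (.entry k j) * .ι ℂ (.entry i l)))
  | det_mul_detInv : GLRel q
      (qDet q (fun i j => .ι ℂ (.entry i j)) * .ι ℂ .detInv) 1
  | detInv_mul_det : GLRel q
      (.ι ℂ .detInv * qDet q (fun i j => .ι ℂ (.entry i j))) 1

/-- The algebra `Fun_q(GL(3, ℂ))`. -/
def GLq (q : ℂˣ) : Type := RingQuot (GLRel q)

namespace GLq

variable (q : ℂˣ)

instance : Ring (GLq q) := inferInstanceAs (Ring (RingQuot (GLRel q)))
instance : Algebra ℂ (GLq q) := inferInstanceAs (Algebra ℂ (RingQuot (GLRel q)))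

/-- The quotient map from the free algebra. -/
def mk : FreeAlgebra ℂ GLGen →ₐ[ℂ] GLq q := RingQuot.mkAlgHom ℂ (GLRel q)

/-- The generators `z i j`. -/
def z (i j : Fin 3) : GLq q := mk q (.ι ℂ (.entry i j))

/-- The quantum determinant of `GL_q(3)`. -/
def det : GLq q := qDet q (z q)

/-- The inverse of the quantum determinant. -/
def detInv : GLq q := mk q (.ι ℂ .detInv)

variable {q}

theorem mk_rel {x y : FreeAlgebra ℂ GLGen} (h : GLRel q x y) : mk q x = mk q y :=
  RingQuot.mkAlgHom_rel ℂ h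

theorem isQMatrix : IsQMatrix q (z q) where
  row i j k h := by simpa [z] using mk_rel (.row i j k h)
  col i j k h := by simpa [z] using mk_rel (.col i j k h)
  comm i j k l h h' := by simpa [z] using mk_rel (.comm i j k l h h')
  cross i j k l h h' := by simpa [z] using mk_rel (.cross i j k l h h')

theorem det_eq : mk q (qDet q (fun i j => .ι ℂ (.entry i j))) = det q := map_qDet _

theorem det_mul_detInv : det q * detInv q = 1 := by
  have := mk_rel (q := q) .det_mul_detInv
  rwa [map_mul, det_eq, map_one] at this

theorem detInv_mul_det : detInv q * det q = 1 := by
  have := mk_rel (q := q) .detInv_mul_det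
  rwa [map_mul, det_eq, map_one] at this

section Lift

variable {R : Type*} [Ring R] [Algebra ℂ R]

/-- The values of an algebra map on the generators. -/
def genMap (w : Fin 3 → Fin 3 → R) (e : R) : GLGen → R
  | .entry i j => w i j
  | .detInv => e

variable (w : Fin 3 → Fin 3 → R) (e : R)
  (hw : IsQMatrix q w) (h₁ : qDet q w * e = 1) (h₂ : e * qDet q w = 1)

theorem lift_aux {R : Type*} [Ring R] [Algebra ℂ R] (w : Fin 3 → Fin 3 → R) (e : R)
    (hw : IsQMatrix q w) (h₁ : qDet q w * e = 1) (h₂ : e * qDet q w = 1) ⦃x y : FreeAlgebra ℂ GLGen⦄ (h : GLRel q x y) :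
    FreeAlgebra.lift ℂ (genMap w e) x = FreeAlgebra.lift ℂ (genMap w e) y := by
  induction h with
  | row i j k h => simpa [genMap] using hw.row i j k h
  | col i j k h => simpa [genMap] using hw.col i j k h
  | comm i j k l h h' => simpa [genMap] using hw.comm i j k l h h'
  | cross i j k l h h' => simpa [genMap] using hw.cross i j k l h h'
  | det_mul_detInv => simpa [genMap, map_qDet] using h₁
  | detInv_mul_det => simpa [genMap, map_qDet] using h₂

/-- The algebra map given by a quantum matrix with invertible quantum determinant. -/
def lift : GLq q →ₐ[ℂ] R :=
  RingQuot.liftAlgHom ℂ ⟨FreeAlgebra.lift ℂ (genMap w e), lift_aux w e hw h₁ h₂⟩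

@[simp] theorem lift_z (i j : Fin 3) : lift w e hw h₁ h₂ (z q i j) = w i j := by
  refine (RingQuot.liftAlgHom_mkAlgHom_apply ℂ (FreeAlgebra.lift ℂ (genMap w e))
    (lift_aux w e hw h₁ h₂) _).trans ?_
  simp [genMap]

@[simp] theorem lift_detInv : lift w e hw h₁ h₂ (detInv q) = e := by
  refine (RingQuot.liftAlgHom_mkAlgHom_apply ℂ (FreeAlgebra.lift ℂ (genMap w e))
    (lift_aux w e hw h₁ h₂) _).trans ?_
  simp [genMap]

end Lift

theorem algHom_ext {R : Type*} [Ring R] [Algebra ℂ R] {f g : GLq q →ₐ[ℂ] R}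
    (h : ∀ i j, f (z q i j) = g (z q i j)) (h' : f (detInv q) = g (detInv q)) : f = g := by
  apply RingQuot.ringQuot_ext'
  apply FreeAlgebra.hom_ext
  funext x
  cases x with
  | entry i j => exact h i j
  | detInv => exact h'

theorem comul_isQMatrix :
    IsQMatrix q (fun i j => ∑ k, (z q i k ⊗ₜ[ℂ] z q k j : GLq q ⊗[ℂ] GLq q)) := by
  simpa using (isQMatrix.map (Algebra.TensorProduct.includeLeft (S := ℂ) (B := GLq q))).mul
    (isQMatrix.map (Algebra.TensorProduct.includeRight (A := GLq q))) (by simp)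

theorem comul_qDet :
    qDet q (fun i j => ∑ k, (z q i k ⊗ₜ[ℂ] z q k j : GLq q ⊗[ℂ] GLq q)) =
      det q ⊗ₜ det q := by
  have := (isQMatrix.map (Algebra.TensorProduct.includeRight (R := ℂ) (A := GLq q))).qDet_mul
    (q := q) (z := fun i j => Algebra.TensorProduct.includeLeft (R := ℂ) (S := ℂ) (B := GLq q)
      (z q i j)) (by simp)
  rw [← map_qDet, ← map_qDet] at this
  simpa [det] using this

variable (q)

/-- The coproduct `z i j ↦ ∑ k, z i k ⊗ z k j`. -/
def comulHom : GLq q →ₐ[ℂ] GLq q ⊗[ℂ] GLq q :=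
  lift (fun i j => ∑ k, z q i k ⊗ₜ z q k j) (detInv q ⊗ₜ detInv q) comul_isQMatrix
    (by rw [comul_qDet]; simp [det_mul_detInv, Algebra.TensorProduct.one_def])
    (by rw [comul_qDet]; simp [detInv_mul_det, Algebra.TensorProduct.one_def])

/-- The counit `z i j ↦ δ i j`. -/
def counitHom : GLq q →ₐ[ℂ] ℂ :=
  lift (fun i j => if i = j then 1 else 0) 1 isQMatrix_one (by rw [qDet_one, mul_one])
    (by rw [qDet_one, mul_one])

variable {q} in
theorem comulHom_det : comulHom q (det q) = det q ⊗ₜ det q := by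
  rw [← comul_qDet, det, map_qDet]
  simp [comulHom]

variable {q} in
theorem counitHom_det : counitHom q (det q) = 1 := by
  rw [det, map_qDet]
  simpa [counitHom] using qDet_one

@[simp] theorem comulHom_z (i j : Fin 3) :
    comulHom q (z q i j) = ∑ k, z q i k ⊗ₜ z q k j := by
  simp [comulHom]

@[simp] theorem counitHom_z (i j : Fin 3) :
    counitHom q (z q i j) = if i = j then 1 else 0 := by
  simp [counitHom]

noncomputable instance : Bialgebra ℂ (GLq q) :=
  Bialgebra.ofAlgHom (comulHom q) (counitHom q)
    (by
      apply algHom_ext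
      · intro i j
        simp [comulHom, Fin.sum_univ_three, TensorProduct.add_tmul, TensorProduct.tmul_add]
        abel
      · simp [comulHom])
    (by
      apply algHom_ext
      · intro i j
        simp [comulHom, counitHom, TensorProduct.ite_tmul]
      · simp [comulHom, counitHom])
    (by
      apply algHom_ext
      · intro i j
        simp [comulHom, counitHom, TensorProduct.tmul_ite]
      · simp [comulHom, counitHom])

end GLq

open scoped RightActions

/-- The defining relation `D = 1` of `Fun_q(SL(3, ℂ))` as a quotient of `Fun_q(GL(3, ℂ))`. -/
inductive SLRel (q : ℂˣ) : GLq q → GLq q → Prop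
  | det_eq_one : SLRel q (GLq.det q) 1

/-- The algebra `Fun_q(SL(3, ℂ))`. -/
def SLq (q : ℂˣ) : Type := RingQuot (SLRel q)

namespace SLq

variable (q : ℂˣ)

instance : Ring (SLq q) := inferInstanceAs (Ring (RingQuot (SLRel q)))
instance : Algebra ℂ (SLq q) := inferInstanceAs (Algebra ℂ (RingQuot (SLRel q)))

/-- The quotient map `Fun_q(GL(3, ℂ)) → Fun_q(SL(3, ℂ))`. -/
def proj : GLq q →ₐ[ℂ] SLq q := RingQuot.mkAlgHom ℂ (SLRel q)

/-- The generators `z i j` of `SL_q(3)`. -/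
def z (i j : Fin 3) : SLq q := proj q (GLq.z q i j)

variable {q}

theorem proj_det : proj q (GLq.det q) = 1 := by
  have := RingQuot.mkAlgHom_rel ℂ (SLRel.det_eq_one (q := q))
  exact this.trans (map_one _)

/-- Algebra maps out of `SL_q(3)` are algebra maps out of `GL_q(3)` with `D ↦ 1`. -/
def lift {R : Type*} [Ring R] [Algebra ℂ R] (f : GLq q →ₐ[ℂ] R) (hf : f (GLq.det q) = 1) :
    SLq q →ₐ[ℂ] R :=
  RingQuot.liftAlgHom ℂ ⟨f, by rintro _ _ ⟨⟩; rw [hf, map_one]⟩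

theorem lift_comp_proj {R : Type*} [Ring R] [Algebra ℂ R] (f : GLq q →ₐ[ℂ] R)
    (hf : f (GLq.det q) = 1) : (lift f hf).comp (proj q) = f := by
  ext x
  exact RingQuot.liftAlgHom_mkAlgHom_apply ℂ f _ x

@[simp] theorem lift_proj {R : Type*} [Ring R] [Algebra ℂ R] (f : GLq q →ₐ[ℂ] R)
    (hf : f (GLq.det q) = 1) (x : GLq q) : lift f hf (proj q x) = f x :=
  DFunLike.congr_fun (lift_comp_proj f hf) x

theorem algHom_ext {R : Type*} [Ring R] [Algebra ℂ R] {f g : SLq q →ₐ[ℂ] R}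
    (h : ∀ i j, f (z q i j) = g (z q i j)) : f = g := by
  apply RingQuot.ringQuot_ext'
  change f.comp (proj q) = g.comp (proj q)
  have hz : ∀ i j, (f.comp (proj q)) (GLq.z q i j) = (g.comp (proj q)) (GLq.z q i j) := h
  apply GLq.algHom_ext hz
  have hdet : proj q (GLq.detInv q) = 1 := by
    have := congrArg (proj q) (GLq.det_mul_detInv (q := q))
    rwa [map_mul, proj_det, one_mul, map_one] at this
  simp [hdet]

variable (q)

/-- The coproduct of `SL_q(3)`, induced by that of `GL_q(3)`. -/
def comulHom : SLq q →ₐ[ℂ] SLq q ⊗[ℂ] SLq q :=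
  lift ((Algebra.TensorProduct.map (proj q) (proj q)).comp (GLq.comulHom q)) (by
    simp [GLq.comulHom_det, proj_det, Algebra.TensorProduct.one_def])

/-- The counit of `SL_q(3)`, induced by that of `GL_q(3)`. -/
def counitHom : SLq q →ₐ[ℂ] ℂ := lift (GLq.counitHom q) GLq.counitHom_det

@[simp] theorem comulHom_z (i j : Fin 3) :
    comulHom q (z q i j) = ∑ k, z q i k ⊗ₜ z q k j := by
  simp [comulHom, z]

@[simp] theorem counitHom_z (i j : Fin 3) :
    counitHom q (z q i j) = if i = j then 1 else 0 := by
  simp [counitHom, z]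

noncomputable instance : Bialgebra ℂ (SLq q) :=
  Bialgebra.ofAlgHom (comulHom q) (counitHom q)
    (by
      apply algHom_ext
      intro i j
      simp [Fin.sum_univ_three, TensorProduct.add_tmul, TensorProduct.tmul_add]
      abel)
    (by
      apply algHom_ext
      intro i j
      simp [TensorProduct.ite_tmul])
    (by
      apply algHom_ext
      intro i j
      simp [TensorProduct.tmul_ite])

end SLq

/-! ### First order differential calculi -/

/-- A first order differential calculus over a complex algebra `A`: an `A`-bimodule with a
linear map `d` satisfying the Leibniz rule, generated by the image of `d` as a left module.
The right multiplication is an action of `Aᵐᵒᵖ`, written `ω <• a`. -/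
structure FODC (A : Type) [Ring A] [Algebra ℂ A] where
  /-- The bimodule of one-forms. -/
  Form : Type
  [addCommGroup : AddCommGroup Form]
  [module : Module ℂ Form]
  [leftModule : Module A Form]
  [rightModule : Module Aᵐᵒᵖ Form]
  [leftTower : IsScalarTower ℂ A Form]
  [rightTower : IsScalarTower ℂ Aᵐᵒᵖ Form]
  [bimodule : SMulCommClass A Aᵐᵒᵖ Form]
  /-- The differential. -/
  d : A →ₗ[ℂ] Form
  leibniz : ∀ a b : A, d (a * b) = d a <• b + a • d b
  span_d : Submodule.span A (Set.range d) = ⊤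

attribute [instance] FODC.addCommGroup FODC.module FODC.leftModule FODC.rightModule
  FODC.leftTower FODC.rightTower FODC.bimodule

namespace FODC

section

variable {A : Type} [Ring A] [Algebra ℂ A]

/-- Equivalence of calculi: a bimodule isomorphism that intertwines the differentials. -/
def Equivalent (Γ Γ' : FODC A) : Prop :=
  ∃ ζ : Γ.Form ≃ₗ[A] Γ'.Form,
    (∀ (ω : Γ.Form) (a : A), ζ (ω <• a) = ζ ω <• a) ∧ ∀ a : A, ζ (Γ.d a) = Γ'.d a

/-- Calculi up to equivalence. -/
instance setoid (A : Type) [Ring A] [Algebra ℂ A] : Setoid (FODC A) where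
  r := Equivalent
  iseqv :=
    { refl := fun Γ => ⟨LinearEquiv.refl A Γ.Form, fun _ _ => rfl, fun _ => rfl⟩
      symm := by
        rintro Γ Γ' ⟨ζ, h, h'⟩
        refine ⟨ζ.symm, fun ω a => ?_, fun a => ?_⟩
        · rw [LinearEquiv.symm_apply_eq, h, LinearEquiv.apply_symm_apply]
        · rw [LinearEquiv.symm_apply_eq, h']
      trans := by
        rintro Γ Γ' Γ'' ⟨ζ, h, h'⟩ ⟨ξ, k, k'⟩
        exact ⟨ζ.trans ξ, fun ω a => by simp [h, k], fun a => by simp [h', k']⟩ }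

/-- The forms `dx`, for `x` in the family `x`, generate the one-forms as a left module. -/
def GeneratedBy (Γ : FODC A) {ι : Type} (x : ι → A) : Prop :=
  Submodule.span A (Set.range fun i => Γ.d (x i)) = ⊤

/-- The forms `dx`, for `x` in the family `x`, are a basis of the one-forms as a left module. -/
def HasBasis (Γ : FODC A) {ι : Type} (x : ι → A) : Prop :=
  LinearIndependent A (fun i => Γ.d (x i)) ∧ Γ.GeneratedBy x

end

section

variable {A : Type} [Ring A] [Bialgebra ℂ A]

/-- The product `(a ⊗ b) (c ⊗ ω) = a c ⊗ b ω` of `A ⊗ A` and `A ⊗ Γ`. -/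
noncomputable def mulLeft (Γ : FODC A) :
    A ⊗[ℂ] A →ₗ[ℂ] A ⊗[ℂ] Γ.Form →ₗ[ℂ] A ⊗[ℂ] Γ.Form :=
  TensorProduct.map₂ (LinearMap.mul ℂ A) (Algebra.lsmul ℂ ℂ Γ.Form).toLinearMap

/-- The product `(a ⊗ b) (ω ⊗ c) = a ω ⊗ b c` of `A ⊗ A` and `Γ ⊗ A`. -/
noncomputable def mulRight (Γ : FODC A) :
    A ⊗[ℂ] A →ₗ[ℂ] Γ.Form ⊗[ℂ] A →ₗ[ℂ] Γ.Form ⊗[ℂ] A :=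
  TensorProduct.map₂ (Algebra.lsmul ℂ ℂ Γ.Form).toLinearMap (LinearMap.mul ℂ A)

/-- Bicovariance: there are linear maps `Δ_L : Γ → A ⊗ Γ` and `Δ_R : Γ → Γ ⊗ A` with
`Δ_L (a db) = Δ(a) (id ⊗ d)Δ(b)` and `Δ_R (a db) = Δ(a) (d ⊗ id)Δ(b)`. -/
def Bicovariant (Γ : FODC A) : Prop :=
  (∃ ΔL : Γ.Form →ₗ[ℂ] A ⊗[ℂ] Γ.Form, ∀ a b : A,
    ΔL (a • Γ.d b) = Γ.mulLeft (Coalgebra.comul a) (Γ.d.lTensor A (Coalgebra.comul b))) ∧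
  ∃ ΔR : Γ.Form →ₗ[ℂ] Γ.Form ⊗[ℂ] A, ∀ a b : A,
    ΔR (a • Γ.d b) = Γ.mulRight (Coalgebra.comul a) (Γ.d.rTensor A (Coalgebra.comul b))

end

end FODC

/-! ### Calculi on `GL_q(3)` and the two families -/

/-- The matrix entries of `GL_q(3)` as a family of nine elements. -/
def GLq.entries (q : ℂˣ) (p : Fin 3 × Fin 3) : GLq q := GLq.z q p.1 p.2

/-- The matrix entries of `SL_q(3)` as a family of nine elements. -/
def SLq.entries (q : ℂˣ) (p : Fin 3 × Fin 3) : SLq q := SLq.z q p.1 p.2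

/-- The entries of the antipode matrix `S(Z)`. -/
noncomputable def GLq.antipodeZ (q : ℂˣ) (i j : Fin 3) : GLq q :=
  let z := GLq.z q
  let c : ℂ := q
  GLq.detInv q *
    (!![z 1 1 * z 2 2 - c • (z 1 2 * z 2 1),
        -(c⁻¹ • (z 0 1 * z 2 2)) + z 0 2 * z 2 1,
        c⁻¹ ^ 2 • (z 0 1 * z 1 2) - c⁻¹ • (z 0 2 * z 1 1);
        -(c • (z 1 0 * z 2 2)) + c ^ 2 • (z 1 2 * z 2 0),
        z 0 0 * z 2 2 - c • (z 0 2 * z 2 0),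
        -(c⁻¹ • (z 0 0 * z 1 2)) + z 0 2 * z 1 0;
        c ^ 2 • (z 1 0 * z 2 1) - c ^ 3 • (z 1 1 * z 2 0),
        -(c • (z 0 0 * z 2 1)) + c ^ 2 • (z 0 1 * z 2 0),
        z 0 0 * z 1 1 - c • (z 0 1 * z 1 0)] : Matrix (Fin 3) (Fin 3) (GLq q)) i j

namespace FODC

variable {q : ℂˣ}

/-- The Maurer-Cartan forms `θ i j = ∑ k, S(z i k) dz k j`. -/
noncomputable def theta (Γ : FODC (GLq q)) (i j : Fin 3) : Γ.Form :=
  ∑ k, GLq.antipodeZ q i k • Γ.d (GLq.z q k j)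

/-- The form `Tr_q θ`. -/
noncomputable def trTheta (Γ : FODC (GLq q)) : Γ.Form :=
  (q : ℂ) ^ 4 • Γ.theta 0 0 + (q : ℂ) ^ 2 • Γ.theta 1 1 + Γ.theta 2 2

/-- The coefficient `σ` of the first family. -/
noncomputable def sigma₁ (q : ℂˣ) (t : ℂ) : ℂ :=
  ((q : ℂ) ^ 2 - t) * (t - 1) / ((q : ℂ) ^ 4 * ((q : ℂ) ^ 2 + 1) * (t - 1) - (q : ℂ) ^ 2 + t)

/-- The coefficient `β` of the first family. -/
noncomputable def beta₁ (q : ℂˣ) (t : ℂ) : ℂ :=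
  t * ((q : ℂ) ^ 2 - 1) * (t - 1) /
    ((q : ℂ) ^ 4 * ((q : ℂ) ^ 2 + 1) * (t - 1) - (q : ℂ) ^ 2 + t)

/-- The coefficient `σ` of the second family. -/
noncomputable def sigma₂ (q : ℂˣ) (t : ℂ) : ℂ :=
  -(((q : ℂ) ^ 2 * t - 1) * (t - 1) /
    ((q : ℂ) ^ 4 * ((q : ℂ) ^ 2 * t - 1) + ((q : ℂ) ^ 2 + 1) * (t - 1)))

/-- The coefficient `β` of the second family. -/
noncomputable def beta₂ (q : ℂˣ) (t : ℂ) : ℂ :=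
  -(t * ((q : ℂ) ^ 2 - 1) * (t - 1) /
    ((q : ℂ) ^ 4 * ((q : ℂ) ^ 2 * t - 1) + ((q : ℂ) ^ 2 + 1) * (t - 1)))

/-- The admissible parameters of the first family. -/
def Admissible₁ (q : ℂˣ) (t : ℂ) : Prop :=
  t ≠ 0 ∧ ((q : ℂ) ^ 6 + (q : ℂ) ^ 4 + 1) * t - ((q : ℂ) ^ 6 + (q : ℂ) ^ 4 + (q : ℂ) ^ 2) ≠ 0

/-- The admissible parameters of the second family. -/
def Admissible₂ (q : ℂˣ) (t : ℂ) : Prop :=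
  t ≠ 0 ∧ ((q : ℂ) ^ 6 + (q : ℂ) ^ 2 + 1) * t - ((q : ℂ) ^ 4 + (q : ℂ) ^ 2 + 1) ≠ 0

/-- `Γ` is (a copy of) the calculus `Γ₁(t)` on `GL_q(3)`: it is bicovariant, the nine forms
`dz i j` are a left basis, and the commutation relations between the forms `dz i j` and the
generators `z k l` are those of the first family. -/
structure IsGamma₁ (t : ℂ) (Γ : FODC (GLq q)) : Prop where
  bicovariant : Γ.Bicovariant
  basis : Γ.HasBasis (GLq.entries q)
  same : ∀ i j, let z := GLq.z q
    Γ.d (z i j) <• z i j =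
      (t / (q : ℂ) ^ 2 + t - 1) • (z i j • Γ.d (z i j)) +
      sigma₁ q t • ((z i j * z i j) • Γ.trTheta)
  row : ∀ i j l, j < l → let z := GLq.z q
    Γ.d (z i j) <• z i l =
      (t / (q : ℂ)) • (z i l • Γ.d (z i j)) + (t - 1) • (z i j • Γ.d (z i l)) +
      sigma₁ q t • ((z i j * z i l) • Γ.trTheta)
  col : ∀ i j k, i < k → let z := GLq.z q
    Γ.d (z i j) <• z k j =
      (t / (q : ℂ)) • (z k j • Γ.d (z i j)) + (t - 1) • (z i j • Γ.d (z k j)) +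
      sigma₁ q t • ((z i j * z k j) • Γ.trTheta)
  diag : ∀ i j k l, i < k → j < l → let z := GLq.z q
    Γ.d (z i j) <• z k l =
      t • (z k l • Γ.d (z i j)) + (t - 1) • (z i j • Γ.d (z k l)) +
      sigma₁ q t • ((z i j * z k l) • Γ.trTheta) -
      beta₁ q t • ((z i j * z k l - (q : ℂ) • (z i l * z k j)) • Γ.trTheta)
  antidiag : ∀ i j k l, i < k → l < j → let z := GLq.z q
    Γ.d (z i j) <• z k l =
      t • (z k l • Γ.d (z i j)) + (t - 1) • (z i j • Γ.d (z k l)) +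
      sigma₁ q t • ((z i j * z k l) • Γ.trTheta) -
      (t * ((q : ℂ) - 1 / (q : ℂ))) • (z k j • Γ.d (z i l)) +
      ((q : ℂ) * beta₁ q t) • ((z i l * z k j - (q : ℂ) • (z i j * z k l)) • Γ.trTheta)

/-- `Γ` is (a copy of) the calculus `Γ₂(t)` on `GL_q(3)`: it is bicovariant, the nine forms
`dz i j` are a left basis, and the commutation relations between the forms `dz i j` and the
generators `z k l` are those of the second family. -/
structure IsGamma₂ (t : ℂ) (Γ : FODC (GLq q)) : Prop where
  bicovariant : Γ.Bicovariant
  basis : Γ.HasBasis (GLq.entries q)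
  same : ∀ i j, let z := GLq.z q
    Γ.d (z i j) <• z i j =
      (t * (q : ℂ) ^ 2 + t - 1) • (z i j • Γ.d (z i j)) +
      sigma₂ q t • ((z i j * z i j) • Γ.trTheta)
  row : ∀ i j l, j < l → let z := GLq.z q
    Γ.d (z i j) <• z i l =
      (t * (q : ℂ)) • (z i l • Γ.d (z i j)) +
      (t * (q : ℂ) ^ 2 - 1) • (z i j • Γ.d (z i l)) +
      sigma₂ q t • ((z i j * z i l) • Γ.trTheta)
  col : ∀ i j k, i < k → let z := GLq.z q
    Γ.d (z i j) <• z k j =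
      (t * (q : ℂ)) • (z k j • Γ.d (z i j)) +
      (t * (q : ℂ) ^ 2 - 1) • (z i j • Γ.d (z k j)) +
      sigma₂ q t • ((z i j * z k j) • Γ.trTheta)
  diag : ∀ i j k l, i < k → j < l → let z := GLq.z q
    Γ.d (z i j) <• z k l =
      t • (z k l • Γ.d (z i j)) + (t - 1) • (z i j • Γ.d (z k l)) +
      sigma₂ q t • ((z i j * z k l) • Γ.trTheta) +
      (t * ((q : ℂ) - 1 / (q : ℂ))) • (z i l • Γ.d (z k j) + z k j • Γ.d (z i l)) +
      (t * ((q : ℂ) - 1 / (q : ℂ)) ^ 2) • (z i j • Γ.d (z k l)) -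
      (1 / (q : ℂ) ^ 2 * beta₂ q t) •
        ((z i j * z k l - (q : ℂ) • (z i l * z k j)) • Γ.trTheta)
  antidiag : ∀ i j k l, i < k → l < j → let z := GLq.z q
    Γ.d (z i j) <• z k l =
      t • (z k l • Γ.d (z i j)) + (t - 1) • (z i j • Γ.d (z k l)) +
      sigma₂ q t • ((z i j * z k l) • Γ.trTheta) +
      (t * ((q : ℂ) - 1 / (q : ℂ))) • (z i l • Γ.d (z k j)) +
      (1 / (q : ℂ) * beta₂ q t) •
        ((z i l * z k j - (q : ℂ) • (z i j * z k l)) • Γ.trTheta)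

/-! ### Induced calculi on `SL_q(3)` -/

/-- The sub-bimodule of the one-forms over `GL_q(3)` that has to vanish when `D = 1` and
`dD = 0` are imposed: it is generated by `(D - 1) ω`, `ω (D - 1)` and `dD`. -/
def unimodularRelations (Γ : FODC (GLq q)) : Submodule ℂ Γ.Form :=
  Submodule.span ℂ
    ({x | ∃ (a b : GLq q) (ω : Γ.Form), x = (a • ((GLq.det q - 1) • ω)) <• b} ∪
     {x | ∃ (a b : GLq q) (ω : Γ.Form), x = (a • (ω <• (GLq.det q - 1))) <• b} ∪
     {x | ∃ a b : GLq q, x = (a • Γ.d (GLq.det q)) <• b})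

/-- `Γ'` is the calculus over `SL_q(3)` that the calculus `Γ` over `GL_q(3)` induces: the
quotient of `Γ` by the relations `D = 1` and `dD = 0`. -/
def Induces (Γ : FODC (GLq q)) (Γ' : FODC (SLq q)) : Prop :=
  ∃ ρ : Γ.Form →ₗ[ℂ] Γ'.Form,
    (∀ (a : GLq q) (ω : Γ.Form), ρ (a • ω) = SLq.proj q a • ρ ω) ∧
    (∀ (a : GLq q) (ω : Γ.Form), ρ (ω <• a) = ρ ω <• SLq.proj q a) ∧
    (∀ a : GLq q, ρ (Γ.d a) = Γ'.d (SLq.proj q a)) ∧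
    LinearMap.ker ρ = Γ.unimodularRelations

/-- `Γ` is consistent with `D = 1` and `dD = 0`, i.e. it descends to `SL_q(3)`: it induces a
bicovariant calculus on `SL_q(3)` in which the nine forms `dz i j` still are a left basis. -/
def DescendsToSL (Γ : FODC (GLq q)) : Prop :=
  ∃ Γ' : FODC (SLq q), Γ.Induces Γ' ∧ Γ'.Bicovariant ∧ Γ'.HasBasis (SLq.entries q)

/-- The equivalence classes of the bicovariant calculi on `SL_q(3)`, with left basis `dz i j`,
that are induced by bicovariant calculi on `GL_q(3)` generated by the forms `dz i j` as left
modules. -/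
def inducedSLCalculi (q : ℂˣ) : Set (Quotient (FODC.setoid (SLq q))) :=
  {c | ∃ Γ' : FODC (SLq q), Quotient.mk _ Γ' = c ∧ Γ'.Bicovariant ∧
    Γ'.HasBasis (SLq.entries q) ∧
    ∃ Γ : FODC (GLq q), Γ.Bicovariant ∧ Γ.GeneratedBy (GLq.entries q) ∧ Γ.Induces Γ'}

end FODC

/-! Write B for the matrix `braid q s`. For `s = q` and `s = q⁻¹` it is a braid operator (the two
are mutually inverse), and the quantum matrix relations say that B commutes with Z ⊗ Z
(`IsQMatrix.braid_mul`).

Existence. The calculi are realised as inner ones. On a free left module with basis e_ij let e b =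
b₁ f(b₂) e, where f is an algebra map into 9 × 9 matrices, and put db = X b - b X with X = q⁴ e₀₀ +
q² e₁₁ + e₂₂. The Yang-Baxter equation allows f(Z) = t · B B (`isQMatrix_familyMatrix`), commutation
of B with Z ⊗ Z supplies a right coaction (`QGroup.matConv_coact`), and a quantum trace identity
(`weight_familyMatrix`) gives the Maurer-Cartan forms θ = A e + (t - 1) δ X. Their quantum trace T
equals `familyDenom` times X, and they form a basis when A and `familyDenom` are nonzero: A ≠ 0
follows from q² ≠ 1 and t ≠ 0, and `familyDenom` ≠ 0 is admissibility. Moving B across Z Z turns the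
relations for θ into those for dZ (`QGroup.MCRel.dzRel`). Uniqueness holds because the listed
relations, together with the Leibniz rule applied to the relations of Z, determine the product of
every dz with every z.

Descent. D is group-like and f(D) is the scalar t³ s⁻², so ω D = t³ s⁻² D ω. If the scalar is not 1,
then D = 1 forces ω = 0. If it is 1, f factors through SL and the same construction there is the
induced calculus (`descends_iff`).

Classification. If a calculus descends, the coordinates with respect to the SL basis followed by the
counit give functionals dual to the dz, so a basis over GL need not be assumed. By left covariance
the relations of the Maurer-Cartan forms have scalar coefficients. By right covariance these
coefficients, contracted with B, commute with Z ⊗ Z ⊗ Z (`QGroup.IsDual.intertwines`). Such an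
operator is determined by its value on e₀ ⊗ e₁ ⊗ e₂, so it is a combination of six products of B₁₂
and B₂₃ (`QGroup.Intertwines.exists_eq`). Six unknown scalars remain; the Leibniz rule and
multiplicativity of the coefficient matrix give polynomial equations for them, whose solutions are
the two families (`braidTensor_solutions`).

Counting. An induced calculus still determines t and the family, so classes correspond to admissible
roots of t³ = q² and t³ = q⁻². For all but finitely many q every cube root is admissible, which
gives 3 + 3. -/

/-! ### The quantum adjugate -/

/-- The quantum adjugate of a quantum matrix. -/
noncomputable def qAdj (q : ℂˣ) {R : Type*} [Ring R] [Algebra ℂ R] (z : Fin 3 → Fin 3 → R)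
    (i j : Fin 3) : R :=
  (!![z 1 1 * z 2 2 - (q : ℂ) • (z 1 2 * z 2 1),
      -((q : ℂ)⁻¹ • (z 0 1 * z 2 2)) + z 0 2 * z 2 1,
      (q : ℂ)⁻¹ ^ 2 • (z 0 1 * z 1 2) - (q : ℂ)⁻¹ • (z 0 2 * z 1 1);
      -((q : ℂ) • (z 1 0 * z 2 2)) + (q : ℂ) ^ 2 • (z 1 2 * z 2 0),
      z 0 0 * z 2 2 - (q : ℂ) • (z 0 2 * z 2 0),
      -((q : ℂ)⁻¹ • (z 0 0 * z 1 2)) + z 0 2 * z 1 0;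
      (q : ℂ) ^ 2 • (z 1 0 * z 2 1) - (q : ℂ) ^ 3 • (z 1 1 * z 2 0),
      -((q : ℂ) • (z 0 0 * z 2 1)) + (q : ℂ) ^ 2 • (z 0 1 * z 2 0),
      z 0 0 * z 1 1 - (q : ℂ) • (z 0 1 * z 1 0)] : Matrix (Fin 3) (Fin 3) R) i j

/-- The weights of the quantum trace. -/
def qWeight (q : ℂˣ) : Fin 3 → ℂ := ![(q : ℂ) ^ 4, (q : ℂ) ^ 2, 1]

section Adjugate

variable {q : ℂˣ} {R : Type*} [Ring R] [Algebra ℂ R] {z : Fin 3 → Fin 3 → R}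

set_option maxHeartbeats 1000000 in
theorem IsQMatrix.mul_qAdj (h : IsQMatrix q z) (i j : Fin 3) :
    ∑ k, z i k * qAdj q z k j = if i = j then qDet q z else 0 := by
  have hq := q.ne_zero
  have z1 := fun i j k h' => QMatrix.assoc_rw (h.row' i j k h')
  have z2 := fun i j k h' => QMatrix.assoc_rw (h.col' i j k h')
  have z3 := fun i j k l h' h'' => QMatrix.assoc_rw (h.comm' i j k l h' h'')
  have z4 := fun i j k l h' h'' => QMatrix.assoc_rw (h.cross' i j k l h' h'')
  have w1 := h.row'
  have w2 := h.col'
  have w3 := h.comm'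
  have w4 := h.cross'
  rcases QMatrix.fin3 i with rfl | rfl | rfl <;> rcases QMatrix.fin3 j with rfl | rfl | rfl <;>
    (simp [qDet, qAdj, Fin.sum_univ_three]
     try simp (disch := decide) only [mul_assoc, z1, z2, z3, z4, w1, w2,
          w3 0 1 1 0, w3 0 2 1 0, w3 0 2 1 1, w3 0 1 2 0, w3 0 2 2 0, w3 0 2 2 1,
          w3 1 1 2 0, w3 1 2 2 0, w3 1 2 2 1, w4,
          smul_mul_assoc, mul_add, add_mul, smul_neg, mul_neg, neg_mul,
       mul_smul_comm, smul_add, smul_sub, mul_sub, sub_mul, smul_smul]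
     try (match_scalars <;> field_simp <;> try ring))

set_option maxHeartbeats 1000000 in
theorem IsQMatrix.qAdj_mul (h : IsQMatrix q z) (i j : Fin 3) :
    ∑ k, qAdj q z i k * z k j = if i = j then qDet q z else 0 := by
  have hq := q.ne_zero
  have z1 := fun i j k h' => QMatrix.assoc_rw (h.row' i j k h')
  have z2 := fun i j k h' => QMatrix.assoc_rw (h.col' i j k h')
  have z3 := fun i j k l h' h'' => QMatrix.assoc_rw (h.comm' i j k l h' h'')
  have z4 := fun i j k l h' h'' => QMatrix.assoc_rw (h.cross' i j k l h' h'')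
  have w1 := h.row'
  have w2 := h.col'
  have w3 := h.comm'
  have w4 := h.cross'
  rcases QMatrix.fin3 i with rfl | rfl | rfl <;> rcases QMatrix.fin3 j with rfl | rfl | rfl <;>
    (simp [qDet, qAdj, Fin.sum_univ_three]
     try simp (disch := decide) only [mul_assoc, z1, z2, z3, z4, w1, w2,
          w3 0 1 1 0, w3 0 2 1 0, w3 0 2 1 1, w3 0 1 2 0, w3 0 2 2 0, w3 0 2 2 1,
          w3 1 1 2 0, w3 1 2 2 0, w3 1 2 2 1, w4,
          smul_mul_assoc, mul_add, add_mul, smul_neg, mul_neg, neg_mul,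
       mul_smul_comm, smul_add, smul_sub, mul_sub, sub_mul, smul_smul]
     try (match_scalars <;> field_simp <;> try ring))

-- Here the first index of the adjugate is contracted with the second index of `z`, opposite to the
-- matrix product; the weights compensate for the antipode not being an involution. This identity
-- makes the trace vector `frameTr` invariant under the right coaction.
set_option maxHeartbeats 1000000 in
theorem IsQMatrix.weight_qAdj_mul (h : IsQMatrix q z) (c e : Fin 3) :
    ∑ i, qWeight q i • (qAdj q z i c * z e i) = if c = e then qWeight q c • qDet q z else 0 := by
  have hq := q.ne_zero
  have z1 := fun i j k h' => QMatrix.assoc_rw (h.row' i j k h')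
  have z2 := fun i j k h' => QMatrix.assoc_rw (h.col' i j k h')
  have z3 := fun i j k l h' h'' => QMatrix.assoc_rw (h.comm' i j k l h' h'')
  have z4 := fun i j k l h' h'' => QMatrix.assoc_rw (h.cross' i j k l h' h'')
  have w1 := h.row'
  have w2 := h.col'
  have w3 := h.comm'
  have w4 := h.cross'
  rcases QMatrix.fin3 c with rfl | rfl | rfl <;> rcases QMatrix.fin3 e with rfl | rfl | rfl <;>
    (simp [qDet, qAdj, qWeight, Fin.sum_univ_three]
     try simp (disch := decide) only [mul_assoc, z1, z2, z3, z4, w1, w2,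
          w3 0 1 1 0, w3 0 2 1 0, w3 0 2 1 1, w3 0 1 2 0, w3 0 2 2 0, w3 0 2 2 1,
          w3 1 1 2 0, w3 1 2 2 0, w3 1 2 2 1, w4,
          smul_mul_assoc, mul_add, add_mul, smul_neg, mul_neg, neg_mul,
       mul_smul_comm, smul_add, smul_sub, mul_sub, sub_mul, smul_smul]
     try (match_scalars <;> field_simp <;> try ring))

/-- The quantum determinant is central. -/
theorem IsQMatrix.qDet_comm (h : IsQMatrix q z) (i j : Fin 3) :
    z i j * qDet q z = qDet q z * z i j := by
  -- The product Z · adj(Z) · Z, bracketed in the two possible ways, is Z D and D Z.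
  have h1 : ∑ k, ∑ l, z i k * qAdj q z k l * z l j = z i j * qDet q z := by
    simp_rw [mul_assoc, ← Finset.mul_sum, h.qAdj_mul]
    simp
  rw [← h1, Finset.sum_comm]
  simp_rw [← Finset.sum_mul, h.mul_qAdj]
  simp

end Adjugate

/-! ### The braid matrix -/

/-- The entries of the inverse braid matrix, shifted by a multiple of the identity so that its
eigenvalues are `s⁻¹` and `s⁻¹ - q - q⁻¹`. -/
noncomputable def braid (q s : ℂˣ) (a b x y : Fin 3) : ℂ :=
  (if a = x ∧ b = y then
    (s : ℂ)⁻¹ - (if a = b then 0 else if a < b then (q : ℂ)⁻¹ else (q : ℂ)) else 0) +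
  if a ≠ b ∧ a = y ∧ b = x then 1 else 0

/-- Each row of the braid matrix has at most two nonzero entries, one on the diagonal and one at the
flipped pair. -/
theorem braid_sum_right {q : ℂˣ} {M : Type*} [AddCommGroup M] [Module ℂ M] (s : ℂˣ)
    (m : Fin 3 → Fin 3 → M) (i k : Fin 3) :
    ∑ a, ∑ b, braid q s i k a b • m a b =
      ((s : ℂ)⁻¹ - (if i = k then 0 else if i < k then (q : ℂ)⁻¹ else (q : ℂ))) • m i k +
      if i ≠ k then m k i else 0 := by
  simp only [braid, add_smul, Finset.sum_add_distrib, ite_and, ite_smul, zero_smul,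
    Finset.sum_ite_eq, Finset.mem_univ, if_true, one_smul]
  congr 1
  · simp
  · by_cases h : i = k
    · simp [h]
    · simp only [ne_eq, h, not_false_eq_true, if_true]
      rw [Finset.sum_comm]
      simp

theorem braid_sum_left {q : ℂˣ} {M : Type*} [AddCommGroup M] [Module ℂ M] (s : ℂˣ)
    (m : Fin 3 → Fin 3 → M) (j l : Fin 3) :
    ∑ a, ∑ b, braid q s a b j l • m a b =
      ((s : ℂ)⁻¹ - (if j = l then 0 else if j < l then (q : ℂ)⁻¹ else (q : ℂ))) • m j l +
      if j ≠ l then m l j else 0 := by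
  rw [← braid_sum_right]
  refine Finset.sum_congr rfl fun a _ => Finset.sum_congr rfl fun b _ => ?_
  congr 1
  simp only [braid]
  congr 1
  · by_cases h : a = j ∧ b = l
    · obtain ⟨rfl, rfl⟩ := h; rfl
    · rw [if_neg h, if_neg (by rintro ⟨rfl, rfl⟩; exact h ⟨rfl, rfl⟩)]
  · by_cases h : a ≠ b ∧ a = l ∧ b = j
    · obtain ⟨h, rfl, rfl⟩ := h
      simp [h, h.symm]
    · rw [if_neg h, if_neg (by rintro ⟨h', rfl, rfl⟩; exact h ⟨h'.symm, rfl, rfl⟩)]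

/-- The order types of (i, k) and (j, l) give nine cases, each of them trivial or one of the
defining relations. Changing `s` adds a multiple of the identity, which commutes with everything, so
`s` is arbitrary here. -/
theorem IsQMatrix.braid_mul {q : ℂˣ} {R : Type*} [Ring R] [Algebra ℂ R] {z : Fin 3 → Fin 3 → R}
    (h : IsQMatrix q z) (s : ℂˣ) (i k j l : Fin 3) :
    ∑ a, ∑ b, braid q s i k a b • (z a j * z b l) =
      ∑ a, ∑ b, braid q s a b j l • (z i a * z k b) := by
  have hq := q.ne_zero
  have hL : ∑ a, ∑ b, braid q s i k a b • (z a j * z b l) =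
      ((s : ℂ)⁻¹ - (if i = k then 0 else if i < k then (q : ℂ)⁻¹ else (q : ℂ))) • (z i j * z k l) +
      if i ≠ k then z k j * z i l else 0 :=
    braid_sum_right s (fun a b => z a j * z b l) i k
  have hR : ∑ a, ∑ b, braid q s a b j l • (z i a * z k b) =
      ((s : ℂ)⁻¹ - (if j = l then 0 else if j < l then (q : ℂ)⁻¹ else (q : ℂ))) • (z i j * z k l) +
      if j ≠ l then z i l * z k j else 0 := by
    rw [← braid_sum_left s (fun a b => z i a * z k b) j l]
  rw [hL, hR]
  rcases lt_trichotomy i k with hik | rfl | hik <;> rcases lt_trichotomy j l with hjl | rfl | hjl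
  · simp only [hik.ne, hjl.ne, hik, hjl, if_true, if_false, ne_eq, not_false_eq_true]
    rw [h.cross i j k l hik hjl, h.comm i l k j hik hjl]
  · simp only [hik.ne, hik, if_true, if_false, ne_eq, not_false_eq_true, not_true_eq_false]
    rw [h.col' i j k hik]
    module
  · simp only [hik.ne, hjl.ne', hik, hjl.asymm, if_true, if_false, ne_eq, not_false_eq_true]
    rw [h.cross i l k j hik hjl, h.comm i j k l hik hjl]
    module
  · simp only [hjl.ne, hjl, if_true, if_false, ne_eq, not_false_eq_true, not_true_eq_false]
    rw [h.row' i j l hjl]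
    module
  · simp
  · simp only [hjl.ne', hjl.asymm, if_true, if_false, ne_eq, not_false_eq_true, not_true_eq_false]
    rw [h.row i l j hjl]
    module
  · simp only [hik.ne', hjl.ne, hik.asymm, hjl, if_true, if_false, ne_eq, not_false_eq_true]
    rw [h.comm' k l i j hik hjl, h.cross' k j i l hik hjl, h.comm k l i j hik hjl]
    module
  · simp only [hik.ne', hik.asymm, if_true, if_false, ne_eq, not_false_eq_true,
      not_true_eq_false]
    rw [h.col k j i hik]
    module
  · simp only [hik.ne', hjl.ne', hik.asymm, hjl.asymm, if_true, if_false, ne_eq,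
      not_false_eq_true]
    rw [h.comm' k j i l hik hjl]

/-! ### Convolution of functionals -/

section Convolution

variable {H : Type} [Ring H] [Bialgebra ℂ H]

/-- The convolution `b ↦ b₁ φ(b₂)`. -/
noncomputable def convR (φ : H →ₗ[ℂ] ℂ) : H →ₗ[ℂ] H :=
  (TensorProduct.rid ℂ H).toLinearMap ∘ₗ φ.lTensor H ∘ₗ Coalgebra.comul

/-- The convolution `b ↦ φ(b₁) b₂`. -/
noncomputable def convL (φ : H →ₗ[ℂ] ℂ) : H →ₗ[ℂ] H :=
  (TensorProduct.lid ℂ H).toLinearMap ∘ₗ φ.rTensor H ∘ₗ Coalgebra.comul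

/-- Coassociativity: both sides are b₁ ⊗ b₂ φ(b₃). This is the source of left covariance of inner
differentials. -/
theorem comul_convR (φ : H →ₗ[ℂ] ℂ) (b : H) :
    Coalgebra.comul (R := ℂ) (convR φ b) = (convR φ).lTensor H (Coalgebra.comul b) := by
  have h1 : (Coalgebra.comul (R := ℂ) (A := H)) ∘ₗ
      ((TensorProduct.rid ℂ H).toLinearMap ∘ₗ φ.lTensor H) =
      ((TensorProduct.rid ℂ (H ⊗[ℂ] H)).toLinearMap ∘ₗ φ.lTensor (H ⊗[ℂ] H)) ∘ₗ
        (Coalgebra.comul (R := ℂ) (A := H)).rTensor H := by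
    ext a b; simp
  have h2 : ((TensorProduct.rid ℂ (H ⊗[ℂ] H)).toLinearMap ∘ₗ φ.lTensor (H ⊗[ℂ] H)) ∘ₗ
      (TensorProduct.assoc ℂ H H H).symm.toLinearMap =
      ((TensorProduct.rid ℂ H).toLinearMap ∘ₗ φ.lTensor H).lTensor H := by
    ext a b c; simp
  have h3 := Coalgebra.coassoc_apply (R := ℂ) b
  rw [← LinearEquiv.eq_symm_apply] at h3
  have e1 := LinearMap.congr_fun h1 (Coalgebra.comul b)
  have e2 := LinearMap.congr_fun h2 (Coalgebra.comul.lTensor H (Coalgebra.comul b))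
  simp only [LinearMap.comp_apply, LinearEquiv.coe_coe] at e1 e2
  simp only [convR, LinearMap.comp_apply, LinearEquiv.coe_coe]
  rw [e1, h3, e2]
  simp only [LinearMap.lTensor_comp, LinearMap.comp_apply]

/-- Both sides are b₁ φ(b₂) ⊗ b₃. Right covariance thereby becomes a comparison of `convR` with
`convL`. -/
theorem rTensor_convR (φ : H →ₗ[ℂ] ℂ) (b : H) :
    (convR φ).rTensor H (Coalgebra.comul b) = (convL φ).lTensor H (Coalgebra.comul b) := by
  have h2 : ((TensorProduct.rid ℂ H).toLinearMap ∘ₗ φ.lTensor H).rTensor H ∘ₗ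
      (TensorProduct.assoc ℂ H H H).symm.toLinearMap =
      ((TensorProduct.lid ℂ H).toLinearMap ∘ₗ φ.rTensor H).lTensor H := by
    ext a b c; simp [TensorProduct.smul_tmul]
  have h3 := Coalgebra.coassoc_apply (R := ℂ) b
  rw [← LinearEquiv.eq_symm_apply] at h3
  have e2 := LinearMap.congr_fun h2 (Coalgebra.comul.lTensor H (Coalgebra.comul b))
  simp only [LinearMap.comp_apply, LinearEquiv.coe_coe, ← h3] at e2
  simp only [convR, convL, LinearMap.rTensor_comp, LinearMap.lTensor_comp,
    LinearMap.comp_apply] at e2 ⊢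
  exact e2

variable {ι : Type} [Fintype ι] [DecidableEq ι]

/-- The matrix functional `(i, j) ↦ f(b) i j`. -/
noncomputable def entryFun (f : H →ₐ[ℂ] Matrix ι ι ℂ) (i j : ι) : H →ₗ[ℂ] ℂ :=
  Matrix.entryLinearMap ℂ ℂ i j ∘ₗ f.toLinearMap

@[simp] theorem entryFun_apply (f : H →ₐ[ℂ] Matrix ι ι ℂ) (i j : ι) (b : H) :
    entryFun f i j b = f b i j := rfl

/-- The algebra map `b ↦ b₁ f(b₂)`. -/
noncomputable def matConvR (f : H →ₐ[ℂ] Matrix ι ι ℂ) : H →ₐ[ℂ] Matrix ι ι H :=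
  (matrixEquivTensor ι ℂ H).symm.toAlgHom.comp
    ((Algebra.TensorProduct.map (AlgHom.id ℂ H) f).comp (Bialgebra.comulAlgHom ℂ H))

/-- The algebra map `b ↦ f(b₁) b₂`. -/
noncomputable def matConvL (f : H →ₐ[ℂ] Matrix ι ι ℂ) : H →ₐ[ℂ] Matrix ι ι H :=
  (matrixEquivTensor ι ℂ H).symm.toAlgHom.comp
    ((Algebra.TensorProduct.comm ℂ (Matrix ι ι ℂ) H).toAlgHom.comp
      ((Algebra.TensorProduct.map f (AlgHom.id ℂ H)).comp (Bialgebra.comulAlgHom ℂ H)))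

theorem matConvR_apply (f : H →ₐ[ℂ] Matrix ι ι ℂ) (b : H) (i j : ι) :
    matConvR f b i j = convR (entryFun f i j) b := by
  suffices h : ∀ x : H ⊗[ℂ] H, (matrixEquivTensor ι ℂ H).symm
      (Algebra.TensorProduct.map (AlgHom.id ℂ H) f x) i j =
      TensorProduct.rid ℂ H ((entryFun f i j).lTensor H x) from h _
  intro x
  induction x with
  | zero => simp
  | tmul a b => simp [Algebra.smul_def, Algebra.commutes]
  | add x y hx hy => simp only [map_add, Matrix.add_apply, hx, hy]

theorem matConvL_apply (f : H →ₐ[ℂ] Matrix ι ι ℂ) (b : H) (i j : ι) :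
    matConvL f b i j = convL (entryFun f i j) b := by
  suffices h : ∀ x : H ⊗[ℂ] H, (matrixEquivTensor ι ℂ H).symm
      (Algebra.TensorProduct.comm ℂ (Matrix ι ι ℂ) H
        (Algebra.TensorProduct.map f (AlgHom.id ℂ H) x)) i j =
      TensorProduct.lid ℂ H ((entryFun f i j).rTensor H x) from h _
  intro x
  induction x with
  | zero => simp
  | tmul a b => simp [Algebra.smul_def, Algebra.commutes]
  | add x y hx hy => simp only [map_add, Matrix.add_apply, hx, hy]

end Convolution

/-! ### Inner calculi -/

section Frame

theorem lTensor_sum {κ M N P : Type*} [AddCommGroup M] [AddCommGroup N] [AddCommGroup P]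
    [Module ℂ M] [Module ℂ N] [Module ℂ P] (s : Finset κ) (g : κ → N →ₗ[ℂ] P) :
    (∑ k ∈ s, g k).lTensor M = ∑ k ∈ s, (g k).lTensor M :=
  map_sum (LinearMap.lTensorHom (R := ℂ) M) g s

theorem rTensor_sum {κ M N P : Type*} [AddCommGroup M] [AddCommGroup N] [AddCommGroup P]
    [Module ℂ M] [Module ℂ N] [Module ℂ P] (s : Finset κ) (g : κ → N →ₗ[ℂ] P) :
    (∑ k ∈ s, g k).rTensor M = ∑ k ∈ s, (g k).rTensor M :=
  map_sum (LinearMap.rTensorHom (R := ℂ) M) g s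

variable {H : Type} [Ring H] [Bialgebra ℂ H] {ι : Type} [Fintype ι] [DecidableEq ι]

/-- The free left module on `ι`, with the right multiplication twisted by a matrix functional. -/
def Frame (_f : H →ₐ[ℂ] Matrix ι ι ℂ) : Type := ι → H

namespace Frame

variable (f : H →ₐ[ℂ] Matrix ι ι ℂ)

instance : AddCommGroup (Frame f) := inferInstanceAs (AddCommGroup (ι → H))
instance : Module ℂ (Frame f) := inferInstanceAs (Module ℂ (ι → H))
instance : Module H (Frame f) := inferInstanceAs (Module H (ι → H))
instance : IsScalarTower ℂ H (Frame f) := inferInstanceAs (IsScalarTower ℂ H (ι → H))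

/-- On basis vectors the action reads e_i b = ∑ b₁ f(b₂) i j e_j; it is a right action because
`matConvR f` is multiplicative. -/
noncomputable instance : Module Hᵐᵒᵖ (Frame f) where
  smul a h := Matrix.vecMul (show ι → H from h) (matConvR f a.unop)
  one_smul h := by
    change Matrix.vecMul _ (matConvR f 1) = _
    rw [map_one, Matrix.vecMul_one]
  mul_smul a b h := by
    change Matrix.vecMul _ (matConvR f (b.unop * a.unop)) =
      Matrix.vecMul (Matrix.vecMul _ (matConvR f b.unop)) (matConvR f a.unop)
    rw [map_mul, Matrix.vecMul_vecMul]
  smul_zero a := Matrix.zero_vecMul _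
  smul_add a x y := Matrix.add_vecMul _ _ _
  add_smul a b h := by
    change Matrix.vecMul _ (matConvR f (a.unop + b.unop)) = _
    rw [map_add, Matrix.vecMul_add]
    rfl
  zero_smul h := by
    change Matrix.vecMul _ (matConvR f 0) = _
    rw [map_zero, Matrix.vecMul_zero]
    rfl

variable {f}

theorem rsmul_apply (h : Frame f) (a : H) (j : ι) :
    (h <• a) j = ∑ i, h i * matConvR f a i j := rfl

theorem smul_apply (a : H) (h : Frame f) (j : ι) : (a • h) j = a * h j := rfl

theorem csmul_apply (c : ℂ) (h : Frame f) (j : ι) : (c • h) j = c • h j := rfl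

theorem add_apply (h k : Frame f) (j : ι) : (h + k) j = h j + k j := rfl

@[ext] theorem ext {h k : Frame f} (e : ∀ j, h j = k j) : h = k := funext e

variable (f) in
/-- The coordinate of index `j`. -/
def proj (j : ι) : Frame f →ₗ[H] H := LinearMap.proj (R := H) (φ := fun _ : ι => H) j

variable (f) in
/-- The standard basis vectors. -/
def single (j : ι) : H →ₗ[H] Frame f := LinearMap.single H (fun _ : ι => H) j

theorem single_apply (j k : ι) (a : H) : single f j a k = if k = j then a else 0 := by
  change (Pi.single j a : ι → H) k = _
  rw [Pi.single_apply]

theorem sum_apply {κ : Type*} (s : Finset κ) (h : κ → Frame f) (j : ι) :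
    (∑ x ∈ s, h x) j = ∑ x ∈ s, h x j :=
  map_sum (proj f j) h s

theorem sum_single (h : Frame f) : ∑ j, single f j (h j) = h := by
  ext k
  simp only [sum_apply, single_apply]
  exact (Finset.sum_ite_eq Finset.univ k h).trans (if_pos (Finset.mem_univ k))

instance : SMulCommClass H Hᵐᵒᵖ (Frame f) where
  smul_comm a b h := by
    ext j
    rw [← MulOpposite.op_unop b]
    simp only [smul_apply, rsmul_apply, Finset.mul_sum, mul_assoc]

instance : IsScalarTower ℂ Hᵐᵒᵖ (Frame f) where
  smul_assoc c a h := by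
    ext j
    rw [← MulOpposite.op_unop a, ← MulOpposite.op_smul]
    simp only [csmul_apply, rsmul_apply, map_smul, Matrix.smul_apply, mul_smul_comm,
      Finset.smul_sum]

variable (f)

/-- The coordinates of the inner differential. -/
noncomputable def innerCoord (X : ι → ℂ) (k : ι) : H →ₗ[ℂ] H :=
  ∑ i, X i • convR (entryFun f i k) - X k • LinearMap.id

theorem comul_innerCoord (X : ι → ℂ) (k : ι) (b : H) :
    Coalgebra.comul (R := ℂ) (innerCoord f X k b) =
      (innerCoord f X k).lTensor H (Coalgebra.comul b) := by
  rw [innerCoord, LinearMap.lTensor_sub, lTensor_sum]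
  simp only [LinearMap.sub_apply, LinearMap.sum_apply, map_sub, map_sum,
    LinearMap.lTensor_smul, LinearMap.smul_apply, map_smul, comul_convR,
    LinearMap.lTensor_id, LinearMap.id_apply]

theorem rTensor_innerCoord (X : ι → ℂ) (k : ι) (b : H) :
    (innerCoord f X k).rTensor H (Coalgebra.comul b) =
      (∑ j, X j • convL (entryFun f j k) - X k • LinearMap.id).lTensor H
        (Coalgebra.comul b) := by
  rw [innerCoord, LinearMap.lTensor_sub, lTensor_sum, LinearMap.rTensor_sub, rTensor_sum]
  simp only [LinearMap.sub_apply, LinearMap.sum_apply, LinearMap.rTensor_smul,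
    LinearMap.lTensor_smul, LinearMap.smul_apply, rTensor_convR,
    LinearMap.lTensor_id, LinearMap.rTensor_id, LinearMap.id_apply]

/-- The inner differential `b ↦ X b - b X`. -/
noncomputable def innerD (X : ι → ℂ) : H →ₗ[ℂ] Frame f :=
  ∑ k, (single f k).restrictScalars ℂ ∘ₗ innerCoord f X k

variable {f}

theorem innerD_apply (X : ι → ℂ) (b : H) (k : ι) :
    innerD f X b k = ∑ i, X i • matConvR f b i k - X k • b := by
  simp only [innerD, LinearMap.sum_apply, sum_apply, LinearMap.comp_apply, matConvR_apply,
    LinearMap.restrictScalars_apply, single_apply, Finset.sum_ite_eq, Finset.mem_univ, if_true]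
  simp [innerCoord]

theorem innerD_leibniz (X : ι → ℂ) (a b : H) :
    innerD f X (a * b) = innerD f X a <• b + a • innerD f X b := by
  ext k
  simp only [add_apply, rsmul_apply, smul_apply, innerD_apply, map_mul, Matrix.mul_apply,
    mul_sub, sub_mul, Finset.sum_sub_distrib, Finset.mul_sum, Finset.sum_mul, Finset.smul_sum,
    mul_smul_comm, smul_mul_assoc]
  rw [Finset.sum_comm]
  abel

end Frame

/-- The inner calculus `db = X b - b X` on a frame. -/
noncomputable def innerFODC (f : H →ₐ[ℂ] Matrix ι ι ℂ) (X : ι → ℂ)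
    (hX : Submodule.span H (Set.range (Frame.innerD f X)) = ⊤) : FODC H where
  Form := Frame f
  d := Frame.innerD f X
  leibniz := Frame.innerD_leibniz X
  span_d := hX

theorem FODC.mulLeft_tmul (Γ : FODC H) (a b c : H) (ω : Γ.Form) :
    Γ.mulLeft (a ⊗ₜ b) (c ⊗ₜ ω) = (a * c) ⊗ₜ (b • ω) := rfl

theorem FODC.mulRight_tmul (Γ : FODC H) (a b c : H) (ω : Γ.Form) :
    Γ.mulRight (a ⊗ₜ b) (ω ⊗ₜ c) = (a • ω) ⊗ₜ (b * c) := rfl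

variable {f : H →ₐ[ℂ] Matrix ι ι ℂ} {X : ι → ℂ}

/-- The basis vectors of the frame are taken to be left invariant, so Δ_L is the coproduct of the
coordinates. The coordinates of db are right convolutions of b, which commute with the coproduct by
`comul_innerCoord`. -/
theorem innerFODC_left (hX : Submodule.span H (Set.range (Frame.innerD f X)) = ⊤) :
    ∃ ΔL : (innerFODC f X hX).Form →ₗ[ℂ] H ⊗[ℂ] (innerFODC f X hX).Form, ∀ a b : H,
      ΔL (a • (innerFODC f X hX).d b) = (innerFODC f X hX).mulLeft (Coalgebra.comul a)
        ((innerFODC f X hX).d.lTensor H (Coalgebra.comul b)) := by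
  let Γ := innerFODC f X hX
  let s : ι → H →ₗ[ℂ] Γ.Form := fun k => (Frame.single f k).restrictScalars ℂ
  let p : ι → Γ.Form →ₗ[ℂ] H := fun k => (Frame.proj f k).restrictScalars ℂ
  have hs : ∀ k (a b : H), s k (a * b) = a • s k b := fun k a b => (Frame.single f k).map_smul a b
  have hp : ∀ k (a : H) (ω : Γ.Form), p k (a • ω) = a * p k ω := fun k a ω => rfl
  have hd : Γ.d = ∑ k, s k ∘ₗ Frame.innerCoord f X k := rfl
  have hpd : ∀ k b, p k (Γ.d b) = Frame.innerCoord f X k b := by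
    intro k b
    refine (Frame.innerD_apply X b k).trans ?_
    simp [matConvR_apply, Frame.innerCoord]
  refine ⟨∑ k, (s k).lTensor H ∘ₗ Coalgebra.comul ∘ₗ p k, fun a b => ?_⟩
  have h1 : ∀ k (x y : H ⊗[ℂ] H), (s k).lTensor H (x * y) = Γ.mulLeft x ((s k).lTensor H y) := by
    intro k x y
    induction x with
    | zero => simp
    | add x x' hx hx' => simp only [add_mul, map_add, LinearMap.add_apply, hx, hx']
    | tmul x x' =>
      induction y with
      | zero => simp
      | add y y' hy hy' => simp only [mul_add, map_add, hy, hy']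
      | tmul y y' =>
        rw [Algebra.TensorProduct.tmul_mul_tmul, LinearMap.lTensor_tmul, LinearMap.lTensor_tmul,
          FODC.mulLeft_tmul, hs]
  have h2 : Γ.d.lTensor H (Coalgebra.comul b) =
      ∑ k, (s k).lTensor H (Coalgebra.comul (p k (Γ.d b))) := by
    simp only [hpd]
    rw [hd, lTensor_sum, LinearMap.sum_apply]
    refine Finset.sum_congr rfl fun k _ => ?_
    rw [LinearMap.lTensor_comp, LinearMap.comp_apply, Frame.comul_innerCoord]
  simp only [LinearMap.sum_apply, LinearMap.comp_apply]
  change _ = Γ.mulLeft _ (Γ.d.lTensor H _)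
  rw [h2, map_sum]
  refine Finset.sum_congr rfl fun k _ => ?_
  rw [← h1, ← Bialgebra.comul_mul]
  rfl

/-- Δ_R sends e_j to ∑ e_k ⊗ W j k. The hypothesis `hW` makes this compatible with right
multiplication and `hXW` makes X invariant, so db = X b - b X is respected. No comatrix identity for
W is needed, since bicovariance only asks for linear maps with the prescribed values. -/
theorem innerFODC_right (hX : Submodule.span H (Set.range (Frame.innerD f X)) = ⊤)
    (W : Matrix ι ι H) (hW : ∀ b, matConvR f b * W = W * matConvL f b)
    (hXW : ∀ k, ∑ i, X i • W i k = X k • (1 : H)) :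
    ∃ ΔR : (innerFODC f X hX).Form →ₗ[ℂ] (innerFODC f X hX).Form ⊗[ℂ] H, ∀ a b : H,
      ΔR (a • (innerFODC f X hX).d b) = (innerFODC f X hX).mulRight (Coalgebra.comul a)
        ((innerFODC f X hX).d.rTensor H (Coalgebra.comul b)) := by
  let Γ := innerFODC f X hX
  let s : ι → H →ₗ[ℂ] Γ.Form := fun k => (Frame.single f k).restrictScalars ℂ
  let p : ι → Γ.Form →ₗ[ℂ] H := fun k => (Frame.proj f k).restrictScalars ℂ
  have hs : ∀ k (a b : H), s k (a * b) = a • s k b := fun k a b => (Frame.single f k).map_smul a b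
  have hp : ∀ k (a : H) (ω : Γ.Form), p k (a • ω) = a * p k ω := fun k a ω => rfl
  have hd : Γ.d = ∑ k, s k ∘ₗ Frame.innerCoord f X k := rfl
  have hpd : ∀ k b, p k (Γ.d b) = Frame.innerCoord f X k b := by
    intro k b
    refine (Frame.innerD_apply X b k).trans ?_
    simp [matConvR_apply, Frame.innerCoord]
  let m : ι → ι → H ⊗[ℂ] H →ₗ[ℂ] Γ.Form ⊗[ℂ] H := fun j k =>
    TensorProduct.map (s k) (LinearMap.mulRight ℂ (W j k))
  refine ⟨∑ j, ∑ k, m j k ∘ₗ Coalgebra.comul ∘ₗ p j, fun a b => ?_⟩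
  have h1 : ∀ j k (x y : H ⊗[ℂ] H), m j k (x * y) = Γ.mulRight x (m j k y) := by
    intro j k x y
    induction x with
    | zero => simp
    | add x x' hx hx' => simp only [add_mul, map_add, LinearMap.add_apply, hx, hx']
    | tmul x x' =>
      induction y with
      | zero => simp
      | add y y' hy hy' => simp only [mul_add, map_add, hy, hy']
      | tmul y y' =>
        simp only [m]
        rw [Algebra.TensorProduct.tmul_mul_tmul, TensorProduct.map_tmul, TensorProduct.map_tmul,
          FODC.mulRight_tmul, hs]
        simp [mul_assoc]
  -- Multiplying the coordinates of db by W turns right into left convolution: `hW` moves W to the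
  -- left of the functional, where `hXW` absorbs it into X.
  have h3 : ∀ k b, ∑ j, LinearMap.mulRight ℂ (W j k) (p j (Γ.d b)) =
      ∑ j, X j • convL (entryFun f j k) b - X k • b := by
    intro k b
    have e1 : ∀ j, p j (Γ.d b) = ∑ i, X i • matConvR f b i j - X j • b := fun j =>
      Frame.innerD_apply X b j
    simp only [e1, LinearMap.mulRight_apply, sub_mul, Finset.sum_sub_distrib, Finset.sum_mul,
      smul_mul_assoc]
    congr 1
    · rw [Finset.sum_comm]
      have e2 : ∀ i, ∑ j, matConvR f b i j * W j k = ∑ j, W i j * matConvL f b j k := fun i => by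
        rw [← Matrix.mul_apply, hW, Matrix.mul_apply]
      simp only [← Finset.smul_sum, e2]
      simp only [Finset.smul_sum]
      rw [Finset.sum_comm]
      refine Finset.sum_congr rfl fun j _ => ?_
      simp only [← smul_mul_assoc, ← Finset.sum_mul]
      rw [hXW, smul_mul_assoc, one_mul, matConvL_apply]
    · simp only [← mul_smul_comm, ← Finset.mul_sum, hXW]
      rw [mul_smul_comm, mul_one]
  have h2 : Γ.d.rTensor H (Coalgebra.comul b) =
      ∑ j, ∑ k, m j k (Coalgebra.comul (p j (Γ.d b))) := by
    have e1 : ∀ j, Coalgebra.comul (R := ℂ) (p j (Γ.d b)) =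
        (p j ∘ₗ Γ.d).lTensor H (Coalgebra.comul b) := by
      intro j
      have : p j ∘ₗ Γ.d = Frame.innerCoord f X j := LinearMap.ext (hpd j)
      rw [this, hpd, Frame.comul_innerCoord]
    have e2 : ∀ k, ∑ j, m j k (Coalgebra.comul (p j (Γ.d b))) =
        (s k).rTensor H ((∑ j, X j • convL (entryFun f j k) - X k • LinearMap.id).lTensor H
          (Coalgebra.comul b)) := by
      intro k
      have e3 : ∑ j, LinearMap.mulRight ℂ (W j k) ∘ₗ (p j ∘ₗ Γ.d) =
          ∑ j, X j • convL (entryFun f j k) - X k • LinearMap.id := by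
        ext b
        simpa using h3 k b
      simp only [e1, ← e3]
      rw [lTensor_sum, LinearMap.sum_apply, map_sum]
      refine Finset.sum_congr rfl fun j _ => ?_
      generalize Coalgebra.comul (R := ℂ) b = x
      induction x with
      | zero => simp
      | add x y hx hy => simp only [map_add, hx, hy]
      | tmul x y => rfl
    rw [Finset.sum_comm]
    simp only [e2]
    conv_lhs => rw [hd]
    simp only [rTensor_sum, LinearMap.sum_apply, LinearMap.rTensor_comp, LinearMap.comp_apply,
      Frame.rTensor_innerCoord]
  simp only [LinearMap.sum_apply, LinearMap.comp_apply]
  change _ = Γ.mulRight _ (Γ.d.rTensor H _)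
  rw [h2, map_sum]
  refine Finset.sum_congr rfl fun j _ => ?_
  rw [map_sum]
  refine Finset.sum_congr rfl fun k _ => ?_
  rw [← h1, ← Bialgebra.comul_mul]
  rfl

/-- An inner calculus on a frame is bicovariant if the frame has a compatible right coaction `W`
for which the vector `X` is invariant. -/
theorem innerFODC_bicovariant (hX : Submodule.span H (Set.range (Frame.innerD f X)) = ⊤)
    (W : Matrix ι ι H) (hW : ∀ b, matConvR f b * W = W * matConvL f b)
    (hXW : ∀ k, ∑ i, X i • W i k = X k • (1 : H)) : (innerFODC f X hX).Bicovariant :=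
  ⟨innerFODC_left hX, innerFODC_right hX W hW hXW⟩

end Frame

/-! ### Matrices on the threefold tensor power -/

section Legs

set_option linter.unusedSectionVars false

/-- Triples of indices. -/
abbrev Idx3 : Type := Fin 3 × Fin 3 × Fin 3

variable {H : Type} [Ring H] [Algebra ℂ H]

/-- A matrix acting on the first leg. -/
def leg1 (A : Fin 3 → Fin 3 → H) : Matrix Idx3 Idx3 H := fun x y =>
  if x.2.1 = y.2.1 then if x.2.2 = y.2.2 then A x.1 y.1 else 0 else 0

/-- A matrix acting on the second leg. -/
def leg2 (A : Fin 3 → Fin 3 → H) : Matrix Idx3 Idx3 H := fun x y =>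
  if x.1 = y.1 then if x.2.2 = y.2.2 then A x.2.1 y.2.1 else 0 else 0

/-- A matrix acting on the third leg. -/
def leg3 (A : Fin 3 → Fin 3 → H) : Matrix Idx3 Idx3 H := fun x y =>
  if x.1 = y.1 then if x.2.1 = y.2.1 then A x.2.2 y.2.2 else 0 else 0

/-- A scalar matrix acting on the first two legs. -/
def leg12 (H : Type) [Ring H] [Algebra ℂ H] (g : Fin 3 → Fin 3 → Fin 3 → Fin 3 → ℂ) :
    Matrix Idx3 Idx3 H := fun x y =>
  if x.2.2 = y.2.2 then algebraMap ℂ H (g x.1 x.2.1 y.1 y.2.1) else 0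

/-- A scalar matrix acting on the first and the third leg. -/
def leg13 (H : Type) [Ring H] [Algebra ℂ H] (g : Fin 3 → Fin 3 → Fin 3 → Fin 3 → ℂ) :
    Matrix Idx3 Idx3 H := fun x y =>
  if x.2.1 = y.2.1 then algebraMap ℂ H (g x.1 x.2.2 y.1 y.2.2) else 0

/-- A scalar matrix acting on the last two legs. -/
def leg23 (H : Type) [Ring H] [Algebra ℂ H] (g : Fin 3 → Fin 3 → Fin 3 → Fin 3 → ℂ) :
    Matrix Idx3 Idx3 H := fun x y =>
  if x.1 = y.1 then algebraMap ℂ H (g x.2.1 x.2.2 y.2.1 y.2.2) else 0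

theorem leg1_mul_of {A B : Fin 3 → Fin 3 → H}
    (h : ∀ i j, ∑ k, A i k * B k j = if i = j then 1 else 0) : leg1 A * leg1 B = 1 := by
  ext ⟨i, k, e⟩ ⟨j, l, o⟩
  simp [Matrix.mul_apply, leg1, Fintype.sum_prod_type, Matrix.one_apply, ite_and, h]
  split_ifs <;> simp_all

theorem leg2_mul_of {A B : Fin 3 → Fin 3 → H}
    (h : ∀ i j, ∑ k, A i k * B k j = if i = j then 1 else 0) : leg2 A * leg2 B = 1 := by
  ext ⟨i, k, e⟩ ⟨j, l, o⟩
  simp [Matrix.mul_apply, leg2, Fintype.sum_prod_type, Matrix.one_apply, ite_and, h]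
  split_ifs <;> simp_all

variable {z : Fin 3 → Fin 3 → H} {g : Fin 3 → Fin 3 → Fin 3 → Fin 3 → ℂ}

theorem leg12_rtt (h : ∀ i k j l, ∑ a, ∑ b, g i k a b • (z a j * z b l) =
      ∑ a, ∑ b, g a b j l • (z i a * z k b)) :
    leg12 H g * (leg1 z * leg2 z) = leg1 z * leg2 z * leg12 H g := by
  ext ⟨i, k, e⟩ ⟨j, l, o⟩
  have := h i k j l
  simp only [Matrix.mul_apply, leg1, leg2, leg12, Fintype.sum_prod_type]
  by_cases heo : e = o
  · subst heo
    simpa [Algebra.smul_def, ← Algebra.commutes, mul_assoc] using this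
  · simp [heo]

theorem leg13_rtt (h : ∀ i k j l, ∑ a, ∑ b, g i k a b • (z a j * z b l) =
      ∑ a, ∑ b, g a b j l • (z i a * z k b)) :
    leg13 H g * (leg1 z * leg3 z) = leg1 z * leg3 z * leg13 H g := by
  ext ⟨i, e, k⟩ ⟨j, o, l⟩
  have := h i k j l
  simp only [Matrix.mul_apply, leg1, leg3, leg13, Fintype.sum_prod_type]
  by_cases heo : e = o
  · subst heo
    simpa [Algebra.smul_def, ← Algebra.commutes, mul_assoc] using this
  · simp [heo]

theorem leg23_rtt (h : ∀ i k j l, ∑ a, ∑ b, g i k a b • (z a j * z b l) =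
      ∑ a, ∑ b, g a b j l • (z i a * z k b)) :
    leg23 H g * (leg2 z * leg3 z) = leg2 z * leg3 z * leg23 H g := by
  ext ⟨e, i, k⟩ ⟨o, j, l⟩
  have := h i k j l
  simp only [Matrix.mul_apply, leg2, leg3, leg23, Fintype.sum_prod_type]
  by_cases heo : e = o
  · subst heo
    simpa [Algebra.smul_def, ← Algebra.commutes, mul_assoc] using this
  · simp [heo]

theorem leg12_mul_leg3 (A : Fin 3 → Fin 3 → H) : leg12 H g * leg3 A = leg3 A * leg12 H g := by
  ext ⟨i, k, e⟩ ⟨j, l, o⟩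
  simp [Matrix.mul_apply, leg3, leg12, Fintype.sum_prod_type, Algebra.commutes]

theorem leg23_mul_leg1 (A : Fin 3 → Fin 3 → H) : leg23 H g * leg1 A = leg1 A * leg23 H g := by
  ext ⟨i, k, e⟩ ⟨j, l, o⟩
  simp [Matrix.mul_apply, leg1, leg23, Fintype.sum_prod_type, Algebra.commutes]

end Legs

/-! ### Quantum groups of quantum matrices -/

/-- A bialgebra generated by a quantum matrix `z` with an inverse matrix `S`. -/
structure QGroup (q : ℂˣ) (H : Type) [Ring H] [Bialgebra ℂ H] where
  /-- the quantum matrix -/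
  z : Fin 3 → Fin 3 → H
  /-- the inverse matrix -/
  S : Fin 3 → Fin 3 → H
  isQMatrix : IsQMatrix q z
  comul_z : ∀ i j, Coalgebra.comul (R := ℂ) (z i j) = ∑ k, z i k ⊗ₜ[ℂ] z k j
  counit_z : ∀ i j, Coalgebra.counit (R := ℂ) (z i j) = if i = j then 1 else 0
  mul_S : ∀ i j, ∑ k, z i k * S k j = if i = j then 1 else 0
  S_mul : ∀ i j, ∑ k, S i k * z k j = if i = j then 1 else 0
  weight : ∀ c e, ∑ i, qWeight q i • (S i c * z e i) = if c = e then qWeight q c • 1 else 0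
  -- Closure under inverses brings in the inverse of the determinant, so that one induction
  -- principle serves both GL and SL.
  gen : ∀ A : Subalgebra ℂ H, (∀ i j, z i j ∈ A) →
    (∀ a b, a ∈ A → a * b = 1 → b * a = 1 → b ∈ A) → A = ⊤

namespace GLq

variable {q : ℂˣ}

theorem comul_z (i j : Fin 3) :
    Coalgebra.comul (R := ℂ) (z q i j) = ∑ k, z q i k ⊗ₜ[ℂ] z q k j := comulHom_z q i j

theorem counit_z (i j : Fin 3) :
    Coalgebra.counit (R := ℂ) (z q i j) = if i = j then 1 else 0 := counitHom_z q i j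

theorem det_comm_z (i j : Fin 3) : z q i j * det q = det q * z q i j := isQMatrix.qDet_comm i j

theorem z_mul_detInv (i j : Fin 3) : z q i j * detInv q = detInv q * z q i j := by
  calc z q i j * detInv q = detInv q * (det q * z q i j) * detInv q := by
        rw [← mul_assoc, detInv_mul_det, one_mul]
    _ = detInv q * z q i j := by
        rw [← det_comm_z, mul_assoc, mul_assoc, det_mul_detInv, mul_one]

theorem antipodeZ_eq (i j : Fin 3) : antipodeZ q i j = detInv q * qAdj q (z q) i j := rfl

theorem mul_antipodeZ (i j : Fin 3) :
    ∑ k, z q i k * antipodeZ q k j = if i = j then 1 else 0 := by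
  simp only [antipodeZ_eq, ← mul_assoc, z_mul_detInv]
  simp only [mul_assoc, ← Finset.mul_sum, isQMatrix.mul_qAdj]
  split_ifs
  · exact detInv_mul_det
  · simp

theorem antipodeZ_mul (i j : Fin 3) :
    ∑ k, antipodeZ q i k * z q k j = if i = j then 1 else 0 := by
  simp only [antipodeZ_eq, mul_assoc, ← Finset.mul_sum, isQMatrix.qAdj_mul]
  split_ifs
  · exact detInv_mul_det
  · simp

theorem weight_antipodeZ (c e : Fin 3) :
    ∑ i, qWeight q i • (antipodeZ q i c * z q e i) = if c = e then qWeight q c • 1 else 0 := by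
  have h : ∀ i, qWeight q i • (antipodeZ q i c * z q e i) =
      detInv q * qWeight q i • (qAdj q (z q) i c * z q e i) := fun i => by
    rw [antipodeZ_eq, mul_assoc, mul_smul_comm]
  simp only [h, ← Finset.mul_sum]
  rw [isQMatrix.weight_qAdj_mul]
  split_ifs
  · rw [mul_smul_comm]
    congr 1
    exact detInv_mul_det
  · simp

/-- The universal property yields an algebra map into A; followed by the inclusion it fixes the
generators, hence is the identity. -/
theorem subalgebra_eq_top (A : Subalgebra ℂ (GLq q)) (h : ∀ i j, z q i j ∈ A)
    (h' : detInv q ∈ A) : A = ⊤ := by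
  have hdet : qDet q (fun i j => (⟨z q i j, h i j⟩ : A)) = ⟨det q, by
      unfold det qDet
      exact A.sub_mem (A.sub_mem (A.sub_mem (A.add_mem (A.add_mem
        (A.mul_mem (A.mul_mem (h _ _) (h _ _)) (h _ _))
        (A.smul_mem (A.mul_mem (A.mul_mem (h _ _) (h _ _)) (h _ _)) _))
        (A.smul_mem (A.mul_mem (A.mul_mem (h _ _) (h _ _)) (h _ _)) _))
        (A.smul_mem (A.mul_mem (A.mul_mem (h _ _) (h _ _)) (h _ _)) _))
        (A.smul_mem (A.mul_mem (A.mul_mem (h _ _) (h _ _)) (h _ _)) _))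
        (A.smul_mem (A.mul_mem (A.mul_mem (h _ _) (h _ _)) (h _ _)) _)⟩ := rfl
  let F : GLq q →ₐ[ℂ] A := lift (fun i j => ⟨z q i j, h i j⟩) ⟨detInv q, h'⟩
    { row := fun i j k hjk => Subtype.ext (isQMatrix.row i j k hjk)
      col := fun i j k hjk => Subtype.ext (isQMatrix.col i j k hjk)
      comm := fun i j k l h h' => Subtype.ext (isQMatrix.comm i j k l h h')
      cross := fun i j k l h h' => Subtype.ext (isQMatrix.cross i j k l h h') }
    (by rw [hdet]; exact Subtype.ext det_mul_detInv)
    (by rw [hdet]; exact Subtype.ext detInv_mul_det)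
  have hF : A.val.comp F = AlgHom.id ℂ (GLq q) := by
    apply algHom_ext
    · intro i j; simp [F]
    · simp [F]
  rw [eq_top_iff]
  intro x _
  have := DFunLike.congr_fun hF x
  rw [AlgHom.comp_apply, AlgHom.id_apply] at this
  rw [← this]
  exact (F x).2

variable (q)

/-- `GL_q(3)` as a quantum group of quantum matrices. -/
noncomputable def qGroup : QGroup q (GLq q) where
  z := z q
  S := antipodeZ q
  isQMatrix := isQMatrix
  comul_z := comul_z
  counit_z := counit_z
  mul_S := mul_antipodeZ
  S_mul := antipodeZ_mul
  weight := weight_antipodeZ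
  gen A h h' := by
    refine subalgebra_eq_top A h (h' (det q) _ ?_ det_mul_detInv detInv_mul_det)
    unfold det qDet
    exact A.sub_mem (A.sub_mem (A.sub_mem (A.add_mem (A.add_mem
        (A.mul_mem (A.mul_mem (h _ _) (h _ _)) (h _ _))
        (A.smul_mem (A.mul_mem (A.mul_mem (h _ _) (h _ _)) (h _ _)) _))
        (A.smul_mem (A.mul_mem (A.mul_mem (h _ _) (h _ _)) (h _ _)) _))
        (A.smul_mem (A.mul_mem (A.mul_mem (h _ _) (h _ _)) (h _ _)) _))
        (A.smul_mem (A.mul_mem (A.mul_mem (h _ _) (h _ _)) (h _ _)) _))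
        (A.smul_mem (A.mul_mem (A.mul_mem (h _ _) (h _ _)) (h _ _)) _)

end GLq

namespace SLq

variable {q : ℂˣ}

theorem proj_surjective : Function.Surjective (proj q) :=
  RingQuot.mkAlgHom_surjective ℂ (SLRel q)

theorem proj_z (i j : Fin 3) : proj q (GLq.z q i j) = z q i j := rfl

theorem isQMatrix : IsQMatrix q (z q) := GLq.isQMatrix.map (proj q)

theorem comul_z (i j : Fin 3) :
    Coalgebra.comul (R := ℂ) (z q i j) = ∑ k, z q i k ⊗ₜ[ℂ] z q k j := comulHom_z q i j

theorem counit_z (i j : Fin 3) :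
    Coalgebra.counit (R := ℂ) (z q i j) = if i = j then 1 else 0 := counitHom_z q i j

theorem comul_proj (a : GLq q) : Coalgebra.comul (R := ℂ) (proj q a) =
    TensorProduct.map (proj q).toLinearMap (proj q).toLinearMap (Coalgebra.comul a) :=
  lift_proj _ _ a

theorem counit_proj (a : GLq q) :
    Coalgebra.counit (R := ℂ) (proj q a) = Coalgebra.counit (R := ℂ) a :=
  lift_proj _ _ a

theorem proj_detInv : proj q (GLq.detInv q) = 1 := by
  have := congrArg (proj q) (GLq.det_mul_detInv (q := q))
  rwa [map_mul, proj_det, one_mul, map_one] at this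

variable (q)

/-- `SL_q(3)` as a quantum group of quantum matrices. -/
noncomputable def qGroup : QGroup q (SLq q) where
  z := z q
  S i j := proj q (GLq.antipodeZ q i j)
  isQMatrix := isQMatrix
  comul_z := comul_z
  counit_z := counit_z
  mul_S i j := by
    simp only [← proj_z, ← map_mul, ← map_sum, GLq.mul_antipodeZ]
    split_ifs <;> simp
  S_mul i j := by
    simp only [← proj_z, ← map_mul, ← map_sum, GLq.antipodeZ_mul]
    split_ifs <;> simp
  weight c e := by
    simp only [← proj_z, ← map_mul, ← map_smul, ← map_sum, GLq.weight_antipodeZ]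
    split_ifs <;> simp
  gen A h h' := by
    have := GLq.subalgebra_eq_top (A.comap (proj q)) h (by
      change proj q (GLq.detInv q) ∈ A
      rw [proj_detInv]
      exact A.one_mem)
    rw [eq_top_iff]
    intro x _
    obtain ⟨y, rfl⟩ := proj_surjective x
    have hy : y ∈ A.comap (proj q) := by rw [this]; trivial
    exact hy

end SLq

/-! ### The matrix functionals of the two families -/

section Family

/-- The representation of quantum matrices on `ℂ³` given by the braid matrix. -/
noncomputable def braidRep (q s : ℂˣ) (t : ℂ) (k a : Fin 3) : Matrix (Fin 3) (Fin 3) ℂ :=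
  Matrix.of fun i b => t * braid q s i k a b

theorem braid_symm (q s : ℂˣ) (a b x y : Fin 3) : braid q s a b x y = braid q s x y a b := by
  simp only [braid]
  congr 1
  · by_cases h : a = x ∧ b = y
    · obtain ⟨rfl, rfl⟩ := h; rfl
    · rw [if_neg h, if_neg (by rintro ⟨rfl, rfl⟩; exact h ⟨rfl, rfl⟩)]
  · by_cases h : a ≠ b ∧ a = y ∧ b = x
    · obtain ⟨h, rfl, rfl⟩ := h
      simp [h, h.symm]
    · rw [if_neg h, if_neg (by rintro ⟨h', rfl, rfl⟩; exact h ⟨h'.symm, rfl, rfl⟩)]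

theorem IsQMatrix.transpose {q : ℂˣ} {R : Type*} [Ring R] [Algebra ℂ R] {z : Fin 3 → Fin 3 → R}
    (h : IsQMatrix q z) : IsQMatrix q (fun i j => z j i) where
  row i j k hjk := h.col j i k hjk
  col i j k hik := h.row j i k hik
  comm i j k l hik hlj := h.comm' l k j i hlj hik
  cross i j k l hik hjl := by
    rw [h.cross j i l k hjl hik, h.comm j k l i hjl hik]

/-- The relations of a quantum matrix follow from its commutation with the braid matrix. -/
theorem IsQMatrix.of_braid_mul {q s : ℂˣ} {R : Type*} [Ring R] [Algebra ℂ R]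
    {z : Fin 3 → Fin 3 → R}
    (h : ∀ i k j l, ∑ a, ∑ b, braid q s i k a b • (z a j * z b l) =
      ∑ a, ∑ b, braid q s a b j l • (z i a * z k b)) : IsQMatrix q z := by
  have hq := q.ne_zero
  have key := fun i k j l => (braid_sum_right s (fun a b => z a j * z b l) i k).symm.trans
    ((h i k j l).trans (braid_sum_left s (fun a b => z i a * z k b) j l))
  have hcomm : ∀ i j k l, i < k → l < j → z i j * z k l = z k l * z i j := by
    intro i j k l hik hlj
    have := key i k l j
    simp only [hik.ne, hik, hlj.ne, hlj, if_true, if_false, ne_eq, not_false_eq_true] at this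
    exact (add_left_cancel this).symm
  refine ⟨?_, ?_, hcomm, ?_⟩
  · intro i j k hjk
    have := key i i j k
    simp only [hjk.ne, hjk, if_true, if_false, ne_eq, not_false_eq_true, not_true_eq_false] at this
    have h2 : z i k * z i j = (q : ℂ)⁻¹ • (z i j * z i k) := by
      linear_combination (norm := module) (-1 : ℂ) • this
    rw [h2, smul_smul, mul_inv_cancel₀ hq, one_smul]
  · intro i j k hik
    have := key i k j j
    simp only [hik.ne, hik, if_true, if_false, ne_eq, not_false_eq_true, not_true_eq_false] at this
    have h2 : z k j * z i j = (q : ℂ)⁻¹ • (z i j * z k j) := by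
      linear_combination (norm := module) (1 : ℂ) • this
    rw [h2, smul_smul, mul_inv_cancel₀ hq, one_smul]
  · intro i j k l hik hjl
    have := key i k l j
    simp only [hik.ne, hik, hjl.ne', hjl.asymm, if_true, if_false, ne_eq,
      not_false_eq_true] at this
    rw [← hcomm i l k j hik hjl]
    linear_combination (norm := module) (-1 : ℂ) • this

/-- The braid relation B₂₃ B₁₂ B₂₃ = B₁₂ B₂₃ B₁₂, tested on an arbitrary tensor `m`. It is the
reason for restricting to these two values of `s`: it turns the entries of B into a representation
of quantum matrices. -/
theorem yang_baxter {q s : ℂˣ} (hs : s = q ∨ s = q⁻¹) (m : Fin 3 → Fin 3 → Fin 3 → ℂ)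
    (x i k : Fin 3) :
    ∑ a, ∑ b, braid q s i k a b • ∑ c, ∑ d, braid q s x a c d • ∑ e, ∑ f,
        braid q s d b e f • m c e f =
      ∑ a, ∑ b, braid q s x i a b • ∑ c, ∑ d, braid q s b k c d • ∑ e, ∑ f,
        braid q s a c e f • m e f d := by
  have hq := q.ne_zero
  simp only [braid_sum_right s]
  rcases QMatrix.fin3 x with rfl | rfl | rfl <;> rcases QMatrix.fin3 i with rfl | rfl | rfl <;>
    rcases QMatrix.fin3 k with rfl | rfl | rfl <;> rcases hs with rfl | rfl <;>
    simp <;> field_simp <;> ring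

theorem isQMatrix_braidRep {q s : ℂˣ} (hs : s = q ∨ s = q⁻¹) (t : ℂ) :
    IsQMatrix q (braidRep q s t) := by
  refine IsQMatrix.of_braid_mul (s := s) fun i k j l => ?_
  ext x y
  -- The tensor is concentrated at (j, l, y), so that a single matrix entry is read off; t * t is
  -- the scale of two factors `braidRep`.
  have h := yang_baxter hs
    (fun a b c => if a = j then if b = l then if c = y then t * t else 0 else 0 else 0) x i k
  have hL : ∀ g : Fin 3 → Fin 3 → ℂ,
      (∑ a, ∑ b, g a b • (braidRep q s t a j * braidRep q s t b l)) x y =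
      ∑ a, ∑ b, g a b • ∑ d, braid q s x a j d * braid q s d b l y * (t * t) := by
    intro g
    simp only [Matrix.sum_apply, Matrix.smul_apply, Matrix.mul_apply, braidRep, Matrix.of_apply]
    refine Finset.sum_congr rfl fun a _ => Finset.sum_congr rfl fun b _ => ?_
    congr 1
    refine Finset.sum_congr rfl fun d _ => ?_
    ring
  have hR : (∑ a, ∑ b, braid q s a b j l • (braidRep q s t i a * braidRep q s t k b)) x y =
      ∑ a, ∑ b, braid q s x i a b • ∑ d, braid q s b k d y * braid q s a d j l * (t * t) := by
    simp only [Matrix.sum_apply, Matrix.smul_apply, Matrix.mul_apply, braidRep, Matrix.of_apply]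
    simp only [Fin.sum_univ_three, smul_eq_mul]
    ring
  rw [hL, hR]
  simpa [Finset.sum_ite_eq', mul_assoc] using h

/-- That the determinant acts by a scalar, and the value of this scalar, decides which calculi
descend to SL. -/
theorem qDet_braidRep {q s : ℂˣ} (hs : s = q ∨ s = q⁻¹) (t : ℂ) :
    qDet q (braidRep q s t) = (t ^ 3 * (s : ℂ)⁻¹) • 1 := by
  have hq := q.ne_zero
  rcases hs with rfl | rfl <;> ext i j <;> fin_cases i <;> fin_cases j <;>
    simp [qDet, braidRep, braid, Matrix.mul_apply, Fin.sum_univ_three] <;> ring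

end Family

/-! ### Frames of quantum groups -/

section QFrame

theorem sum_rotate {M : Type*} [AddCommMonoid M] {α β γ : Type*} [Fintype α] [Fintype β]
    [Fintype γ] (F : α → β → γ → M) :
    ∑ a, ∑ b, ∑ c, F a b c = ∑ c, ∑ a, ∑ b, F a b c :=
  (Finset.sum_congr rfl fun _ _ => Finset.sum_comm).trans Finset.sum_comm

theorem sum_rotate₅ {M : Type*} [AddCommMonoid M] {α β γ δ ε : Type*} [Fintype α] [Fintype β]
    [Fintype γ] [Fintype δ] [Fintype ε] (F : α → β → γ → δ → ε → M) :
    ∑ a, ∑ b, ∑ c, ∑ d, ∑ e, F a b c d e = ∑ c, ∑ d, ∑ e, ∑ a, ∑ b, F a b c d e := by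
  rw [sum_rotate]
  refine Finset.sum_congr rfl fun c _ => ?_
  rw [sum_rotate]
  exact Finset.sum_congr rfl fun d _ => sum_rotate _

/-- A family obtained from a left basis by an invertible matrix is a left basis. -/
theorem basis_of_matrix {H M ι : Type*} [Ring H] [AddCommGroup M] [Module H M] [Fintype ι]
    [DecidableEq ι] {v w : ι → M} (P N : Matrix ι ι H) (hw : ∀ i, w i = ∑ j, P i j • v j)
    (hv : ∀ i, v i = ∑ j, N i j • w j) (hPN : P * N = 1)
    (h : LinearIndependent H v ∧ Submodule.span H (Set.range v) = ⊤) :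
    LinearIndependent H w ∧ Submodule.span H (Set.range w) = ⊤ := by
  constructor
  · rw [Fintype.linearIndependent_iff]
    intro g hg
    have h1 : ∑ j, (Matrix.vecMul g P) j • v j = 0 := by
      rw [← hg]
      simp only [hw, Matrix.vecMul, dotProduct, Finset.smul_sum, Finset.sum_smul, mul_smul]
      exact Finset.sum_comm
    have h2 : Matrix.vecMul g P = 0 := funext (Fintype.linearIndependent_iff.mp h.1 _ h1)
    have h3 : g = 0 := by
      rw [← Matrix.vecMul_one g, ← hPN, ← Matrix.vecMul_vecMul, h2, Matrix.zero_vecMul]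
    exact fun i => congrFun h3 i
  · rw [eq_top_iff, ← h.2, Submodule.span_le]
    rintro _ ⟨i, rfl⟩
    rw [hv]
    exact Submodule.sum_mem _ fun j _ =>
      Submodule.smul_mem _ _ (Submodule.subset_span ⟨j, rfl⟩)

namespace QGroup

variable {q : ℂˣ} {H : Type} [Ring H] [Bialgebra ℂ H] (G : QGroup q H)

/-- The matrix entries as a family of nine elements. -/
def entries (p : Fin 3 × Fin 3) : H := G.z p.1 p.2

theorem gen_of {P : H → Prop} (hz : ∀ i j, P (G.z i j)) (hc : ∀ c : ℂ, P (algebraMap ℂ H c))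
    (hadd : ∀ a b, P a → P b → P (a + b)) (hmul : ∀ a b, P a → P b → P (a * b))
    (hinv : ∀ a b, P a → a * b = 1 → b * a = 1 → P b) (b : H) : P b := by
  let A : Subalgebra ℂ H :=
    { carrier := {b | P b}
      mul_mem' := fun {a b} => hmul a b
      add_mem' := fun {a b} => hadd a b
      algebraMap_mem' := hc }
  have : b ∈ A := by
    rw [G.gen A hz hinv]
    trivial
  exact this

variable {M : Type*} [AddCommGroup M] [Module H M]

/-- Multiplying a family by the quantum matrix. -/
def zMul (ω : Fin 3 × Fin 3 → M) (p : Fin 3 × Fin 3) : M := ∑ m, G.z p.1 m • ω (m, p.2)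

/-- Multiplying a family by the inverse quantum matrix. -/
def SMul (ω : Fin 3 × Fin 3 → M) (p : Fin 3 × Fin 3) : M := ∑ m, G.S p.1 m • ω (m, p.2)

theorem zMul_SMul (ω : Fin 3 × Fin 3 → M) : G.zMul (G.SMul ω) = ω := by
  funext p
  simp only [zMul, SMul, Finset.smul_sum, smul_smul]
  rw [Finset.sum_comm]
  simp only [← Finset.sum_smul, G.mul_S]
  simp [ite_smul]

theorem SMul_zMul (ω : Fin 3 × Fin 3 → M) : G.SMul (G.zMul ω) = ω := by
  funext p
  simp only [zMul, SMul, Finset.smul_sum, smul_smul]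
  rw [Finset.sum_comm]
  simp only [← Finset.sum_smul, G.S_mul]
  simp [ite_smul]

theorem basis_zMul {ω : Fin 3 × Fin 3 → M}
    (h : LinearIndependent H ω ∧ Submodule.span H (Set.range ω) = ⊤) :
    LinearIndependent H (G.zMul ω) ∧ Submodule.span H (Set.range (G.zMul ω)) = ⊤ := by
  refine basis_of_matrix (Matrix.of fun p r => if p.2 = r.2 then G.z p.1 r.1 else 0)
    (Matrix.of fun p r => if p.2 = r.2 then G.S p.1 r.1 else 0) ?_ ?_ ?_ h
  · rintro ⟨i, j⟩
    simp [zMul, Fintype.sum_prod_type]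
  · rintro ⟨i, j⟩
    conv_lhs => rw [← G.SMul_zMul ω]
    simp [SMul, Fintype.sum_prod_type]
  · ext ⟨i, j⟩ ⟨k, l⟩
    simp [Matrix.mul_apply, Fintype.sum_prod_type, G.mul_S, Matrix.one_apply, ite_and]
    split_ifs <;> simp_all [G.mul_S]

/-- The Maurer-Cartan forms. -/
def mc (Γ : FODC H) (p : Fin 3 × Fin 3) : Γ.Form := G.SMul (fun r => Γ.d (G.z r.1 r.2)) p

theorem d_z_eq (Γ : FODC H) (i j : Fin 3) : Γ.d (G.z i j) = ∑ a, G.z i a • G.mc Γ (a, j) :=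
  (congrFun (G.zMul_SMul fun r => Γ.d (G.z r.1 r.2)) (i, j)).symm

/-- The quantum trace of the Maurer-Cartan forms. -/
noncomputable def mcTr (Γ : FODC H) : Γ.Form := ∑ i, qWeight q i • G.mc Γ (i, i)

/-- The commutation relations of the Maurer-Cartan forms in the calculi of the two families. -/
def MCRel (s : ℂˣ) (t : ℂ) (Γ : FODC H) (Y : Γ.Form) : Prop :=
  ∀ a j k l, G.mc Γ (a, j) <• G.z k l = ∑ m, G.z k m •
    (t • ∑ x, ∑ b, ∑ d, (braid q s a m x b * braid q s x d j l) •
      (G.mc Γ (b, d) - if b = d then (t - 1) • Y else 0) +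
      if a = j then (t - 1) • (G.mc Γ (m, l) + if m = l then Y else 0) else 0)

/-- The commutation relations of the differentials `dz i j` in the calculi of the two families. -/
def DZRel (s : ℂˣ) (t : ℂ) (Γ : FODC H) (Y : Γ.Form) : Prop :=
  ∀ i j k l, Γ.d (G.z i j) <• G.z k l =
    t • ∑ a, ∑ m, braid q s i k a m • ∑ x, ∑ d, braid q s x d j l •
      (G.z a x • (Γ.d (G.z m d) - (t - 1) • G.z m d • Y)) +
    (t - 1) • G.z i j • (Γ.d (G.z k l) + G.z k l • Y)

/-- Multiplying the relation for θ by Z from the left produces Z Z B B θ. Since B commutes with Z ⊗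
Z, one of the braid matrices can be moved to the far left; the inner Z then joins θ to give dZ
again. The part of θ along Y is carried along in `ω`. -/
theorem MCRel.dzRel {s : ℂˣ} {t : ℂ} {Γ : FODC H} {Y : Γ.Form} (h : G.MCRel s t Γ Y) :
    G.DZRel s t Γ Y := by
  intro i j k l
  let ω : Fin 3 → Fin 3 → Γ.Form := fun b d => G.mc Γ (b, d) - if b = d then (t - 1) • Y else 0
  have hω : ∀ m d, Γ.d (G.z m d) - (t - 1) • G.z m d • Y = ∑ b, G.z m b • ω b d := by
    intro m d
    simp only [ω, smul_sub, Finset.sum_sub_distrib, ← d_z_eq]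
    congr 1
    simp [smul_comm (G.z m d) (t - 1) Y]
  have hR := fun i k x b (η : Γ.Form) => congrArg (fun c : H => c • η) (G.isQMatrix.braid_mul s i k x b)
  simp only [Finset.sum_smul, smul_assoc] at hR
  have hL : ∀ a, (G.z i a • G.mc Γ (a, j)) <• G.z k l =
      t • ∑ m, ∑ x, ∑ b, ∑ d, braid q s a m x b • braid q s x d j l •
        (G.z i a * G.z k m) • ω b d +
      if a = j then (t - 1) • G.z i a • ∑ m, G.z k m • (G.mc Γ (m, l) + if m = l then Y else 0)
        else 0 := by
    intro a
    rw [← smul_comm, h a j k l]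
    simp only [smul_add, Finset.smul_sum, Finset.sum_add_distrib, mul_smul]
    congr 1
    · simp only [smul_comm (G.z _ _) t,
        fun (z : H) (x y u v : Fin 3) (η : Γ.Form) => smul_comm z (braid q s x y u v) η]
      rfl
    · split_ifs with haj
      · simp only [Finset.smul_sum, smul_add, smul_comm (G.z _ _) (t - 1), Finset.sum_add_distrib]
      · simp
  have hY : Γ.d (G.z k l) + G.z k l • Y =
      ∑ m, G.z k m • (G.mc Γ (m, l) + if m = l then Y else 0) := by
    simp [smul_add, Finset.sum_add_distrib, ← d_z_eq]
  have hsum : Γ.d (G.z i j) <• G.z k l = ∑ a, (G.z i a • G.mc Γ (a, j)) <• G.z k l := by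
    rw [d_z_eq, Finset.smul_sum]
  rw [hsum]
  simp only [hL, hω, hY, Finset.sum_add_distrib, Finset.sum_ite_eq', Finset.mem_univ, if_true]
  congr 1
  rw [← Finset.smul_sum]
  congr 1
  have e2 : ∑ a, ∑ m, braid q s i k a m • ∑ x, ∑ d, braid q s x d j l •
        (G.z a x • ∑ b, G.z m b • ω b d) =
      ∑ a, ∑ m, ∑ x, ∑ b, ∑ d, braid q s x d j l • braid q s i k a m •
        (G.z a x * G.z m b) • ω b d := by
    refine Finset.sum_congr rfl fun a _ => Finset.sum_congr rfl fun m _ => ?_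
    rw [Finset.smul_sum]
    refine Finset.sum_congr rfl fun x _ => ?_
    rw [Finset.sum_comm, Finset.smul_sum]
    refine Finset.sum_congr rfl fun d _ => ?_
    simp only [Finset.smul_sum, mul_smul]
    exact Finset.sum_congr rfl fun b _ => smul_comm _ _ _
  rw [e2]
  refine (sum_rotate₅ _).trans (Eq.trans ?_ (sum_rotate₅ _).symm)
  refine Finset.sum_congr rfl fun x _ => Finset.sum_congr rfl fun b _ =>
    Finset.sum_congr rfl fun d _ => ?_
  have e3 := congrArg (fun η : Γ.Form => braid q s x d j l • η) (hR i k x b (ω b d))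
  simp only [Finset.smul_sum] at e3
  rw [e3]
  exact Finset.sum_congr rfl fun a _ => Finset.sum_congr rfl fun m _ => smul_comm _ _ _

end QGroup

end QFrame

/-! ### The model calculi -/

section Model

open scoped Kronecker

/-- The algebra map `A ↦ A ⊗ 1`. -/
def kroneckerLeft : Matrix (Fin 3) (Fin 3) ℂ →ₐ[ℂ] Matrix (Fin 3 × Fin 3) (Fin 3 × Fin 3) ℂ where
  toFun A := A ⊗ₖ 1
  map_one' := Matrix.one_kronecker_one
  map_mul' A B := by rw [← Matrix.mul_kronecker_mul, mul_one]
  map_zero' := Matrix.zero_kronecker _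
  map_add' A B := Matrix.add_kronecker _ _ _
  commutes' c := by
    simp only [Algebra.algebraMap_eq_smul_one, Matrix.smul_kronecker, Matrix.one_kronecker_one]

/-- The algebra map `A ↦ 1 ⊗ A`. -/
def kroneckerRight : Matrix (Fin 3) (Fin 3) ℂ →ₐ[ℂ] Matrix (Fin 3 × Fin 3) (Fin 3 × Fin 3) ℂ where
  toFun A := 1 ⊗ₖ A
  map_one' := Matrix.one_kronecker_one
  map_mul' A B := by rw [← Matrix.mul_kronecker_mul, mul_one]
  map_zero' := Matrix.kronecker_zero _
  map_add' A B := Matrix.kronecker_add _ _ _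
  commutes' c := by
    simp only [Algebra.algebraMap_eq_smul_one, Matrix.kronecker_smul, Matrix.one_kronecker_one]

theorem qDet_braidRep_transpose {q s : ℂˣ} (hs : s = q ∨ s = q⁻¹) (t : ℂ) :
    qDet q (fun i j => braidRep q s t j i) = (t ^ 3 * (s : ℂ)⁻¹) • 1 := by
  have hq := q.ne_zero
  rcases hs with rfl | rfl <;> ext i j <;> fin_cases i <;> fin_cases j <;>
    simp [qDet, braidRep, braid, Matrix.mul_apply, Fin.sum_univ_three] <;> ring

/-- The values of the matrix functional of a family on the generators. -/
noncomputable def familyMatrix (q s : ℂˣ) (t : ℂ) (k l : Fin 3) :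
    Matrix (Fin 3 × Fin 3) (Fin 3 × Fin 3) ℂ :=
  ∑ a, kroneckerLeft (braidRep q s t k a) * kroneckerRight (braidRep q s 1 l a)

theorem familyMatrix_apply (q s : ℂˣ) (t : ℂ) (k l i j b d : Fin 3) :
    familyMatrix q s t k l (i, j) (b, d) =
      t * ∑ a, braid q s i k a b * braid q s a d j l := by
  simp only [familyMatrix, kroneckerLeft, kroneckerRight, AlgHom.coe_mk, RingHom.coe_mk,
    MonoidHom.coe_mk, OneHom.coe_mk, ← Matrix.mul_kronecker_mul, one_mul, mul_one,
    Matrix.sum_apply, Matrix.kroneckerMap_apply, braidRep, Matrix.of_apply, Finset.mul_sum]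
  refine Finset.sum_congr rfl fun a _ => ?_
  rw [braid_symm q s j l a d]
  ring

theorem kronecker_comm (A B : Matrix (Fin 3) (Fin 3) ℂ) :
    kroneckerRight A * kroneckerLeft B = kroneckerLeft B * kroneckerRight A := by
  simp only [kroneckerLeft, kroneckerRight, AlgHom.coe_mk, RingHom.coe_mk,
    MonoidHom.coe_mk, OneHom.coe_mk, ← Matrix.mul_kronecker_mul, one_mul, mul_one]

/-- The matrix is a product of two commuting quantum matrices: `braidRep` on the first tensor factor
and the transpose of `braidRep` with parameter 1 on the second. The determinant is multiplicative on
such products, which gives t³ s⁻¹ · s⁻¹ below. -/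
theorem isQMatrix_familyMatrix {q s : ℂˣ} (hs : s = q ∨ s = q⁻¹) (t : ℂ) :
    IsQMatrix q (familyMatrix q s t) :=
  ((isQMatrix_braidRep hs t).map kroneckerLeft).mul
    ((isQMatrix_braidRep hs 1).transpose.map kroneckerRight) fun _ _ _ _ => kronecker_comm _ _

theorem qDet_familyMatrix {q s : ℂˣ} (hs : s = q ∨ s = q⁻¹) (t : ℂ) :
    qDet q (familyMatrix q s t) = (t ^ 3 * (s : ℂ)⁻¹ ^ 2) • 1 := by
  refine (((isQMatrix_braidRep hs 1).transpose.map kroneckerRight).qDet_mul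
    (z := fun i j => kroneckerLeft (braidRep q s t i j)) fun _ _ _ _ => kronecker_comm _ _).trans ?_
  rw [← map_qDet, ← map_qDet, qDet_braidRep hs, qDet_braidRep_transpose hs, map_smul, map_smul,
    map_one, map_one, smul_mul_smul_comm, one_mul]
  congr 1
  ring

/-- The matrix functional of a family on `GL_q(3)`. -/
noncomputable def familyHom {q s : ℂˣ} (hs : s = q ∨ s = q⁻¹) {t : ℂ} (ht : t ≠ 0) :
    GLq q →ₐ[ℂ] Matrix (Fin 3 × Fin 3) (Fin 3 × Fin 3) ℂ :=
  GLq.lift (familyMatrix q s t) ((t ^ 3 * (s : ℂ)⁻¹ ^ 2)⁻¹ • 1) (isQMatrix_familyMatrix hs t)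
    (by
      have hs' := s.ne_zero
      rw [qDet_familyMatrix hs, smul_mul_smul_comm, one_mul, mul_inv_cancel₀ (by simp [ht]),
        one_smul])
    (by
      rw [qDet_familyMatrix hs, smul_mul_smul_comm, one_mul, inv_mul_cancel₀ (by simp [ht]),
        one_smul])

theorem familyHom_z {q s : ℂˣ} (hs : s = q ∨ s = q⁻¹) {t : ℂ} (ht : t ≠ 0) (k l : Fin 3) :
    familyHom hs ht (GLq.z q k l) = familyMatrix q s t k l := GLq.lift_z _ _ _ _ _ _ _

theorem familyHom_det {q s : ℂˣ} (hs : s = q ∨ s = q⁻¹) {t : ℂ} (ht : t ≠ 0) :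
    familyHom hs ht (GLq.det q) = (t ^ 3 * (s : ℂ)⁻¹ ^ 2) • 1 := by
  rw [GLq.det, map_qDet]
  simp only [familyHom_z]
  exact qDet_familyMatrix hs t

/-- The coefficient of the Maurer-Cartan forms of a family in the frame. -/
noncomputable def familyA (q s : ℂˣ) (t : ℂ) : ℂ :=
  t * ((s : ℂ)⁻¹ - s) * if s = q then (q : ℂ)⁻¹ else (q : ℂ) ^ 5

/-- The factor between the invariant vector of the frame and the trace form. -/
noncomputable def familyDenom (q s : ℂˣ) (t : ℂ) : ℂ :=
  familyA q s t + (t - 1) * ((q : ℂ) ^ 4 + (q : ℂ) ^ 2 + 1)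

theorem familyA_self (q : ℂˣ) (t : ℂ) :
    familyA q q t = t * ((q : ℂ)⁻¹ - q) * (q : ℂ)⁻¹ := by
  rw [familyA, if_pos rfl]

theorem familyA_inv (q : ℂˣ) (t : ℂ) :
    familyA q q⁻¹ t = t * ((q : ℂ) - (q : ℂ)⁻¹) * (q : ℂ) ^ 5 := by
  rw [familyA]
  -- If q = q⁻¹, the case distinction takes the branch of the other family, but then the factor s⁻¹
  -- - s vanishes.
  split_ifs with h
  · have : (q : ℂ)⁻¹ = q := by rw [← Units.val_inv_eq_inv_val, h]
    simp [this]
  · simp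

-- Applied to the trace vector X, the functional f(z m l) gives A e_ml + t δ X. Subtracting δ X
-- leaves A e_ml + (t - 1) δ X, the coordinates of the Maurer-Cartan forms; this fixes the constant
-- `familyA`.
set_option maxHeartbeats 4000000 in
theorem weight_familyMatrix {q s : ℂˣ} (hs : s = q ∨ s = q⁻¹) (t : ℂ) (m l b d : Fin 3) :
    ∑ i, qWeight q i * familyMatrix q s t m l (i, i) (b, d) =
      (if m = b then if l = d then familyA q s t else 0 else 0) +
      if b = d then if m = l then t * qWeight q b else 0 else 0 := by
  have hq := q.ne_zero
  simp only [familyMatrix_apply, Fin.sum_univ_three]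
  rcases hs with rfl | rfl
  · rw [familyA_self]
    rcases QMatrix.fin3 m with rfl | rfl | rfl <;> rcases QMatrix.fin3 l with rfl | rfl | rfl <;>
      rcases QMatrix.fin3 b with rfl | rfl | rfl <;> rcases QMatrix.fin3 d with rfl | rfl | rfl <;>
      simp [braid, qWeight] <;> field_simp <;> ring
  · rw [familyA_inv]
    rcases QMatrix.fin3 m with rfl | rfl | rfl <;> rcases QMatrix.fin3 l with rfl | rfl | rfl <;>
      rcases QMatrix.fin3 b with rfl | rfl | rfl <;> rcases QMatrix.fin3 d with rfl | rfl | rfl <;>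
      simp [braid, qWeight] <;> field_simp <;> ring

end Model

/-! ### The inner calculi on the frame and their Maurer-Cartan forms -/

section ModelCalculus

variable {q s : ℂˣ} {t : ℂ} {H : Type} [Ring H] [Bialgebra ℂ H] (G : QGroup q H)
  {f : H →ₐ[ℂ] Matrix (Fin 3 × Fin 3) (Fin 3 × Fin 3) ℂ}

/-- The invariant vector of the frame. -/
def frameTr (q : ℂˣ) (p : Fin 3 × Fin 3) : ℂ := if p.1 = p.2 then qWeight q p.1 else 0

theorem sum_frameTr {M : Type*} [AddCommGroup M] [Module ℂ M] (g : Fin 3 × Fin 3 → M) :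
    ∑ p, frameTr q p • g p = ∑ i, qWeight q i • g (i, i) := by
  simp [Fintype.sum_prod_type, frameTr, ite_smul]

theorem sum_rotate₄ {M : Type*} [AddCommMonoid M] {α β γ δ : Type*} [Fintype α] [Fintype β]
    [Fintype γ] [Fintype δ] (F : α → β → γ → δ → M) :
    ∑ a, ∑ b, ∑ c, ∑ d, F a b c d = ∑ d, ∑ a, ∑ b, ∑ c, F a b c d :=
  (Finset.sum_congr rfl fun _ _ => sum_rotate _).trans Finset.sum_comm

namespace QGroup

theorem matConvR_z {ι : Type} [Fintype ι] [DecidableEq ι] (f : H →ₐ[ℂ] Matrix ι ι ℂ)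
    (k l : Fin 3) (p r : ι) :
    matConvR f (G.z k l) p r = ∑ m, f (G.z m l) p r • G.z k m := by
  rw [matConvR_apply, convR, LinearMap.comp_apply, LinearMap.comp_apply, G.comul_z]
  simp

theorem matConvL_z {ι : Type} [Fintype ι] [DecidableEq ι] (f : H →ₐ[ℂ] Matrix ι ι ℂ)
    (k l : Fin 3) (p r : ι) :
    matConvL f (G.z k l) p r = ∑ m, f (G.z k m) p r • G.z m l := by
  rw [matConvL_apply, convL, LinearMap.comp_apply, LinearMap.comp_apply, G.comul_z]
  simp

/-- The right coaction on the frame. -/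
def coact : Matrix (Fin 3 × Fin 3) (Fin 3 × Fin 3) H := fun p r => G.S p.1 r.1 * G.z r.2 p.2

theorem frameTr_coact (k : Fin 3 × Fin 3) :
    ∑ p, frameTr q p • G.coact p k = frameTr q k • (1 : H) := by
  obtain ⟨c, e⟩ := k
  refine (sum_frameTr _).trans ((G.weight c e).trans ?_)
  simp [frameTr, ite_smul]

/-- On generators this is a computation on three legs: from B₁₂ Z₁ Z₂ = Z₁ Z₂ B₁₂ follows S₁ B₁₂ Z₁
= Z₂ B₁₂ S₂, which is combined with B₁₃ Z₁ Z₃ = Z₁ Z₃ B₁₃. The identity is stable under products and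
inverses in b because both convolutions are algebra maps. -/
theorem matConv_coact (hf : ∀ k l, f (G.z k l) = familyMatrix q s t k l) (b : H) :
    matConvR f b * G.coact = G.coact * matConvL f b := by
  induction b using G.gen_of with
  | hz k l =>
    have h12 := leg12_rtt (g := braid q s) (G.isQMatrix.braid_mul s)
    have h13 := leg13_rtt (g := braid q s) (G.isQMatrix.braid_mul s)
    have hz1 : leg1 G.S * leg1 G.z = 1 := leg1_mul_of G.S_mul
    have hz2 : leg2 G.z * leg2 G.S = 1 := leg2_mul_of G.mul_S
    have h1 : leg1 G.S * leg12 H (braid q s) * leg1 G.z =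
        leg2 G.z * leg12 H (braid q s) * leg2 G.S := by
      calc leg1 G.S * leg12 H (braid q s) * leg1 G.z
          = leg1 G.S * (leg12 H (braid q s) * (leg1 G.z * leg2 G.z)) * leg2 G.S := by
            simp only [mul_assoc, hz2, mul_one]
        _ = leg2 G.z * leg12 H (braid q s) * leg2 G.S := by
            rw [h12]
            simp only [← mul_assoc, hz1, one_mul]
    have h2 : leg2 G.z * leg12 H (braid q s) * leg2 G.S * (leg3 G.z * leg13 H (braid q s)) =
        leg1 G.S * leg12 H (braid q s) * (leg13 H (braid q s) * (leg1 G.z * leg3 G.z)) := by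
      rw [h13, ← h1]
      simp only [mul_assoc]
    ext ⟨i, j⟩ ⟨c, e⟩
    -- In this entry k and l are the indices of the generator, while (i, j) and (c, e) are indices
    -- of the frame.
    have h3 := congrFun (congrFun h2 (i, k, e)) (j, c, l)
    simp only [Matrix.mul_apply, leg1, leg2, leg3, leg12, leg13, Fintype.sum_prod_type, mul_ite, ite_mul,
      zero_mul, mul_zero, Finset.sum_ite_eq, Finset.sum_ite_eq', Finset.mem_univ, if_true, Finset.sum_ite_irrel, Finset.sum_const_zero] at h3
    simp only [Matrix.mul_apply, matConvR_z, matConvL_z, hf, familyMatrix_apply, Fintype.sum_prod_type, coact]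
    have e1 : ∀ (c : ℂ) (x : H), x * algebraMap ℂ H c = c • x := fun c x => by
      rw [← Algebra.commutes, Algebra.smul_def]
    simp only [e1, ← Algebra.smul_def, Finset.sum_mul, Finset.mul_sum, smul_mul_assoc,
      mul_smul_comm, smul_smul, mul_assoc, Finset.sum_smul] at h3 ⊢
    have h4 := congrArg (fun x : H => t • x) h3
    simp only [Finset.smul_sum, smul_smul] at h4
    refine (sum_rotate₄ _).trans (Eq.trans ?_ (h4.trans ?_))
    · refine Finset.sum_congr rfl fun a _ => Finset.sum_comm.trans ?_
      refine Finset.sum_congr rfl fun d _ => Finset.sum_congr rfl fun b _ =>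
        Finset.sum_congr rfl fun m _ => ?_
      congr 1
      ring
    · refine Eq.trans (Finset.sum_congr rfl fun a _ => ?_) (sum_rotate₄ _).symm
      refine (sum_rotate _).trans ?_
      refine Finset.sum_congr rfl fun d _ => Finset.sum_congr rfl fun b _ =>
        Finset.sum_congr rfl fun m _ => ?_
      congr 1
      ring
  | hc c =>
    rw [AlgHom.commutes, AlgHom.commutes, Algebra.commutes]
  | hadd a b ha hb => rw [map_add, map_add, add_mul, mul_add, ha, hb]
  | hmul a b ha hb => rw [map_mul, map_mul, mul_assoc, hb, ← mul_assoc, ha, mul_assoc]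
  | hinv a b ha hab hba =>
    have h1 : matConvR f b * matConvR f a = 1 := by rw [← map_mul, hba, map_one]
    have h2 : matConvL f a * matConvL f b = 1 := by rw [← map_mul, hab, map_one]
    calc matConvR f b * G.coact = matConvR f b * (G.coact * matConvL f a) * matConvL f b := by
          rw [mul_assoc, mul_assoc, h2, mul_one]
      _ = G.coact * matConvL f b := by
          rw [← ha, ← mul_assoc, h1, one_mul]

/-- The forms `A e + (t - 1) δ X` in the frame. -/
noncomputable def frameMC (f : H →ₐ[ℂ] Matrix (Fin 3 × Fin 3) (Fin 3 × Fin 3) ℂ) (q s : ℂˣ) (t : ℂ)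
    (p : Fin 3 × Fin 3) : Frame f :=
  familyA q s t • Frame.single f p 1 +
    if p.1 = p.2 then (t - 1) • ∑ i, qWeight q i • Frame.single f (i, i) 1 else 0

theorem frame_eq_sum (h : Frame f) : h = ∑ r, h r • Frame.single f r 1 := by
  conv_lhs => rw [← Frame.sum_single h]
  exact Finset.sum_congr rfl fun r _ => by
    rw [← map_smul, smul_eq_mul, mul_one]

theorem single_rsmul (p : Fin 3 × Fin 3) (b : H) :
    (Frame.single f p 1) <• b = ∑ r, matConvR f b p r • Frame.single f r 1 := by
  refine (frame_eq_sum _).trans (Finset.sum_congr rfl fun r _ => ?_)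
  rw [Frame.rsmul_apply]
  simp [Frame.single_apply]

theorem single_rsmul_z (hf : ∀ k l, f (G.z k l) = familyMatrix q s t k l) (i j k l : Fin 3) :
    (Frame.single f (i, j) 1) <• G.z k l = ∑ m, G.z k m • (t • ∑ a, ∑ b, ∑ d,
      (braid q s i m a b * braid q s a d j l) • Frame.single f (b, d) 1) := by
  rw [single_rsmul]
  simp only [G.matConvR_z, hf, Finset.sum_smul, Fintype.sum_prod_type, familyMatrix_apply,
    Finset.smul_sum, smul_assoc, Finset.mul_sum]
  refine (sum_rotate _).trans (Finset.sum_congr rfl fun m _ => ?_)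
  refine (sum_rotate _).trans (Finset.sum_congr rfl fun a _ => Finset.sum_congr rfl fun b _ =>
    Finset.sum_congr rfl fun d _ => ?_)
  rw [smul_comm, smul_smul]

theorem innerD_z (hf : ∀ k l, f (G.z k l) = familyMatrix q s t k l) (hs : s = q ∨ s = q⁻¹)
    (k l : Fin 3) : Frame.innerD f (frameTr q) (G.z k l) =
      ∑ m, G.z k m • frameMC f q s t (m, l) := by
  have h : ∀ b d, Frame.innerD f (frameTr q) (G.z k l) (b, d) =
      ∑ m, ((if m = b then if l = d then familyA q s t else 0 else 0) +
        if b = d then if m = l then (t - 1) * qWeight q b else 0 else 0) • G.z k m := by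
    intro b d
    have h := fun m => weight_familyMatrix hs t m l b d
    rw [Frame.innerD_apply, sum_frameTr]
    simp only [G.matConvR_z, hf, Finset.smul_sum, smul_smul]
    have e : ∑ x, ∑ m, (qWeight q x * familyMatrix q s t m l (x, x) (b, d)) • G.z k m =
        ∑ m, ((if m = b then if l = d then familyA q s t else 0 else 0) +
          if b = d then if m = l then t * qWeight q b else 0 else 0) • G.z k m := by
      rw [Finset.sum_comm]
      exact Finset.sum_congr rfl fun m _ => by rw [← Finset.sum_smul, h]
    rw [e]
    simp only [add_smul, Finset.sum_add_distrib]
    by_cases hbd : b = d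
    · simp [hbd, ite_smul, sub_mul, sub_smul, frameTr]
      abel
    · simp [hbd, frameTr]
  rw [frame_eq_sum (Frame.innerD f (frameTr q) (G.z k l)), Fintype.sum_prod_type]
  simp only [h, frameMC, smul_add, Finset.sum_add_distrib, add_smul, Finset.sum_smul]
  congr 1
  · simpa [ite_smul] using Finset.sum_congr rfl fun x _ => (smul_comm _ _ _).symm
  · simp only [mul_smul, ite_smul, zero_smul, smul_ite, smul_zero, Finset.sum_ite_eq, Finset.sum_ite_eq',
      Finset.mem_univ, if_true, Finset.smul_sum]
    refine Finset.sum_congr rfl fun x _ => ?_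
    simp [smul_comm (G.z k l) (t - 1), smul_comm (G.z k l) (qWeight q x)]

/-- The invariant element of the frame. -/
noncomputable def frameX (f : H →ₐ[ℂ] Matrix (Fin 3 × Fin 3) (Fin 3 × Fin 3) ℂ) (q : ℂˣ) :
    Frame f := ∑ i, qWeight q i • Frame.single f (i, i) 1

theorem frameMC_eq (i j : Fin 3) : frameMC f q s t (i, j) =
    familyA q s t • Frame.single f (i, j) 1 + if i = j then (t - 1) • frameX f q else 0 := rfl

theorem qWeight_sum (q : ℂˣ) : ∑ i, qWeight q i = (q : ℂ) ^ 4 + (q : ℂ) ^ 2 + 1 := by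
  simp [Fin.sum_univ_three, qWeight]

/-- X can be recovered from the trace of the Maurer-Cartan forms when `familyDenom` does not vanish.
This is the origin of the denominators in σ and β. -/
theorem sum_frameMC : ∑ i, qWeight q i • frameMC f q s t (i, i) =
    familyDenom q s t • frameX f q := by
  simp only [frameMC_eq, if_true, smul_add, Finset.sum_add_distrib, familyDenom, add_smul]
  congr 1
  · simp only [frameX, Finset.smul_sum]
    exact Finset.sum_congr rfl fun i _ => smul_comm _ _ _
  · rw [← Finset.sum_smul, qWeight_sum, smul_smul, mul_comm]

/-- The forms arise from the standard basis by the matrix A + (t - 1) E, where E has rank one and E²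
= (q⁴ + q² + 1) E. Its inverse is A⁻¹ (1 - (t - 1) a⁻¹ E) with a = A + (t - 1)(q⁴ + q² + 1), which
is `familyDenom`. -/
theorem frameMC_basis (hA : familyA q s t ≠ 0) (ha : familyDenom q s t ≠ 0) :
    LinearIndependent H (frameMC f q s t) ∧
      Submodule.span H (Set.range (frameMC f q s t)) = ⊤ := by
  have hv : ∀ p : Fin 3 × Fin 3, Frame.single f p 1 =
      (familyA q s t)⁻¹ • (frameMC f q s t p - if p.1 = p.2 then ((t - 1) * (familyDenom q s t)⁻¹) •
        ∑ i, qWeight q i • frameMC f q s t (i, i) else 0) := by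
    rintro ⟨i, j⟩
    rw [sum_frameMC, frameMC_eq, smul_smul, mul_assoc, inv_mul_cancel₀ ha, mul_one,
      add_sub_cancel_right, smul_smul, inv_mul_cancel₀ hA, one_smul]
  let u : Fin 3 × Fin 3 → ℂ := fun p => if p.1 = p.2 then 1 else 0
  let E := Matrix.vecMulVec u (frameTr q)
  have hE : E * E = ((q : ℂ) ^ 4 + (q : ℂ) ^ 2 + 1) • E := by
    rw [Matrix.vecMulVec_mul_vecMulVec, ← qWeight_sum]
    congr 1
    ext p r
    simp [E, u, Matrix.vecMulVec, dotProduct, Fintype.sum_prod_type, frameTr]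
  have hcoe : ∀ (g : Fin 3 × Fin 3 → Frame f) p, ∑ j, E.map (algebraMap ℂ H) p j • g j =
      if p.1 = p.2 then ∑ i, qWeight q i • g (i, i) else 0 := by
    intro g p
    rw [← sum_frameTr]
    simp only [E, u, Matrix.map_apply, Matrix.vecMulVec_apply, algebraMap_smul]
    split_ifs <;> simp
  refine basis_of_matrix (v := fun p => Frame.single f p 1)
    (familyA q s t • (1 : Matrix _ _ H) + (t - 1) • E.map (algebraMap ℂ H))
    ((familyA q s t)⁻¹ • ((1 : Matrix _ _ H) -
      ((t - 1) * (familyDenom q s t)⁻¹) • E.map (algebraMap ℂ H))) ?_ ?_ ?_ ?_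
  · intro p
    simp only [Matrix.add_apply, Matrix.smul_apply, add_smul, Finset.sum_add_distrib, smul_assoc,
      ← Finset.smul_sum, hcoe, Matrix.one_apply, ite_smul, one_smul, zero_smul, Finset.sum_ite_eq,
      Finset.mem_univ, if_true, smul_ite, smul_zero]
    rfl
  · intro p
    simp only [Matrix.sub_apply, Matrix.smul_apply, sub_smul, Finset.sum_sub_distrib, smul_assoc,
      ← Finset.smul_sum, hcoe, Matrix.one_apply, ite_smul, one_smul, zero_smul, Finset.sum_ite_eq,
      Finset.mem_univ, if_true, smul_ite, smul_zero]
    exact hv p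
  · have hEH : E.map (algebraMap ℂ H) * E.map (algebraMap ℂ H) =
        ((q : ℂ) ^ 4 + (q : ℂ) ^ 2 + 1) • E.map (algebraMap ℂ H) := by
      rw [← Matrix.map_mul, hE, Matrix.map_smul]
      intro a
      simp [Algebra.smul_def]
    simp only [add_mul, mul_sub, smul_mul_assoc, mul_smul_comm, one_mul, mul_one, hEH, smul_sub,
      smul_smul]
    have hd : familyDenom q s t = familyA q s t + (t - 1) * ((q : ℂ) ^ 4 + (q : ℂ) ^ 2 + 1) := rfl
    generalize familyDenom q s t = a at ha hd
    match_scalars <;> field_simp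
    linear_combination (t - 1) * hd
  · constructor
    · rw [Fintype.linearIndependent_iff]
      intro g hg i
      have h : (fun r => g r : Frame f) = 0 := by
        rw [frame_eq_sum (fun r => g r : Frame f)]
        exact hg
      exact congrFun h i
    · rw [eq_top_iff]
      intro h _
      rw [frame_eq_sum h]
      exact Submodule.sum_mem _ fun r _ => Submodule.smul_mem _ _ (Submodule.subset_span ⟨r, rfl⟩)

theorem frame_span (hf : ∀ k l, f (G.z k l) = familyMatrix q s t k l) (hs : s = q ∨ s = q⁻¹)
    (hA : familyA q s t ≠ 0) (ha : familyDenom q s t ≠ 0) :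
    Submodule.span H (Set.range (Frame.innerD f (frameTr q))) = ⊤ := by
  have h := (G.basis_zMul (frameMC_basis (f := f) hA ha)).2
  rw [eq_top_iff, ← h, Submodule.span_le]
  rintro _ ⟨⟨k, l⟩, rfl⟩
  exact Submodule.subset_span ⟨G.z k l, innerD_z G hf hs k l⟩

theorem frameX_apply (p : Fin 3 × Fin 3) : frameX f q p = frameTr q p • (1 : H) := by
  simp only [frameX, Frame.sum_apply, Frame.csmul_apply, Frame.single_apply, frameTr]
  obtain ⟨i, j⟩ := p
  rcases eq_or_ne i j with rfl | h
  · simp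
  · have : ∀ k, ¬ (i = k ∧ j = k) := by rintro k ⟨rfl, rfl⟩; exact h rfl
    simp [h, this]

theorem frameX_rsmul_eq (b : H) :
    frameX f q <• b = b • frameX f q + Frame.innerD f (frameTr q) b := by
  ext p
  simp [Frame.rsmul_apply, Frame.add_apply, Frame.smul_apply, Frame.innerD_apply, frameX_apply]

theorem frameX_rsmul (hf : ∀ k l, f (G.z k l) = familyMatrix q s t k l) (hs : s = q ∨ s = q⁻¹)
    (k l : Fin 3) : frameX f q <• G.z k l =
    G.z k l • frameX f q + ∑ m, G.z k m • frameMC f q s t (m, l) := by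
  rw [← innerD_z G hf hs k l, frameX_rsmul_eq]

/-- The model calculi of the two families. -/
noncomputable def model (hf : ∀ k l, f (G.z k l) = familyMatrix q s t k l) (hs : s = q ∨ s = q⁻¹)
    (hA : familyA q s t ≠ 0) (ha : familyDenom q s t ≠ 0) : FODC H :=
  innerFODC f (frameTr q) (G.frame_span hf hs hA ha)

section

variable (hf : ∀ k l, f (G.z k l) = familyMatrix q s t k l) (hs : s = q ∨ s = q⁻¹)
    (hA : familyA q s t ≠ 0) (ha : familyDenom q s t ≠ 0)

theorem model_bicovariant : (G.model hf hs hA ha).Bicovariant :=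
  innerFODC_bicovariant _ G.coact (G.matConv_coact hf) G.frameTr_coact

theorem model_d_z : (fun p : Fin 3 × Fin 3 => (G.model hf hs hA ha).d (G.z p.1 p.2)) =
    G.zMul (frameMC f q s t) :=
  funext fun p => innerD_z G hf hs p.1 p.2

theorem model_basis : (G.model hf hs hA ha).HasBasis G.entries := by
  have h := G.basis_zMul (frameMC_basis (f := f) hA ha)
  rw [← G.model_d_z hf hs hA ha] at h
  exact h

theorem model_mc (p : Fin 3 × Fin 3) : G.mc (G.model hf hs hA ha) p = frameMC f q s t p := by
  have h := congrFun (G.SMul_zMul (frameMC f q s t)) p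
  rw [← G.model_d_z hf hs hA ha] at h
  exact h

theorem model_mcTr : G.mcTr (G.model hf hs hA ha) = familyDenom q s t • frameX f q := by
  simp only [mcTr, model_mc]
  exact sum_frameMC

/-- Split θ = A e + (t - 1) δ X. The multiples of e are moved past z by the matrix functional, and X
z = z X + dz because the differential is inner. -/
theorem model_mcRel : G.MCRel s t (G.model hf hs hA ha) (frameX f q) := by
  intro a j k l
  simp only [model_mc]
  have h1 : ∀ b d, frameMC f q s t (b, d) - (if b = d then (t - 1) • frameX f q else 0) =
      familyA q s t • Frame.single f (b, d) 1 := fun b d => by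
    rw [frameMC_eq, add_sub_cancel_right]
  have h2 : frameMC f q s t (a, j) <• G.z k l = ∑ m, G.z k m • (familyA q s t • (t • ∑ x, ∑ b, ∑ d,
      (braid q s a m x b * braid q s x d j l) • Frame.single f (b, d) 1) +
      if a = j then (t - 1) • (frameMC f q s t (m, l) + if m = l then frameX f q else 0)
        else 0) := by
    rw [frameMC_eq, smul_add, smul_comm, single_rsmul_z G hf]
    simp only [smul_add, Finset.sum_add_distrib]
    congr 1
    · rw [Finset.smul_sum]
      exact Finset.sum_congr rfl fun m _ => smul_comm _ _ _
    · split_ifs with haj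
      · rw [smul_comm, frameX_rsmul G hf hs, smul_add, add_comm, Finset.smul_sum]
        simp only [smul_add, Finset.sum_add_distrib]
        congr 1
        · exact Finset.sum_congr rfl fun m _ => smul_comm _ _ _
        · simp [smul_comm (G.z k l) (t - 1)]
      · simp
  refine Eq.trans h2 (Finset.sum_congr rfl fun m _ => ?_)
  congr 2
  have h3 : ∀ b d, G.mc (G.model hf hs hA ha) (b, d) = frameMC f q s t (b, d) := fun b d =>
    G.model_mc hf hs hA ha (b, d)
  rw [smul_comm]
  congr 1
  simp only [Finset.smul_sum]
  refine Finset.sum_congr rfl fun x _ => Finset.sum_congr rfl fun b _ =>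
    Finset.sum_congr rfl fun d _ => ?_
  rw [smul_comm, ← h1]
  rfl

end

end QGroup

end ModelCalculus

/-! ### The commutation relations of the two families -/

section Relations

variable {q : ℂˣ}

/-- The eigenvalue of the braid matrix on the diagonal part. -/
noncomputable def braidDiag (q s : ℂˣ) (i k : Fin 3) : ℂ :=
  (s : ℂ)⁻¹ - if i = k then 0 else if i < k then (q : ℂ)⁻¹ else (q : ℂ)

/-- Each of the two braid matrices contributes at most two entries, so at most four index patterns
survive. -/
theorem QGroup.DZRel.collapse {H : Type} [Ring H] [Bialgebra ℂ H] {G : QGroup q H} {s : ℂˣ}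
    {t : ℂ} {Γ : FODC H} {Y : Γ.Form} (h : G.DZRel s t Γ Y) (i j k l : Fin 3) :
    Γ.d (G.z i j) <• G.z k l =
      t • (braidDiag q s i k • (braidDiag q s j l •
          (G.z i j • Γ.d (G.z k l) - (t - 1) • (G.z i j * G.z k l) • Y) +
          if j ≠ l then G.z i l • Γ.d (G.z k j) - (t - 1) • (G.z i l * G.z k j) • Y else 0) +
        if i ≠ k then (braidDiag q s j l •
          (G.z k j • Γ.d (G.z i l) - (t - 1) • (G.z k j * G.z i l) • Y) +
          if j ≠ l then G.z k l • Γ.d (G.z i j) - (t - 1) • (G.z k l * G.z i j) • Y else 0)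
          else 0) +
      (t - 1) • (G.z i j • Γ.d (G.z k l) + (G.z i j * G.z k l) • Y) := by
  rw [h i j k l]
  simp only [braid_sum_right, braid_sum_left]
  simp only [smul_sub, smul_add, mul_smul, smul_comm (G.z _ _) (t - 1)]
  rfl

theorem trTheta_eq (Γ : FODC (GLq q)) : (GLq.qGroup q).mcTr Γ = Γ.trTheta := by
  simp only [QGroup.mcTr, Fin.sum_univ_three, qWeight, FODC.trTheta]
  simp
  rfl

theorem familyDenom_self (q : ℂˣ) (t : ℂ) : familyDenom q q t =
    ((q : ℂ) ^ 4 * ((q : ℂ) ^ 2 + 1) * (t - 1) - (q : ℂ) ^ 2 + t) / (q : ℂ) ^ 2 := by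
  have hq := q.ne_zero
  rw [familyDenom, familyA_self]
  field_simp
  ring

theorem familyDenom_inv (q : ℂˣ) (t : ℂ) : familyDenom q q⁻¹ t =
    (q : ℂ) ^ 4 * ((q : ℂ) ^ 2 * t - 1) + ((q : ℂ) ^ 2 + 1) * (t - 1) := by
  have hq := q.ne_zero
  rw [familyDenom, familyA_inv]
  field_simp
  ring

/-- Admissibility is the nonvanishing of the factor between X and the trace form. -/
theorem admissible₁_iff {t : ℂ} : FODC.Admissible₁ q t ↔ t ≠ 0 ∧ familyDenom q q t ≠ 0 := by
  have hq := q.ne_zero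
  rw [familyDenom_self, FODC.Admissible₁, div_ne_zero_iff, and_iff_left (pow_ne_zero 2 hq)]
  ring_nf

theorem admissible₂_iff {t : ℂ} : FODC.Admissible₂ q t ↔ t ≠ 0 ∧ familyDenom q q⁻¹ t ≠ 0 := by
  rw [familyDenom_inv, FODC.Admissible₂]
  ring_nf

variable {t : ℂ} {Γ : FODC (GLq q)}

/-- Once products of two generators are brought into a common order, both sides are combinations of
the same few forms, and the coefficients are compared as rational functions of q and t. -/
theorem isGamma₁_of_dzRel (hb : Γ.Bicovariant) (hB : Γ.HasBasis (GLq.entries q))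
    (ht : FODC.Admissible₁ q t)
    (h : (GLq.qGroup q).DZRel q t Γ ((familyDenom q q t)⁻¹ • Γ.trTheta)) : FODC.IsGamma₁ t Γ := by
  have hq := q.ne_zero
  have hz := GLq.isQMatrix (q := q)
  have ha := (admissible₁_iff.mp ht).2
  have hc := h.collapse
  rw [familyDenom_self] at hc ha
  replace ha : (q : ℂ) ^ 4 * ((q : ℂ) ^ 2 + 1) * (t - 1) - (q : ℂ) ^ 2 + t ≠ 0 :=
    fun h0 => ha (by rw [h0, zero_div])
  replace hc := fun i j k l => (show Γ.d (GLq.z q i j) <• GLq.z q k l = _ from hc i j k l)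
  simp only [show (GLq.qGroup q).z = GLq.z q from rfl] at hc
  refine ⟨hb, hB, ?_, ?_, ?_, ?_, ?_⟩ <;> simp only [FODC.sigma₁, FODC.beta₁]
  · intro i j
    rw [hc]
    simp only [braidDiag, ne_eq, not_true_eq_false, if_true, if_false]
    rw [smul_comm (GLq.z q i j * GLq.z q i j)]
    generalize GLq.z q i j • Γ.d (GLq.z q i j) = ω
    generalize (GLq.z q i j * GLq.z q i j) • Γ.trTheta = τ
    match_scalars <;> field_simp <;> ring
  · intro i j l hjl
    rw [hc]
    simp only [braidDiag, ne_eq, not_true_eq_false, if_true, if_false, hjl, hjl.ne,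
      not_false_eq_true]
    simp only [smul_comm (GLq.z q _ _ * GLq.z q _ _), hz.row' i j l hjl, smul_assoc]
    generalize GLq.z q i j • Γ.d (GLq.z q i l) = ω
    generalize GLq.z q i l • Γ.d (GLq.z q i j) = ω'
    generalize (GLq.z q i j * GLq.z q i l) • Γ.trTheta = τ
    match_scalars <;> field_simp <;> ring
  · intro i j k hik
    rw [hc]
    simp only [braidDiag, ne_eq, not_true_eq_false, if_true, if_false, hik, hik.ne,
      not_false_eq_true]
    simp only [smul_comm (GLq.z q _ _ * GLq.z q _ _), hz.col' i j k hik, smul_assoc]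
    generalize GLq.z q i j • Γ.d (GLq.z q k j) = ω
    generalize GLq.z q k j • Γ.d (GLq.z q i j) = ω'
    generalize (GLq.z q i j * GLq.z q k j) • Γ.trTheta = τ
    match_scalars <;> field_simp <;> ring
  · intro i j k l hik hjl
    rw [hc]
    simp only [braidDiag, ne_eq, if_true, if_false, hik, hik.ne, hjl, hjl.ne, not_false_eq_true]
    simp only [smul_comm (GLq.z q _ _ * GLq.z q _ _), hz.cross' i j k l hik hjl,
      hz.comm' i l k j hik hjl, smul_assoc, sub_smul (M := Γ.Form) (R := GLq q)]
    generalize GLq.z q i j • Γ.d (GLq.z q k l) = ω₁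
    generalize GLq.z q k l • Γ.d (GLq.z q i j) = ω₂
    generalize GLq.z q i l • Γ.d (GLq.z q k j) = ω₃
    generalize GLq.z q k j • Γ.d (GLq.z q i l) = ω₄
    generalize (GLq.z q i j * GLq.z q k l) • Γ.trTheta = τ₁
    generalize (GLq.z q i l * GLq.z q k j) • Γ.trTheta = τ₂
    match_scalars <;> field_simp <;> ring
  · intro i j k l hik hlj
    rw [hc]
    simp only [braidDiag, ne_eq, if_true, if_false, hik, hik.ne, hlj.asymm, hlj.ne',
      not_false_eq_true]
    simp only [smul_comm (GLq.z q _ _ * GLq.z q _ _), hz.cross' i l k j hik hlj,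
      hz.comm' i j k l hik hlj, smul_assoc, sub_smul (M := Γ.Form) (R := GLq q)]
    generalize GLq.z q i j • Γ.d (GLq.z q k l) = ω₁
    generalize GLq.z q k l • Γ.d (GLq.z q i j) = ω₂
    generalize GLq.z q i l • Γ.d (GLq.z q k j) = ω₃
    generalize GLq.z q k j • Γ.d (GLq.z q i l) = ω₄
    generalize (GLq.z q i j * GLq.z q k l) • Γ.trTheta = τ₁
    generalize (GLq.z q i l * GLq.z q k j) • Γ.trTheta = τ₂
    match_scalars <;> field_simp <;> ring

theorem isGamma₂_of_dzRel (hb : Γ.Bicovariant) (hB : Γ.HasBasis (GLq.entries q))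
    (ht : FODC.Admissible₂ q t)
    (h : (GLq.qGroup q).DZRel q⁻¹ t Γ ((familyDenom q q⁻¹ t)⁻¹ • Γ.trTheta)) : FODC.IsGamma₂ t Γ := by
  have hq := q.ne_zero
  have hz := GLq.isQMatrix (q := q)
  have ha := (admissible₂_iff.mp ht).2
  have hc := h.collapse
  rw [familyDenom_inv] at hc ha
  replace hc := fun i j k l => (show Γ.d (GLq.z q i j) <• GLq.z q k l = _ from hc i j k l)
  simp only [show (GLq.qGroup q).z = GLq.z q from rfl] at hc
  refine ⟨hb, hB, ?_, ?_, ?_, ?_, ?_⟩ <;> simp only [FODC.sigma₂, FODC.beta₂]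
  · intro i j
    rw [hc]
    simp only [braidDiag, Units.val_inv_eq_inv_val, inv_inv, ne_eq, not_true_eq_false, if_true, if_false]
    rw [smul_comm (GLq.z q i j * GLq.z q i j)]
    generalize GLq.z q i j • Γ.d (GLq.z q i j) = ω
    generalize (GLq.z q i j * GLq.z q i j) • Γ.trTheta = τ
    match_scalars <;> field_simp <;> ring
  · intro i j l hjl
    rw [hc]
    simp only [braidDiag, Units.val_inv_eq_inv_val, inv_inv, ne_eq, not_true_eq_false, if_true, if_false, hjl, hjl.ne,
      not_false_eq_true]
    simp only [smul_comm (GLq.z q _ _ * GLq.z q _ _), hz.row' i j l hjl, smul_assoc]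
    generalize GLq.z q i j • Γ.d (GLq.z q i l) = ω
    generalize GLq.z q i l • Γ.d (GLq.z q i j) = ω'
    generalize (GLq.z q i j * GLq.z q i l) • Γ.trTheta = τ
    match_scalars <;> field_simp <;> ring
  · intro i j k hik
    rw [hc]
    simp only [braidDiag, Units.val_inv_eq_inv_val, inv_inv, ne_eq, not_true_eq_false, if_true, if_false, hik, hik.ne,
      not_false_eq_true]
    simp only [smul_comm (GLq.z q _ _ * GLq.z q _ _), hz.col' i j k hik, smul_assoc]
    generalize GLq.z q i j • Γ.d (GLq.z q k j) = ω
    generalize GLq.z q k j • Γ.d (GLq.z q i j) = ω'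
    generalize (GLq.z q i j * GLq.z q k j) • Γ.trTheta = τ
    match_scalars <;> field_simp <;> ring
  · intro i j k l hik hjl
    rw [hc]
    simp only [braidDiag, Units.val_inv_eq_inv_val, inv_inv, ne_eq, if_true, if_false, hik, hik.ne, hjl, hjl.ne, not_false_eq_true]
    simp only [smul_comm (GLq.z q _ _ * GLq.z q _ _), hz.cross' i j k l hik hjl,
      hz.comm' i l k j hik hjl, smul_assoc, sub_smul (M := Γ.Form) (R := GLq q)]
    generalize GLq.z q i j • Γ.d (GLq.z q k l) = ω₁
    generalize GLq.z q k l • Γ.d (GLq.z q i j) = ω₂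
    generalize GLq.z q i l • Γ.d (GLq.z q k j) = ω₃
    generalize GLq.z q k j • Γ.d (GLq.z q i l) = ω₄
    generalize (GLq.z q i j * GLq.z q k l) • Γ.trTheta = τ₁
    generalize (GLq.z q i l * GLq.z q k j) • Γ.trTheta = τ₂
    match_scalars <;> field_simp <;> ring
  · intro i j k l hik hlj
    rw [hc]
    simp only [braidDiag, Units.val_inv_eq_inv_val, inv_inv, ne_eq, if_true, if_false, hik, hik.ne, hlj.asymm, hlj.ne',
      not_false_eq_true]
    simp only [smul_comm (GLq.z q _ _ * GLq.z q _ _), hz.cross' i l k j hik hlj,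
      hz.comm' i j k l hik hlj, smul_assoc, sub_smul (M := Γ.Form) (R := GLq q)]
    generalize GLq.z q i j • Γ.d (GLq.z q k l) = ω₁
    generalize GLq.z q k l • Γ.d (GLq.z q i j) = ω₂
    generalize GLq.z q i l • Γ.d (GLq.z q k j) = ω₃
    generalize GLq.z q k j • Γ.d (GLq.z q i l) = ω₄
    generalize (GLq.z q i j * GLq.z q k l) • Γ.trTheta = τ₁
    generalize (GLq.z q i l * GLq.z q k j) • Γ.trTheta = τ₂
    match_scalars <;> field_simp <;> ring


end Relations

/-! ### Determination of a calculus by its relations on generators -/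

section Uniqueness

variable {q : ℂˣ} {H : Type} [Ring H] [Bialgebra ℂ H] (G : QGroup q H) {Γ Γ' : FODC H}

theorem FODC.d_one (Γ : FODC H) : Γ.d 1 = 0 := by
  have h := Γ.leibniz 1 1
  rw [mul_one, MulOpposite.op_one, one_smul, one_smul] at h
  exact left_eq_add.mp h

theorem FODC.d_algebraMap (Γ : FODC H) (c : ℂ) : Γ.d (algebraMap ℂ H c) = 0 := by
  rw [Algebra.algebraMap_eq_smul_one, map_smul, Γ.d_one, smul_zero]

/-- Right multiplication by scalars. -/
theorem FODC.rsmul_algebraMap (Γ : FODC H) (c : ℂ) (ω : Γ.Form) :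
    ω <• algebraMap ℂ H c = c • ω := by
  rw [Algebra.algebraMap_eq_smul_one, MulOpposite.op_smul, smul_assoc, MulOpposite.op_one, one_smul]

theorem FODC.rsmul_rsmul (Γ : FODC H) (ω : Γ.Form) (a b : H) : ω <• a <• b = ω <• (a * b) := by
  rw [MulOpposite.op_mul, mul_smul]

theorem FODC.rsmul_add (Γ : FODC H) (ω : Γ.Form) (a b : H) : ω <• (a + b) = ω <• a + ω <• b := by
  rw [MulOpposite.op_add, add_smul]

namespace QGroup

/-- A left linear map that respects right multiplication of a left basis by the generators respects
right multiplication. -/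
theorem map_rsmul_of_gen (ζ : Γ.Form →ₗ[H] Γ'.Form) {ι : Type} {v : ι → Γ.Form}
    (hv : Submodule.span H (Set.range v) = ⊤)
    (h : ∀ i k l, ζ (v i <• G.z k l) = ζ (v i) <• G.z k l) (a : H) :
    ∀ ω : Γ.Form, ζ (ω <• a) = ζ ω <• a := by
  induction a using G.gen_of with
  | hz k l =>
    intro ω
    have hω : ω ∈ Submodule.span H (Set.range v) := by rw [hv]; trivial
    induction hω using Submodule.span_induction with
    | mem x hx => obtain ⟨i, rfl⟩ := hx; exact h i k l
    | zero => simp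
    | add x y _ _ hx hy => rw [smul_add, map_add, hx, hy, map_add, smul_add]
    | smul c x _ hx => rw [← smul_comm, map_smul, hx, map_smul, smul_comm]
  | hc c =>
    intro ω
    rw [FODC.rsmul_algebraMap, FODC.rsmul_algebraMap, LinearMap.map_smul_of_tower]
  | hadd a b ha hb => intro ω; rw [FODC.rsmul_add, map_add, ha, hb, FODC.rsmul_add]
  | hmul a b ha hb => intro ω; rw [← FODC.rsmul_rsmul, hb, ha, FODC.rsmul_rsmul]
  | hinv a b ha hab hba =>
    intro ω
    have h1 := ha (ω <• b)
    rw [FODC.rsmul_rsmul, hba, MulOpposite.op_one, one_smul] at h1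
    rw [h1, FODC.rsmul_rsmul, hab, MulOpposite.op_one, one_smul]

/-- A bimodule map that respects the differentials of the generators respects the differentials. -/
theorem map_d_of_gen (ζ : Γ.Form →ₗ[H] Γ'.Form) (hr : ∀ (ω : Γ.Form) (a : H), ζ (ω <• a) = ζ ω <• a)
    (h : ∀ k l, ζ (Γ.d (G.z k l)) = Γ'.d (G.z k l)) (a : H) : ζ (Γ.d a) = Γ'.d a := by
  induction a using G.gen_of with
  | hz k l => exact h k l
  | hc c => rw [FODC.d_algebraMap, FODC.d_algebraMap, map_zero]
  | hadd a b ha hb => rw [map_add, map_add, ha, hb, map_add]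
  | hmul a b ha hb => rw [Γ.leibniz, Γ'.leibniz, map_add, hr, map_smul, ha, hb]
  | hinv a b ha hab hba =>
    -- Differentiating a b = 1 expresses the differential of an inverse through da.
    have key : ∀ Γ : FODC H, Γ.d b = -(b • (Γ.d a <• b)) := by
      intro Γ
      have h1 := Γ.leibniz a b
      rw [hab, Γ.d_one] at h1
      rw [eq_neg_iff_add_eq_zero, add_comm]
      have h2 := congrArg (fun ω => b • ω) h1
      simpa [smul_smul, hba] using h2.symm
    rw [key Γ, key Γ', map_neg, map_smul, hr, ha]

/-- Right multiplication of the differentials of the generators by the generators is determined by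
half of the index pairs. -/
theorem map_dz_rsmul (ζ : Γ.Form →ₗ[H] Γ'.Form)
    (hd : ∀ k l, ζ (Γ.d (G.z k l)) = Γ'.d (G.z k l))
    (hsame : ∀ i j, ζ (Γ.d (G.z i j) <• G.z i j) = Γ'.d (G.z i j) <• G.z i j)
    (hrow : ∀ i j l, j < l → ζ (Γ.d (G.z i j) <• G.z i l) = Γ'.d (G.z i j) <• G.z i l)
    (hlt : ∀ i j k l, i < k → ζ (Γ.d (G.z i j) <• G.z k l) = Γ'.d (G.z i j) <• G.z k l)
    (i j k l : Fin 3) : ζ (Γ.d (G.z i j) <• G.z k l) = Γ'.d (G.z i j) <• G.z k l := by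
  have hz := G.isQMatrix
  -- If c is the product a b rewritten in the opposite order, dc only involves products (dx) y with
  -- the factors already in the preferred order, so the reversed pairs are determined too.
  have hL : ∀ (Γ : FODC H) (a b c : H), a * b = c → Γ.d a <• b = Γ.d c - a • Γ.d b := by
    rintro Γ a b _ rfl
    rw [Γ.leibniz, add_sub_cancel_right]
  have hgt : ∀ i j k l, k < i → l < j →
      ζ (Γ.d (G.z i j) <• G.z k l) = Γ'.d (G.z i j) <• G.z k l := by
    intro i j k l hki hlj
    rw [hL Γ _ _ _ (hz.cross' k l i j hki hlj), hL Γ' _ _ _ (hz.cross' k l i j hki hlj)]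
    simp only [map_sub, map_smul, Γ.leibniz, Γ'.leibniz, map_add, LinearMap.map_smul_of_tower, hd,
      hlt _ _ _ _ hki]
  rcases lt_trichotomy i k with hik | rfl | hki
  · exact hlt i j k l hik
  · rcases lt_trichotomy j l with hjl | rfl | hlj
    · exact hrow i j l hjl
    · exact hsame i j
    · rw [hL Γ _ _ _ (hz.row' i l j hlj), hL Γ' _ _ _ (hz.row' i l j hlj)]
      simp only [map_sub, map_smul, Γ.leibniz, Γ'.leibniz, map_add, LinearMap.map_smul_of_tower, hd,
        hrow i l j hlj]
  · rcases lt_trichotomy j l with hjl | rfl | hlj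
    · rw [hL Γ _ _ _ (hz.comm' k l i j hki hjl), hL Γ' _ _ _ (hz.comm' k l i j hki hjl)]
      simp only [map_sub, map_smul, Γ.leibniz, Γ'.leibniz, map_add, LinearMap.map_smul_of_tower, hd,
        hlt _ _ _ _ hki]
    · rw [hL Γ _ _ _ (hz.col' k j i hki), hL Γ' _ _ _ (hz.col' k j i hki)]
      simp only [map_sub, map_smul, Γ.leibniz, Γ'.leibniz, map_add, LinearMap.map_smul_of_tower, hd,
        hlt _ _ _ _ hki]
    · exact hgt i j k l hki hlj

end QGroup

/-- The left linear bijection between the two bases is the only candidate. Compatibility with right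
multiplication and with d propagates from generators to sums, products and inverses. -/
theorem equivalent_of_gen (hB : Γ.HasBasis G.entries) (hB' : Γ'.HasBasis G.entries)
    (h : ∀ ζ : Γ.Form →ₗ[H] Γ'.Form, (∀ k l, ζ (Γ.d (G.z k l)) = Γ'.d (G.z k l)) →
      ∀ i j k l, ζ (Γ.d (G.z i j) <• G.z k l) = Γ'.d (G.z i j) <• G.z k l) :
    Γ.Equivalent Γ' := by
  let b := Module.Basis.mk hB.1 hB.2.ge
  let b' := Module.Basis.mk hB'.1 hB'.2.ge
  let ζ := b.equiv b' (Equiv.refl _)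
  have hd : ∀ k l, ζ (Γ.d (G.z k l)) = Γ'.d (G.z k l) := fun k l => by
    have := b.equiv_apply (k, l) b' (Equiv.refl _)
    simp only [b, b', Module.Basis.mk_apply, Equiv.refl_apply] at this
    exact this
  have hr := G.map_rsmul_of_gen ζ.toLinearMap hB.2 (fun p k l => by
    refine (h ζ.toLinearMap hd p.1 p.2 k l).trans ?_
    rw [← hd]
    rfl)
  exact ⟨ζ, fun ω a => hr a ω, G.map_d_of_gen ζ.toLinearMap (fun ω a => hr a ω) hd⟩

end Uniqueness

/-! ### Existence and uniqueness of the two families -/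

section ExistsUnique

variable {q s : ℂˣ} {t : ℂ}

theorem familyA_ne_zero (hs : s = q ∨ s = q⁻¹) (hq : (q : ℂ) ^ 2 ≠ 1) (ht : t ≠ 0) :
    familyA q s t ≠ 0 := by
  have hq0 := q.ne_zero
  have h1 : (q : ℂ)⁻¹ - q ≠ 0 := by
    intro h
    apply hq
    field_simp at h
    linear_combination -h
  rcases hs with rfl | rfl
  · rw [familyA_self]
    exact mul_ne_zero (mul_ne_zero ht h1) (inv_ne_zero hq0)
  · rw [familyA_inv]
    exact mul_ne_zero (mul_ne_zero ht (by rw [← neg_sub]; exact neg_ne_zero.mpr h1))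
      (pow_ne_zero 5 hq0)

theorem dzRel_trTheta {Γ : FODC (GLq q)} {Y : Γ.Form} (h : (GLq.qGroup q).DZRel s t Γ Y) {a : ℂ}
    (ha : a ≠ 0) (hY : (GLq.qGroup q).mcTr Γ = a • Y) :
    (GLq.qGroup q).DZRel s t Γ (a⁻¹ • Γ.trTheta) := by
  rwa [← trTheta_eq, hY, smul_smul, inv_mul_cancel₀ ha, one_smul]

/-- The model calculi over `GL_q(3)`. -/
noncomputable def glModel (hs : s = q ∨ s = q⁻¹) (hq : (q : ℂ) ^ 2 ≠ 1) (ht : t ≠ 0)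
    (ha : familyDenom q s t ≠ 0) : FODC (GLq q) :=
  (GLq.qGroup q).model (familyHom_z hs ht) hs (familyA_ne_zero hs hq ht) ha

theorem glModel_dzRel (hs : s = q ∨ s = q⁻¹) (hq : (q : ℂ) ^ 2 ≠ 1) (ht : t ≠ 0)
    (ha : familyDenom q s t ≠ 0) : (GLq.qGroup q).DZRel s t (glModel hs hq ht ha)
      ((familyDenom q s t)⁻¹ • (glModel hs hq ht ha).trTheta) :=
  dzRel_trTheta
    ((GLq.qGroup q).model_mcRel (familyHom_z hs ht) hs (familyA_ne_zero hs hq ht) ha).dzRel ha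
    ((GLq.qGroup q).model_mcTr (familyHom_z hs ht) hs (familyA_ne_zero hs hq ht) ha)

theorem glModel_isGamma₁ (hq : (q : ℂ) ^ 2 ≠ 1) (ht : t ≠ 0) (ha : familyDenom q q t ≠ 0) :
    FODC.IsGamma₁ t (glModel (Or.inl rfl) hq ht ha) :=
  isGamma₁_of_dzRel ((GLq.qGroup q).model_bicovariant _ _ _ _)
    ((GLq.qGroup q).model_basis _ _ _ _) (admissible₁_iff.mpr ⟨ht, ha⟩) (glModel_dzRel _ hq ht ha)

theorem glModel_isGamma₂ (hq : (q : ℂ) ^ 2 ≠ 1) (ht : t ≠ 0) (ha : familyDenom q q⁻¹ t ≠ 0) :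
    FODC.IsGamma₂ t (glModel (Or.inr rfl) hq ht ha) :=
  isGamma₂_of_dzRel ((GLq.qGroup q).model_bicovariant _ _ _ _)
    ((GLq.qGroup q).model_basis _ _ _ _) (admissible₂_iff.mpr ⟨ht, ha⟩) (glModel_dzRel _ hq ht ha)

theorem map_trTheta {Γ Γ' : FODC (GLq q)} (ζ : Γ.Form →ₗ[GLq q] Γ'.Form)
    (hd : ∀ k l, ζ (Γ.d (GLq.z q k l)) = Γ'.d (GLq.z q k l)) : ζ Γ.trTheta = Γ'.trTheta := by
  simp only [FODC.trTheta, FODC.theta, map_add, LinearMap.map_smul_of_tower, map_sum, map_smul, hd]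

theorem FODC.IsGamma₁.equivalent {Γ Γ' : FODC (GLq q)} (h : FODC.IsGamma₁ t Γ)
    (h' : FODC.IsGamma₁ t Γ') : Γ.Equivalent Γ' := by
  refine equivalent_of_gen (GLq.qGroup q) h.basis h'.basis fun ζ hd => ?_
  replace hd : ∀ k l, ζ (Γ.d (GLq.z q k l)) = Γ'.d (GLq.z q k l) := hd
  have hT := map_trTheta ζ hd
  refine (GLq.qGroup q).map_dz_rsmul ζ hd (fun i j => ?_) (fun i j l hjl => ?_)
    (fun i j k l hik => ?_)
  · refine (congrArg ζ (h.same i j)).trans (Eq.trans ?_ (h'.same i j).symm)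
    simp only [map_add, map_sub, LinearMap.map_smul_of_tower, map_smul, hd, hT]
  · refine (congrArg ζ (h.row i j l hjl)).trans (Eq.trans ?_ (h'.row i j l hjl).symm)
    simp only [map_add, map_sub, LinearMap.map_smul_of_tower, map_smul, hd, hT]
  · rcases lt_trichotomy j l with hjl | rfl | hlj
    · refine (congrArg ζ (h.diag i j k l hik hjl)).trans
        (Eq.trans ?_ (h'.diag i j k l hik hjl).symm)
      simp only [map_add, map_sub, LinearMap.map_smul_of_tower, map_smul, hd, hT]
    · refine (congrArg ζ (h.col i j k hik)).trans (Eq.trans ?_ (h'.col i j k hik).symm)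
      simp only [map_add, map_sub, LinearMap.map_smul_of_tower, map_smul, hd, hT]
    · refine (congrArg ζ (h.antidiag i j k l hik hlj)).trans
        (Eq.trans ?_ (h'.antidiag i j k l hik hlj).symm)
      simp only [map_add, map_sub, LinearMap.map_smul_of_tower, map_smul, hd, hT]

theorem FODC.IsGamma₂.equivalent {Γ Γ' : FODC (GLq q)} (h : FODC.IsGamma₂ t Γ)
    (h' : FODC.IsGamma₂ t Γ') : Γ.Equivalent Γ' := by
  refine equivalent_of_gen (GLq.qGroup q) h.basis h'.basis fun ζ hd => ?_
  replace hd : ∀ k l, ζ (Γ.d (GLq.z q k l)) = Γ'.d (GLq.z q k l) := hd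
  have hT := map_trTheta ζ hd
  refine (GLq.qGroup q).map_dz_rsmul ζ hd (fun i j => ?_) (fun i j l hjl => ?_)
    (fun i j k l hik => ?_)
  · refine (congrArg ζ (h.same i j)).trans (Eq.trans ?_ (h'.same i j).symm)
    simp only [map_add, map_sub, LinearMap.map_smul_of_tower, map_smul, hd, hT]
  · refine (congrArg ζ (h.row i j l hjl)).trans (Eq.trans ?_ (h'.row i j l hjl).symm)
    simp only [map_add, map_sub, LinearMap.map_smul_of_tower, map_smul, hd, hT]
  · rcases lt_trichotomy j l with hjl | rfl | hlj
    · refine (congrArg ζ (h.diag i j k l hik hjl)).trans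
        (Eq.trans ?_ (h'.diag i j k l hik hjl).symm)
      simp only [map_add, map_sub, LinearMap.map_smul_of_tower, map_smul, hd, hT]
    · refine (congrArg ζ (h.col i j k hik)).trans (Eq.trans ?_ (h'.col i j k hik).symm)
      simp only [map_add, map_sub, LinearMap.map_smul_of_tower, map_smul, hd, hT]
    · refine (congrArg ζ (h.antidiag i j k l hik hlj)).trans
        (Eq.trans ?_ (h'.antidiag i j k l hik hlj).symm)
      simp only [map_add, map_sub, LinearMap.map_smul_of_tower, map_smul, hd, hT]

end ExistsUnique

/-! ### Descent to `SL_q(3)` -/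

section Descent

variable {q : ℂˣ}

namespace GLq

theorem det_comm (a : GLq q) : a * det q = det q * a := by
  induction a using (qGroup q).gen_of with
  | hz k l => exact det_comm_z k l
  | hc c => exact Algebra.commutes c _
  | hadd a b ha hb => rw [add_mul, ha, hb, mul_add]
  | hmul a b ha hb => rw [mul_assoc, hb, ← mul_assoc, ha, mul_assoc]
  | hinv a b ha hab hba =>
    calc b * det q = b * (det q * a) * b := by rw [mul_assoc, mul_assoc, hab, mul_one]
      _ = det q * b := by rw [← ha, ← mul_assoc, hba, one_mul]

theorem comul_det : Coalgebra.comul (R := ℂ) (det q) = det q ⊗ₜ[ℂ] det q := comulHom_det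

end GLq

/-- Since D is central, the two-sided ideal generated by D - 1 consists of the left multiples (D -
1) y. This makes the kernel of the projection of frames explicit. -/
theorem SLq.exists_of_proj_eq_zero {x : GLq q} (hx : SLq.proj q x = 0) :
    ∃ y, x = (GLq.det q - 1) * y := by
  let I : TwoSidedIdeal (GLq q) := TwoSidedIdeal.span {GLq.det q - 1}
  have hI : ∀ ⦃a b : GLq q⦄, SLRel q a b → I.ringCon.mk' a = I.ringCon.mk' b := by
    rintro _ _ ⟨⟩
    rw [← sub_eq_zero, ← map_sub]
    have h : GLq.det q - 1 ∈ I := TwoSidedIdeal.subset_span rfl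
    rwa [← TwoSidedIdeal.ker_ringCon_mk' I, TwoSidedIdeal.mem_ker] at h
  let φ : SLq q →+* I.ringCon.Quotient := RingQuot.lift ⟨I.ringCon.mk', hI⟩
  have hφ : ∀ a, φ (SLq.proj q a) = I.ringCon.mk' a := fun a => by
    have := RingQuot.lift_mkRingHom_apply I.ringCon.mk' hI a
    rw [← RingQuot.mkAlgHom_coe ℂ] at this
    exact this
  have hxI : x ∈ I := by
    rw [← TwoSidedIdeal.ker_ringCon_mk' I, TwoSidedIdeal.mem_ker, ← hφ, hx, map_zero]
  clear hx
  induction hxI using TwoSidedIdeal.span_induction with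
  | mem x h => exact ⟨1, by rw [mul_one]; exact h⟩
  | zero => exact ⟨0, by simp⟩
  | add x y _ _ hx' hy' =>
    obtain ⟨a, ha⟩ := hx'
    obtain ⟨b, hb⟩ := hy'
    exact ⟨a + b, by rw [ha, hb, mul_add]⟩
  | neg x _ hx' =>
    obtain ⟨a, ha⟩ := hx'
    exact ⟨-a, by rw [ha, mul_neg]⟩
  | left_absorb a x _ hx' =>
    obtain ⟨b, hb⟩ := hx'
    have h : a * (GLq.det q - 1) = (GLq.det q - 1) * a := by
      rw [mul_sub, sub_mul, GLq.det_comm, mul_one, one_mul]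
    exact ⟨a * b, by rw [hb, ← mul_assoc, h, mul_assoc]⟩
  | right_absorb b x _ hx' =>
    obtain ⟨a, ha⟩ := hx'
    exact ⟨a * b, by rw [ha, mul_assoc]⟩

variable {Γ Γ₀ : FODC (GLq q)}

theorem FODC.unimodularRelations_le_comap (ζ : Γ.Form →ₗ[GLq q] Γ₀.Form)
    (hr : ∀ (ω : Γ.Form) (a : GLq q), ζ (ω <• a) = ζ ω <• a) (hd : ∀ a, ζ (Γ.d a) = Γ₀.d a) :
    Γ.unimodularRelations ≤ Γ₀.unimodularRelations.comap (ζ.restrictScalars ℂ) := by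
  refine Submodule.span_le.mpr ?_
  rintro _ ((⟨a, b, ω, rfl⟩ | ⟨a, b, ω, rfl⟩) | ⟨a, b, rfl⟩) <;>
    refine Submodule.subset_span ?_
  · exact Or.inl (Or.inl ⟨a, b, ζ ω, by simp [hr]⟩)
  · exact Or.inl (Or.inr ⟨a, b, ζ ω, (hr _ _).trans (by rw [map_smul, hr])⟩)
  · exact Or.inr ⟨a, b, by simp [hr, hd]⟩

theorem FODC.Induces.of_equivalent {Γ' : FODC (SLq q)} (h : Γ₀.Induces Γ')
    (e : Γ.Equivalent Γ₀) : Γ.Induces Γ' := by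
  obtain ⟨ρ, h1, h2, h3, h4⟩ := h
  obtain ⟨ζ, hr, hd⟩ := e
  refine ⟨ρ ∘ₗ ζ.toLinearMap.restrictScalars ℂ, fun a ω => ?_, fun a ω => ?_, fun a => ?_, ?_⟩
  · simp [h1]
  · simp [h2, hr]
  · simp [h3, hd]
  · apply le_antisymm
    · intro ω hω
      have : ζ ω ∈ Γ₀.unimodularRelations := by rw [← h4]; exact hω
      have h5 := FODC.unimodularRelations_le_comap ζ.symm.toLinearMap
        (fun ω a => by
          change ζ.symm _ = ζ.symm _ <• a
          rw [LinearEquiv.symm_apply_eq, hr, LinearEquiv.apply_symm_apply])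
        (fun a => by
          change ζ.symm _ = _
          rw [LinearEquiv.symm_apply_eq, hd]) this
      simpa using h5
    · intro ω hω
      have h5 := FODC.unimodularRelations_le_comap ζ.toLinearMap hr hd hω
      rw [← h4] at h5
      exact h5

theorem FODC.DescendsToSL.of_equivalent (h : Γ₀.DescendsToSL) (e : Γ.Equivalent Γ₀) :
    Γ.DescendsToSL := by
  obtain ⟨Γ', h1, h2⟩ := h
  exact ⟨Γ', h1.of_equivalent e, h2⟩

theorem FODC.Induces.surjective {Γ' : FODC (SLq q)} {ρ : Γ.Form →ₗ[ℂ] Γ'.Form}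
    (h1 : ∀ (a : GLq q) (ω : Γ.Form), ρ (a • ω) = SLq.proj q a • ρ ω)
    (h3 : ∀ a : GLq q, ρ (Γ.d a) = Γ'.d (SLq.proj q a)) : Function.Surjective ρ := by
  intro η
  have hη : η ∈ Submodule.span (SLq q) (Set.range Γ'.d) := by rw [Γ'.span_d]; trivial
  induction hη using Submodule.span_induction with
  | mem x hx =>
    obtain ⟨b, rfl⟩ := hx
    obtain ⟨a, rfl⟩ := SLq.proj_surjective b
    exact ⟨Γ.d a, h3 a⟩
  | zero => exact ⟨0, map_zero _⟩
  | add x y _ _ hx hy =>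
    obtain ⟨ω, rfl⟩ := hx
    obtain ⟨ω', rfl⟩ := hy
    exact ⟨ω + ω', map_add _ _ _⟩
  | smul c x _ hx =>
    obtain ⟨ω, rfl⟩ := hx
    obtain ⟨a, rfl⟩ := SLq.proj_surjective c
    exact ⟨a • ω, h1 a ω⟩

theorem FODC.unimodularRelations_le_ker {Γ' : FODC (SLq q)} {ρ : Γ.Form →ₗ[ℂ] Γ'.Form}
    (h1 : ∀ (a : GLq q) (ω : Γ.Form), ρ (a • ω) = SLq.proj q a • ρ ω)
    (h2 : ∀ (a : GLq q) (ω : Γ.Form), ρ (ω <• a) = ρ ω <• SLq.proj q a)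
    (h3 : ∀ a : GLq q, ρ (Γ.d a) = Γ'.d (SLq.proj q a)) :
    Γ.unimodularRelations ≤ LinearMap.ker ρ := by
  have h0 : SLq.proj q (GLq.det q - 1) = 0 := by rw [map_sub, SLq.proj_det, map_one, sub_self]
  refine Submodule.span_le.mpr ?_
  rintro _ ((⟨a, b, ω, rfl⟩ | ⟨a, b, ω, rfl⟩) | ⟨a, b, rfl⟩) <;>
    rw [SetLike.mem_coe, LinearMap.mem_ker, h2, h1]
  · rw [h1, h0, zero_smul, smul_zero, smul_zero]
  · rw [h2, h0, MulOpposite.op_zero, zero_smul, smul_zero, smul_zero]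
  · rw [h3, SLq.proj_det, FODC.d_one, smul_zero, smul_zero]

/-- A calculus in which the quantum determinant commutes with forms up to a factor `c ≠ 1` induces
the zero calculus. -/
theorem FODC.Induces.subsingleton {Γ' : FODC (SLq q)} (h : Γ.Induces Γ') {c : ℂ} (hc : c ≠ 1)
    (hD : ∀ ω : Γ.Form, ω <• GLq.det q = c • GLq.det q • ω) : Subsingleton Γ'.Form := by
  obtain ⟨ρ, h1, h2, h3, -⟩ := h
  refine subsingleton_of_forall_eq 0 fun η => ?_
  obtain ⟨ω, rfl⟩ := FODC.Induces.surjective h1 h3 η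
  have h4 := congrArg ρ (hD ω)
  rw [h2, SLq.proj_det, map_smul, h1, SLq.proj_det, MulOpposite.op_one, one_smul, one_smul] at h4
  have h5 : (1 - c) • ρ ω = 0 := by rw [sub_smul, one_smul, ← h4, sub_self]
  exact (smul_eq_zero.mp h5).resolve_left (sub_ne_zero.mpr hc.symm)

theorem FODC.HasBasis.not_subsingleton {Γ' : FODC (SLq q)} (h : Γ'.HasBasis (SLq.entries q)) :
    ¬ Subsingleton Γ'.Form := by
  intro hs
  have : Nontrivial (SLq q) := (Bialgebra.counitAlgHom ℂ (SLq q)).toRingHom.domain_nontrivial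
  exact h.1.ne_zero (0, 0) (Subsingleton.elim _ _)

variable {s : ℂˣ} {t : ℂ}

/-- D is group-like and its functional matrix is scalar, so right multiplication of forms by D is
left multiplication by D up to the factor t³ s⁻². -/
theorem matConvR_det (hs : s = q ∨ s = q⁻¹) (ht : t ≠ 0) :
    matConvR (familyHom hs ht) (GLq.det q) =
      (t ^ 3 * (s : ℂ)⁻¹ ^ 2) • Matrix.diagonal fun _ => GLq.det q := by
  ext p r
  rw [matConvR_apply, convR, LinearMap.comp_apply, LinearMap.comp_apply, GLq.comul_det]
  simp only [LinearMap.lTensor_tmul, LinearEquiv.coe_coe, TensorProduct.rid_tmul, entryFun_apply,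
    familyHom_det]
  by_cases h : p = r
  · subst h; simp
  · simp [h]

theorem frame_rsmul_det (hs : s = q ∨ s = q⁻¹) (ht : t ≠ 0) (ω : Frame (familyHom hs ht)) :
    ω <• GLq.det q = (t ^ 3 * (s : ℂ)⁻¹ ^ 2) • GLq.det q • ω := by
  refine Frame.ext (f := familyHom hs ht) fun j => ?_
  refine (Frame.rsmul_apply _ _ _).trans ?_
  rw [matConvR_det, Frame.csmul_apply, Frame.smul_apply]
  simp only [Matrix.smul_apply, Matrix.diagonal_apply, smul_ite, smul_zero, mul_ite, mul_zero,
    Finset.sum_ite_eq', Finset.mem_univ, if_true, mul_smul_comm, GLq.det_comm]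

/-- The model calculi over `SL_q(3)`. -/
noncomputable def slModel (hs : s = q ∨ s = q⁻¹) (hq : (q : ℂ) ^ 2 ≠ 1) (ht : t ≠ 0)
    (ha : familyDenom q s t ≠ 0) (h : t ^ 3 * (s : ℂ)⁻¹ ^ 2 = 1) : FODC (SLq q) :=
  (SLq.qGroup q).model (f := SLq.lift (familyHom hs ht) (by rw [familyHom_det, h, one_smul]))
    (fun k l => (SLq.lift_proj _ _ _).trans (familyHom_z hs ht k l)) hs
    (familyA_ne_zero hs hq ht) ha

/-- The map is the projection of coordinates. It commutes with all structures because the functional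
on GL is the pullback of the one on SL, and a form in its kernel has all coordinates divisible by D
- 1. -/
theorem glModel_induces_slModel (hs : s = q ∨ s = q⁻¹) (hq : (q : ℂ) ^ 2 ≠ 1) (ht : t ≠ 0)
    (ha : familyDenom q s t ≠ 0) (h : t ^ 3 * (s : ℂ)⁻¹ ^ 2 = 1) :
    (glModel hs hq ht ha).Induces (slModel hs hq ht ha h) := by
  let f' : SLq q →ₐ[ℂ] Matrix (Fin 3 × Fin 3) (Fin 3 × Fin 3) ℂ :=
    SLq.lift (familyHom hs ht) (by rw [familyHom_det, h, one_smul])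
  let ρ : Frame (familyHom hs ht) →ₗ[ℂ] Frame f' :=
    (SLq.proj q).toLinearMap.compLeft (Fin 3 × Fin 3)
  have hρ : ∀ ω p, ρ ω p = SLq.proj q (ω p) := fun ω p => rfl
  have hconv : ∀ a p r, matConvR f' (SLq.proj q a) p r =
      SLq.proj q (matConvR (familyHom hs ht) a p r) := by
    intro a p r
    rw [matConvR_apply, matConvR_apply, convR, convR]
    simp only [LinearMap.comp_apply, SLq.comul_proj]
    generalize Coalgebra.comul (R := ℂ) a = x
    induction x with
    | zero => simp
    | add x y hx hy => simp only [map_add, hx, hy]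
    | tmul x y => simp [f']
  have hr : ∀ (a : GLq q) ω, ρ (ω <• a) = ρ ω <• SLq.proj q a := by
    intro a ω
    ext p
    simp only [hρ, Frame.rsmul_apply, hconv, map_sum, map_mul]
  have hd : ∀ a, ρ (Frame.innerD _ (frameTr q) a) = Frame.innerD f' (frameTr q) (SLq.proj q a) := by
    intro a
    ext p
    simp only [hρ, Frame.innerD_apply, hconv, map_sub, map_sum, map_smul]
  have hl : ∀ (a : GLq q) ω, ρ (a • ω) = SLq.proj q a • ρ ω := by
    intro a ω
    ext p
    simp only [hρ, Frame.smul_apply, map_mul]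
  refine ⟨ρ, hl, fun a ω => hr a ω, hd, le_antisymm ?_ ?_⟩
  · intro ω hω
    choose y hy using fun p => SLq.exists_of_proj_eq_zero (x := (show Frame (familyHom hs ht) from ω) p)
      (congrArg (fun η : Frame f' => η p) (show ρ ω = 0 from hω))
    refine Submodule.subset_span (Or.inl (Or.inl ⟨1, 1, (show Frame (familyHom hs ht) from y), ?_⟩))
    rw [MulOpposite.op_one, one_smul, one_smul]
    exact funext hy
  · exact FODC.unimodularRelations_le_ker (Γ := glModel hs hq ht ha)
      (Γ' := slModel hs hq ht ha h) hl hr hd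

/-- Everything is decided by the factor t³ s⁻² by which D fails to commute with forms: if it differs
from 1 the quotient collapses, and otherwise the model over SL is the induced calculus. -/
theorem descends_iff (hs : s = q ∨ s = q⁻¹) (hq : (q : ℂ) ^ 2 ≠ 1) (ht : t ≠ 0)
    (ha : familyDenom q s t ≠ 0) (e : Γ.Equivalent (glModel hs hq ht ha)) :
    (Γ.DescendsToSL ↔ t ^ 3 = (s : ℂ) ^ 2) ∧
      (t ^ 3 ≠ (s : ℂ) ^ 2 → ∀ Γ' : FODC (SLq q), Γ.Induces Γ' → Subsingleton Γ'.Form) := by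
  have hs0 := s.ne_zero
  have hiff : t ^ 3 * (s : ℂ)⁻¹ ^ 2 = 1 ↔ t ^ 3 = (s : ℂ) ^ 2 := by
    rw [inv_pow, mul_inv_eq_one₀ (pow_ne_zero 2 hs0)]
  have h0 : t ^ 3 ≠ (s : ℂ) ^ 2 → ∀ Γ' : FODC (SLq q), Γ.Induces Γ' → Subsingleton Γ'.Form :=
    fun h Γ' hΓ => (hΓ.of_equivalent (Γ := glModel hs hq ht ha) ((FODC.setoid _).iseqv.symm e)).subsingleton (fun h' => h (hiff.mp h'))
      (frame_rsmul_det hs ht)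
  refine ⟨⟨fun ⟨Γ', h1, _, h2⟩ => ?_, fun h => ?_⟩, h0⟩
  · by_contra h
    exact h2.not_subsingleton (h0 h Γ' h1)
  · have h' := hiff.mpr h
    exact FODC.DescendsToSL.of_equivalent ⟨slModel hs hq ht ha h',
      glModel_induces_slModel hs hq ht ha h', (SLq.qGroup q).model_bicovariant _ _ _ _,
      (SLq.qGroup q).model_basis _ _ _ _⟩ e

end Descent

/-! ### Bicovariant calculi with coordinate functionals -/

section Functionals

variable {H : Type} [Ring H] [Bialgebra ℂ H] {Γ : FODC H}

/-- Evaluation of a functional on the second factor of `H ⊗ Γ`. -/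
noncomputable def evalLeft (φ : Γ.Form →ₗ[ℂ] ℂ) : H ⊗[ℂ] Γ.Form →ₗ[ℂ] H :=
  (TensorProduct.rid ℂ H).toLinearMap ∘ₗ φ.lTensor H

/-- Evaluation of a functional on the first factor of `Γ ⊗ H`. -/
noncomputable def evalRight (φ : Γ.Form →ₗ[ℂ] ℂ) : Γ.Form ⊗[ℂ] H →ₗ[ℂ] H :=
  (TensorProduct.lid ℂ H).toLinearMap ∘ₗ φ.rTensor H

/-- A functional that sees left multiplication only through the counit removes the second leg of
Δ(a), so nothing but a itself remains. -/
theorem evalLeft_mulLeft {φ : Γ.Form →ₗ[ℂ] ℂ}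
    (hφ : ∀ (a : H) ω, φ (a • ω) = Coalgebra.counit a * φ ω) (a b : H) (ω : Γ.Form) :
    evalLeft φ (Γ.mulLeft (Coalgebra.comul a) (b ⊗ₜ ω)) = φ ω • (a * b) := by
  have h : ∀ x : H ⊗[ℂ] H, evalLeft φ (Γ.mulLeft x (b ⊗ₜ ω)) =
      φ ω • (TensorProduct.rid ℂ H ((Coalgebra.counit (R := ℂ) (A := H)).lTensor H x) * b) := by
    intro x
    induction x with
    | zero => simp
    | add x y hx hy => simp only [map_add, LinearMap.add_apply, hx, hy, add_mul, smul_add]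
    | tmul x y => simp [FODC.mulLeft_tmul, evalLeft, hφ, smul_smul, mul_comm]
  rw [h, Coalgebra.lTensor_counit_comul]
  simp

theorem evalRight_mulRight {φ : Γ.Form →ₗ[ℂ] ℂ}
    (hφ : ∀ (a : H) ω, φ (a • ω) = Coalgebra.counit a * φ ω) (a b : H) (ω : Γ.Form) :
    evalRight φ (Γ.mulRight (Coalgebra.comul a) (ω ⊗ₜ b)) = φ ω • (a * b) := by
  have h : ∀ x : H ⊗[ℂ] H, evalRight φ (Γ.mulRight x (ω ⊗ₜ b)) =
      φ ω • (TensorProduct.lid ℂ H ((Coalgebra.counit (R := ℂ) (A := H)).rTensor H x) * b) := by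
    intro x
    induction x with
    | zero => simp
    | add x y hx hy => simp only [map_add, LinearMap.add_apply, hx, hy, add_mul, smul_add]
    | tmul x y => simp [FODC.mulRight_tmul, evalRight, hφ, smul_smul, mul_comm]
  rw [h, Coalgebra.rTensor_counit_comul]
  simp

variable {q : ℂˣ} (G : QGroup q H)

namespace QGroup

/-- Functionals on the one-forms that are dual to the differentials `dz i j` at the counit. -/
structure IsDual (Γ : FODC H) (φ : Fin 3 × Fin 3 → Γ.Form →ₗ[ℂ] ℂ) : Prop where
  smul : ∀ p (a : H) ω, φ p (a • ω) = Coalgebra.counit a * φ p ω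
  d_z : ∀ p i j, φ p (Γ.d (G.z i j)) = if p = (i, j) then 1 else 0

variable {G} {φ : Fin 3 × Fin 3 → Γ.Form →ₗ[ℂ] ℂ}

theorem IsDual.evalLeft (h : G.IsDual Γ φ) {ΔL : Γ.Form →ₗ[ℂ] H ⊗[ℂ] Γ.Form}
    (hΔ : ∀ a b : H,
      ΔL (a • Γ.d b) = Γ.mulLeft (Coalgebra.comul a) (Γ.d.lTensor H (Coalgebra.comul b)))
    (x : Fin 3 × Fin 3 → H) (n r : Fin 3) :
    _root_.evalLeft (φ (n, r)) (ΔL (∑ p, x p • Γ.d (G.entries p))) =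
      ∑ i, x (i, r) * G.z i n := by
  simp only [map_sum, hΔ, entries, G.comul_z, LinearMap.lTensor_tmul, evalLeft_mulLeft (h.smul _),
    h.d_z, Fintype.sum_prod_type, Prod.mk.injEq, ite_and, ite_smul, one_smul, zero_smul,
    Finset.sum_ite_eq, Finset.mem_univ, if_true]

theorem IsDual.evalRight (h : G.IsDual Γ φ) {ΔR : Γ.Form →ₗ[ℂ] Γ.Form ⊗[ℂ] H}
    (hΔ : ∀ a b : H,
      ΔR (a • Γ.d b) = Γ.mulRight (Coalgebra.comul a) (Γ.d.rTensor H (Coalgebra.comul b)))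
    (x : Fin 3 × Fin 3 → H) (n r : Fin 3) :
    _root_.evalRight (φ (n, r)) (ΔR (∑ p, x p • Γ.d (G.entries p))) =
      ∑ j, x (n, j) * G.z r j := by
  simp only [map_sum, hΔ, entries, G.comul_z, LinearMap.rTensor_tmul, evalRight_mulRight (h.smul _),
    h.d_z, Fintype.sum_prod_type, Prod.mk.injEq, ite_and, ite_smul, one_smul, zero_smul,
    Finset.sum_ite_eq, Finset.sum_ite_irrel, Finset.sum_const_zero, Finset.mem_univ, if_true]

theorem comul_z_mul_z (i j k l : Fin 3) : Coalgebra.comul (R := ℂ) (G.z i j * G.z k l) =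
    ∑ e, ∑ m, (G.z i e * G.z k m) ⊗ₜ[ℂ] (G.z e j * G.z m l) := by
  rw [Bialgebra.comul_mul, G.comul_z, G.comul_z, Finset.sum_mul_sum]
  simp only [Algebra.TensorProduct.tmul_mul_tmul]

theorem IsDual.evalLeft_dz_rsmul (h : G.IsDual Γ φ) {ΔL : Γ.Form →ₗ[ℂ] H ⊗[ℂ] Γ.Form}
    (hΔ : ∀ a b : H,
      ΔL (a • Γ.d b) = Γ.mulLeft (Coalgebra.comul a) (Γ.d.lTensor H (Coalgebra.comul b)))
    (i j k l : Fin 3) (p : Fin 3 × Fin 3) :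
    _root_.evalLeft (φ p) (ΔL (Γ.d (G.z i j) <• G.z k l)) =
      ∑ e, ∑ m, φ p (Γ.d (G.z e j) <• G.z m l) • (G.z i e * G.z k m) := by
  -- The coaction is prescribed only on forms a db, so (dz) z' is first written as d(z z') - z dz'.
  have h1 : Γ.d (G.z i j) <• G.z k l = (1 : H) • Γ.d (G.z i j * G.z k l) - G.z i j • Γ.d (G.z k l) := by
    rw [Γ.leibniz, one_smul, add_sub_cancel_right]
  rw [h1, map_sub, map_sub, hΔ, hΔ, comul_z_mul_z, G.comul_z k l]
  simp only [map_sum, LinearMap.lTensor_tmul, evalLeft_mulLeft (h.smul _), one_mul,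
    Γ.leibniz, map_add, h.smul, add_smul, Finset.sum_add_distrib, G.counit_z, ite_mul, one_mul,
    zero_mul, ite_smul, zero_smul]
  rw [add_sub_assoc, add_eq_left, sub_eq_zero, Finset.sum_comm]
  simp

theorem IsDual.evalRight_dz_rsmul (h : G.IsDual Γ φ) {ΔR : Γ.Form →ₗ[ℂ] Γ.Form ⊗[ℂ] H}
    (hΔ : ∀ a b : H,
      ΔR (a • Γ.d b) = Γ.mulRight (Coalgebra.comul a) (Γ.d.rTensor H (Coalgebra.comul b)))
    (i j k l : Fin 3) (p : Fin 3 × Fin 3) :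
    _root_.evalRight (φ p) (ΔR (Γ.d (G.z i j) <• G.z k l)) =
      ∑ e, ∑ m, φ p (Γ.d (G.z i e) <• G.z k m) • (G.z e j * G.z m l) := by
  have h1 : Γ.d (G.z i j) <• G.z k l = (1 : H) • Γ.d (G.z i j * G.z k l) - G.z i j • Γ.d (G.z k l) := by
    rw [Γ.leibniz, one_smul, add_sub_cancel_right]
  rw [h1, map_sub, map_sub, hΔ, hΔ, comul_z_mul_z, G.comul_z k l]
  simp only [map_sum, LinearMap.rTensor_tmul, evalRight_mulRight (h.smul _), one_mul,
    Γ.leibniz, map_add, h.smul, add_smul, Finset.sum_add_distrib, G.counit_z, ite_mul, one_mul,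
    zero_mul, ite_smul, zero_smul]
  rw [add_sub_assoc, add_eq_left, sub_eq_zero, Finset.sum_comm]
  simp

/-- Differentials of the generators with dual functionals are left independent if the calculus is
left covariant. -/
theorem IsDual.hasBasis (h : G.IsDual Γ φ) (hc : Γ.Bicovariant) (hg : Γ.GeneratedBy G.entries) :
    Γ.HasBasis G.entries := by
  refine ⟨Fintype.linearIndependent_iff.mpr fun x hx => ?_, hg⟩
  obtain ⟨⟨ΔL, hΔ⟩, -⟩ := hc
  have h1 : ∀ n r, ∑ i, x (i, r) * G.z i n = 0 := fun n r => by
    rw [← h.evalLeft hΔ x n r, hx, map_zero, map_zero]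
  rintro ⟨i, r⟩
  calc x (i, r) = ∑ k, x (k, r) * ∑ n, G.z k n * G.S n i := by
        simp [G.mul_S]
    _ = ∑ n, (∑ k, x (k, r) * G.z k n) * G.S n i := by
        simp only [Finset.mul_sum, Finset.sum_mul, mul_assoc]
        exact Finset.sum_comm
    _ = 0 := by simp [h1]

/-- The coefficients of the commutation relations in a left covariant calculus. -/
theorem IsDual.coeff (h : G.IsDual Γ φ) (hc : Γ.Bicovariant) (hg : Γ.GeneratedBy G.entries)
    (i j k l : Fin 3) : ∃ x : Fin 3 × Fin 3 → H,
      Γ.d (G.z i j) <• G.z k l = ∑ p, x p • Γ.d (G.entries p) ∧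
      ∀ n r, x (n, r) = ∑ u, (∑ e, ∑ m, φ (u, r) (Γ.d (G.z e j) <• G.z m l) •
        (G.z i e * G.z k m)) * G.S u n := by
  obtain ⟨⟨ΔL, hΔ⟩, -⟩ := hc
  have hmem : Γ.d (G.z i j) <• G.z k l ∈ Submodule.span H (Set.range fun p => Γ.d (G.entries p)) := by
    rw [hg]
    trivial
  obtain ⟨x, hx⟩ := (Submodule.mem_span_range_iff_exists_fun H).mp hmem
  refine ⟨x, hx.symm, fun n r => ?_⟩
  have h1 : ∀ u, ∑ i', x (i', r) * G.z i' u = ∑ e, ∑ m, φ (u, r) (Γ.d (G.z e j) <• G.z m l) •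
        (G.z i e * G.z k m) := fun u => by
    rw [← h.evalLeft_dz_rsmul hΔ, ← hx, h.evalLeft hΔ]
  simp only [← h1]
  calc x (n, r) = ∑ k, x (k, r) * ∑ u, G.z k u * G.S u n := by
        simp [G.mul_S]
    _ = ∑ u, (∑ k, x (k, r) * G.z k u) * G.S u n := by
        simp only [Finset.mul_sum, Finset.sum_mul, mul_assoc]
        exact Finset.sum_comm

theorem IsDual.dz_rsmul (h : G.IsDual Γ φ) (hc : Γ.Bicovariant) (hg : Γ.GeneratedBy G.entries)
    (i j k l : Fin 3) : Γ.d (G.z i j) <• G.z k l =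
      ∑ e, ∑ m, (G.z i e * G.z k m) • ∑ p, φ p (Γ.d (G.z e j) <• G.z m l) • G.mc Γ p := by
  obtain ⟨x, hx, hx'⟩ := h.coeff hc hg i j k l
  let y : Fin 3 → Fin 3 → H := fun u r => ∑ e, ∑ m, φ (u, r) (Γ.d (G.z e j) <• G.z m l) •
        (G.z i e * G.z k m)
  have h1 : Γ.d (G.z i j) <• G.z k l = ∑ u, ∑ r, y u r • G.mc Γ (u, r) := by
    rw [hx, Fintype.sum_prod_type]
    simp only [hx', mc, SMul, Finset.sum_smul, Finset.smul_sum, mul_smul]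
    refine (sum_rotate _).trans (Finset.sum_congr rfl fun u _ => ?_)
    rw [Finset.sum_comm]
    simp only [y, Finset.sum_smul]
    rfl
  rw [h1]
  simp only [y, Finset.sum_smul, Finset.smul_sum, Fintype.sum_prod_type]
  refine (sum_rotate₄ _).trans ((sum_rotate₄ _).trans ?_)
  refine Finset.sum_congr rfl fun e _ => Finset.sum_congr rfl fun m _ =>
    Finset.sum_congr rfl fun u _ => Finset.sum_congr rfl fun r _ => ?_
  rw [smul_assoc, smul_comm]

/-- The Maurer-Cartan forms are left invariant, which is why their commutation with the generators
is governed by scalars, namely the values of the dual functionals. -/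
theorem IsDual.mc_rsmul (h : G.IsDual Γ φ) (hc : Γ.Bicovariant) (hg : Γ.GeneratedBy G.entries)
    (a j k l : Fin 3) : G.mc Γ (a, j) <• G.z k l =
      ∑ m, G.z k m • ∑ p, φ p (Γ.d (G.z a j) <• G.z m l) • G.mc Γ p := by
  have h1 : G.mc Γ (a, j) <• G.z k l = ∑ i, G.S a i • (Γ.d (G.z i j) <• G.z k l) := by
    simp only [mc, SMul, Finset.smul_sum]
    exact Finset.sum_congr rfl fun i _ => (smul_comm _ _ _).symm
  rw [h1]
  refine Eq.trans (Finset.sum_congr rfl fun i _ => ?_)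
    (congrFun (G.SMul_zMul fun r : Fin 3 × Fin 3 => ∑ m, G.z k m •
      ∑ p, φ p (Γ.d (G.z r.1 j) <• G.z m l) • G.mc Γ p) (a, j))
  rw [h.dz_rsmul hc hg, zMul]
  simp only [Finset.smul_sum, mul_smul]

/-- The condition of right covariance on the coefficients of the commutation relations. -/
theorem IsDual.right_covariance (h : G.IsDual Γ φ) (hc : Γ.Bicovariant)
    (hg : Γ.GeneratedBy G.entries) (i j k l n r : Fin 3) :
    ∑ e, ∑ m, φ (n, r) (Γ.d (G.z i e) <• G.z k m) • (G.z e j * G.z m l) =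
      ∑ v, (∑ u, (∑ e, ∑ m, φ (u, v) (Γ.d (G.z e j) <• G.z m l) • (G.z i e * G.z k m)) * G.S u n) *
        G.z r v := by
  obtain ⟨x, hx, hx'⟩ := h.coeff hc hg i j k l
  obtain ⟨-, ΔR, hΔ⟩ := hc
  rw [← h.evalRight_dz_rsmul hΔ, hx, h.evalRight hΔ]
  simp only [hx']

end QGroup

end Functionals

/-! ### Dual functionals and their matrix representation -/

section DualFunctionals

namespace QGroup

variable {q : ℂˣ} {H : Type} [Ring H] [Bialgebra ℂ H] {G : QGroup q H} {Γ : FODC H}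
  {φ : Fin 3 × Fin 3 → Γ.Form →ₗ[ℂ] ℂ}

/-- The values on ω b depend on ω only through its own values under the dual functionals; this is
the multiplicativity behind `IsDual.hom`. -/
theorem IsDual.rsmul (h : G.IsDual Γ φ) (hg : Γ.GeneratedBy G.entries) (ω : Γ.Form) (b : H)
    (r : Fin 3 × Fin 3) : φ r (ω <• b) = ∑ u, φ u ω * φ r (Γ.d (G.entries u) <• b) := by
  have hmem : ω ∈ Submodule.span H (Set.range fun p => Γ.d (G.entries p)) := by
    rw [hg]
    trivial
  obtain ⟨x, rfl⟩ := (Submodule.mem_span_range_iff_exists_fun H).mp hmem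
  have h1 : ∀ u, φ u (∑ p, x p • Γ.d (G.entries p)) = Coalgebra.counit (R := ℂ) (x u) := by
    rintro ⟨a, b⟩
    simp only [map_sum, h.smul, entries, h.d_z, mul_ite, mul_one, mul_zero, Prod.mk.eta,
      Finset.sum_ite_eq, Finset.mem_univ, if_true]
  simp only [h1, Finset.smul_sum, map_sum]
  exact Finset.sum_congr rfl fun p _ => by rw [← smul_comm, h.smul]

/-- The matrix functional of a calculus with dual functionals. -/
noncomputable def IsDual.hom (h : G.IsDual Γ φ) (hg : Γ.GeneratedBy G.entries) :
    H →ₐ[ℂ] Matrix (Fin 3 × Fin 3) (Fin 3 × Fin 3) ℂ :=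
  AlgHom.ofLinearMap
    { toFun := fun a => Matrix.of fun p r => φ r (Γ.d (G.entries p) <• a)
      map_add' := fun a b => by ext p r; simp [add_smul]
      map_smul' := fun c a => by
        ext p r
        simp }
    (by
      ext p r
      obtain ⟨i, j⟩ := p
      simp [entries, h.d_z, Matrix.one_apply, eq_comm])
    (by
      intro a b
      ext p r
      simp only [LinearMap.coe_mk, AddHom.coe_mk, Matrix.of_apply, Matrix.mul_apply]
      rw [← h.rsmul hg, FODC.rsmul_rsmul])

theorem IsDual.hom_apply (h : G.IsDual Γ φ) (hg : Γ.GeneratedBy G.entries) (a : H)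
    (i j : Fin 3) (r : Fin 3 × Fin 3) : h.hom hg a (i, j) r = φ r (Γ.d (G.z i j) <• a) := rfl

theorem IsDual.d_z_mul_z (h : G.IsDual Γ φ) (hg : Γ.GeneratedBy G.entries) (i j k l : Fin 3)
    (r : Fin 3 × Fin 3) : φ r (Γ.d (G.z i j * G.z k l)) =
      h.hom hg (G.z k l) (i, j) r + if i = j then if r = (k, l) then 1 else 0 else 0 := by
  rw [Γ.leibniz, map_add, h.smul, h.d_z, G.counit_z, h.hom_apply]
  split_ifs <;> simp

end QGroup

variable {q : ℂˣ} {Γ : FODC (GLq q)}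

/-- The coordinates with respect to the basis over SL, followed by the counit, are pulled back to
GL. Descent thus supplies what mere generation by the dz over GL does not. -/
theorem FODC.DescendsToSL.exists_isDual (h : Γ.DescendsToSL) :
    ∃ φ : Fin 3 × Fin 3 → Γ.Form →ₗ[ℂ] ℂ, (GLq.qGroup q).IsDual Γ φ := by
  obtain ⟨Γ', ⟨ρ, h1, -, h3, -⟩, -, hB⟩ := h
  let b := Module.Basis.mk hB.1 hB.2.ge
  refine ⟨fun p => Coalgebra.counit ∘ₗ (b.coord p).restrictScalars ℂ ∘ₗ ρ, ?_, ?_⟩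
  · intro p a ω
    simp only [LinearMap.comp_apply, LinearMap.restrictScalars_apply, h1, map_smul, smul_eq_mul,
      Bialgebra.counit_mul, SLq.counit_proj]
  · intro p i j
    have h5 : Γ'.d (SLq.z q i j) = b (i, j) :=
      (Module.Basis.mk_apply hB.1 hB.2.ge (i, j)).symm
    have h4 : ρ (Γ.d ((GLq.qGroup q).z i j)) = b (i, j) := (h3 _).trans h5
    simp only [LinearMap.comp_apply, LinearMap.restrictScalars_apply, h4, Module.Basis.coord_apply,
      Module.Basis.repr_self, Finsupp.single_apply]
    split_ifs with h6 h7 h7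
    · simp
    · exact absurd h6.symm h7
    · exact absurd h7.symm h6
    · simp

end DualFunctionals

/-! ### The commutant of the threefold tensor power of Z -/

section Intertwiners

namespace QGroup

variable {q : ℂˣ} {H : Type} [Ring H] [Bialgebra ℂ H] (G : QGroup q H)

/-- The threefold tensor power of the quantum matrix. -/
def zzz : Matrix Idx3 Idx3 H := fun x y => G.z x.1 y.1 * G.z x.2.1 y.2.1 * G.z x.2.2 y.2.2

theorem zzz_eq : G.zzz = leg1 G.z * leg2 G.z * leg3 G.z := by
  ext ⟨i, k, e⟩ ⟨j, l, o⟩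
  simp [Matrix.mul_apply, leg1, leg2, leg3, Fintype.sum_prod_type, zzz]

/-- Scalar matrices that commute with the threefold tensor power of the quantum matrix. -/
def Intertwines (M : Matrix Idx3 Idx3 ℂ) : Prop :=
  M.map (algebraMap ℂ H) * G.zzz = G.zzz * M.map (algebraMap ℂ H)

variable {G} {M N : Matrix Idx3 Idx3 ℂ}

theorem Intertwines.add (hM : G.Intertwines M) (hN : G.Intertwines N) : G.Intertwines (M + N) := by
  have h : (M + N).map (algebraMap ℂ H) = M.map (algebraMap ℂ H) + N.map (algebraMap ℂ H) :=
    Matrix.map_add _ (map_add _) _ _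
  rw [Intertwines, h, add_mul, mul_add, hM, hN]

theorem Intertwines.smul (hM : G.Intertwines M) (c : ℂ) : G.Intertwines (c • M) := by
  have h : (c • M).map (algebraMap ℂ H) = c • M.map (algebraMap ℂ H) := by
    ext i j
    change algebraMap ℂ H (c * M i j) = c • algebraMap ℂ H (M i j)
    rw [map_mul, Algebra.smul_def]
  rw [Intertwines, h, smul_mul_assoc, mul_smul_comm, hM]

theorem Intertwines.sub (hM : G.Intertwines M) (hN : G.Intertwines N) : G.Intertwines (M - N) := by
  have h := hM.add (hN.smul (-1))
  rwa [neg_one_smul, ← sub_eq_add_neg] at h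

theorem Intertwines.mul (hM : G.Intertwines M) (hN : G.Intertwines N) : G.Intertwines (M * N) := by
  rw [Intertwines, Matrix.map_mul, mul_assoc, hN, ← mul_assoc, hM, mul_assoc]

variable (G) in
theorem intertwines_one : G.Intertwines 1 := by
  rw [Intertwines, Matrix.map_one _ (map_zero _) (map_one _), one_mul, mul_one]

variable (G) in
theorem intertwines_leg12 (s : ℂˣ) : G.Intertwines (leg12 ℂ (braid q s)) := by
  have h : (leg12 ℂ (braid q s)).map (algebraMap ℂ H) = leg12 H (braid q s) := by
    ext x y
    simp only [leg12, Matrix.map_apply]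
    split_ifs <;> simp
  rw [Intertwines, h, zzz_eq, ← mul_assoc, leg12_rtt (G.isQMatrix.braid_mul s), mul_assoc,
    leg12_mul_leg3, ← mul_assoc]

variable (G) in
theorem intertwines_leg23 (s : ℂˣ) : G.Intertwines (leg23 ℂ (braid q s)) := by
  have h : (leg23 ℂ (braid q s)).map (algebraMap ℂ H) = leg23 H (braid q s) := by
    ext x y
    simp only [leg23, Matrix.map_apply]
    split_ifs <;> simp
  rw [Intertwines, h, zzz_eq, mul_assoc, ← mul_assoc, leg23_mul_leg1, mul_assoc,
    leg23_rtt (G.isQMatrix.braid_mul s)]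
  simp only [mul_assoc]

/-- Evaluation of an intertwining relation in a representation. -/
theorem Intertwines.eval (hM : G.Intertwines M) (π : H →ₗ[ℂ] ℂ) (x y : Idx3) :
    ∑ r, M x r * π (G.zzz r y) = ∑ r, M r y * π (G.zzz x r) := by
  have h := congrArg π (congrFun (congrFun hM x) y)
  simpa [Matrix.mul_apply, ← Algebra.smul_def, ← Algebra.commutes] using h

end QGroup

end Intertwiners

/-! ### The intertwiners of the threefold tensor power -/

section Representations

variable {q : ℂˣ}

/-- A two-dimensional upper triangular representation of quantum matrices. -/
def triMat (q : ℂˣ) (x y i j : Fin 3) : Matrix (Fin 2) (Fin 2) ℂ :=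
  !![if i = j then if i = min x y then (q : ℂ) else 1 else 0, if i = x ∧ j = y then 1 else 0;
    0, if i = j then if i = max x y then (q : ℂ) else 1 else 0]

-- The diagonal entries are characters, and the corner entry is a skew derivation. For adjacent x
-- and y these play the role of the raising and lowering operators of the quantized enveloping
-- algebra.
set_option maxHeartbeats 4000000 in
theorem isQMatrix_triMat (q : ℂˣ) {x y : Fin 3}
    (h : (x = 0 ∧ y = 1) ∨ (x = 1 ∧ y = 0) ∨ (x = 1 ∧ y = 2) ∨ (x = 2 ∧ y = 1)) :
    IsQMatrix q (triMat q x y) := by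
  have e0 : (0 : Fin 2 → ℂ) = ![0, 0] := by ext i; fin_cases i <;> rfl
  constructor
  · intro i j k hjk
    rcases h with ⟨rfl, rfl⟩ | ⟨rfl, rfl⟩ | ⟨rfl, rfl⟩ | ⟨rfl, rfl⟩ <;>
      rcases QMatrix.fin3 i with rfl | rfl | rfl <;> rcases QMatrix.fin3 j with rfl | rfl | rfl <;>
      rcases QMatrix.fin3 k with rfl | rfl | rfl <;>
      first
      | exact absurd hjk (by decide)
      | (simp [triMat] <;> exact e0)
  · intro i j k hik
    rcases h with ⟨rfl, rfl⟩ | ⟨rfl, rfl⟩ | ⟨rfl, rfl⟩ | ⟨rfl, rfl⟩ <;>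
      rcases QMatrix.fin3 i with rfl | rfl | rfl <;> rcases QMatrix.fin3 j with rfl | rfl | rfl <;>
      rcases QMatrix.fin3 k with rfl | rfl | rfl <;>
      first
      | exact absurd hik (by decide)
      | (simp [triMat] <;> exact e0)
  · intro i j k l hik hlj
    rcases h with ⟨rfl, rfl⟩ | ⟨rfl, rfl⟩ | ⟨rfl, rfl⟩ | ⟨rfl, rfl⟩ <;>
      rcases QMatrix.fin3 i with rfl | rfl | rfl <;> rcases QMatrix.fin3 k with rfl | rfl | rfl <;>
      first
      | exact absurd hik (by decide)
      | (rcases QMatrix.fin3 j with rfl | rfl | rfl <;> rcases QMatrix.fin3 l with rfl | rfl | rfl <;>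
        first
        | exact absurd hlj (by decide)
        | (simp [triMat] <;> exact e0))
  · intro i j k l hik hjl
    rcases h with ⟨rfl, rfl⟩ | ⟨rfl, rfl⟩ | ⟨rfl, rfl⟩ | ⟨rfl, rfl⟩ <;>
      rcases QMatrix.fin3 i with rfl | rfl | rfl <;> rcases QMatrix.fin3 k with rfl | rfl | rfl <;>
      first
      | exact absurd hik (by decide)
      | (rcases QMatrix.fin3 j with rfl | rfl | rfl <;> rcases QMatrix.fin3 l with rfl | rfl | rfl <;>
        first
        | exact absurd hjl (by decide)
        | (simp [triMat] <;> exact e0))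

theorem qDet_triMat (q : ℂˣ) {x y : Fin 3}
    (h : (x = 0 ∧ y = 1) ∨ (x = 1 ∧ y = 0) ∨ (x = 1 ∧ y = 2) ∨ (x = 2 ∧ y = 1)) :
    qDet q (triMat q x y) = (q : ℂ) • 1 := by
  rcases h with ⟨rfl, rfl⟩ | ⟨rfl, rfl⟩ | ⟨rfl, rfl⟩ | ⟨rfl, rfl⟩ <;> ext i j <;> fin_cases i <;>
    fin_cases j <;> simp [qDet, triMat]

/-- The representation of `GL_q(3)` given by `triMat`. -/
noncomputable def triHom (q : ℂˣ) {x y : Fin 3}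
    (h : (x = 0 ∧ y = 1) ∨ (x = 1 ∧ y = 0) ∨ (x = 1 ∧ y = 2) ∨ (x = 2 ∧ y = 1)) :
    GLq q →ₐ[ℂ] Matrix (Fin 2) (Fin 2) ℂ :=
  GLq.lift (triMat q x y) ((q : ℂ)⁻¹ • 1) (isQMatrix_triMat q h)
    (by rw [qDet_triMat q h, smul_mul_smul_comm, mul_inv_cancel₀ q.ne_zero, one_mul, one_smul])
    (by rw [qDet_triMat q h, smul_mul_smul_comm, inv_mul_cancel₀ q.ne_zero, one_mul, one_smul])

/-- The diagonal character of `GL_q(3)` with values `2, 3, 5`. -/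
noncomputable def diagHom (q : ℂˣ) : GLq q →ₐ[ℂ] ℂ :=
  GLq.lift (fun i j => if i = j then (![2, 3, 5] i : ℂ) else 0) (1 / 30 : ℂ)
    (by
      constructor
      · intro i j k h
        rcases eq_or_ne i j with rfl | hij
        · simp [h.ne]
        · simp [hij]
      · intro i j k h
        rcases eq_or_ne i j with rfl | hij
        · simp [h.ne']
        · simp [hij]
      · exact fun i j k l _ _ => mul_comm _ _
      · intro i j k l h h'
        have h0 : (if k = j then (![2, 3, 5] k : ℂ) else 0) *
            (if i = l then (![2, 3, 5] i : ℂ) else 0) = 0 := by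
          by_cases hk : k = j
          · have : i ≠ l := by rintro rfl; subst hk; exact lt_asymm h h'
            simp [this]
          · simp [hk]
        rw [h0, smul_zero, add_zero, mul_comm])
    (by simp [qDet]; norm_num) (by simp [qDet]; norm_num)

namespace QGroup

variable {M : Matrix Idx3 Idx3 ℂ}

/-- Intertwiners preserve weights. -/
theorem Intertwines.weight (hM : (GLq.qGroup q).Intertwines M) (i k w j l y : Fin 3)
    (h : (![2, 3, 5] i : ℂ) * ![2, 3, 5] k * ![2, 3, 5] w ≠
      ![2, 3, 5] j * ![2, 3, 5] l * ![2, 3, 5] y) : M (i, k, w) (j, l, y) = 0 := by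
  -- The values 2, 3, 5 are distinct primes: by unique factorisation a product of three of them
  -- determines the multiset of indices, so this one character separates all weights.
  have h1 := hM.eval (diagHom q).toLinearMap (i, k, w) (j, l, y)
  have h2 : ∀ a b, diagHom q ((GLq.qGroup q).z a b) = if a = b then (![2, 3, 5] a : ℂ) else 0 :=
    fun a b => GLq.lift_z _ _ _ _ _ _ _
  simp only [AlgHom.toLinearMap_apply, zzz, map_mul, h2, Fintype.sum_prod_type, mul_ite, ite_mul,
    mul_zero, zero_mul, Finset.sum_ite_eq, Finset.sum_ite_eq', Finset.mem_univ, if_true] at h1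
  have h3 : M (i, k, w) (j, l, y) * ((![2, 3, 5] i : ℂ) * ![2, 3, 5] k * ![2, 3, 5] w -
      ![2, 3, 5] j * ![2, 3, 5] l * ![2, 3, 5] y) = 0 := by
    linear_combination -h1
  exact (mul_eq_zero.mp h3).resolve_right (sub_ne_zero.mpr h)

/-- The kernel of an intertwiner is stable under the derivations given by `triMat`. -/
theorem Intertwines.ker_step (hM : (GLq.qGroup q).Intertwines M) {x y : Fin 3}
    (h : (x = 0 ∧ y = 1) ∨ (x = 1 ∧ y = 0) ∨ (x = 1 ∧ y = 2) ∨ (x = 2 ∧ y = 1))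
    {j l o : Fin 3} (h0 : ∀ r, M r (j, l, o) = 0) (r : Idx3) :
    (if j = y then (if l = max x y then (q : ℂ) else 1) * (if o = max x y then (q : ℂ) else 1) *
      M r (x, l, o) else 0) +
    (if l = y then (if j = min x y then (q : ℂ) else 1) * (if o = max x y then (q : ℂ) else 1) *
      M r (j, x, o) else 0) +
    (if o = y then (if j = min x y then (q : ℂ) else 1) * (if l = min x y then (q : ℂ) else 1) *
      M r (j, l, x) else 0) = 0 := by
  have h1 := hM.eval (Matrix.entryLinearMap ℂ ℂ 0 1 ∘ₗ (triHom q h).toLinearMap) r (j, l, o)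
  have h2 : ∀ a b, triHom q h ((GLq.qGroup q).z a b) = triMat q x y a b :=
    fun a b => GLq.lift_z _ _ _ _ _ _ _
  simp only [LinearMap.comp_apply, AlgHom.toLinearMap_apply, zzz, map_mul, h2,
    Matrix.entryLinearMap_apply, h0, zero_mul, Finset.sum_const_zero] at h1
  -- The corner entry of a product of upper triangular matrices obeys a twisted Leibniz rule.
  have h3 : ∀ a b c d e f : Fin 3, (triMat q x y a b * triMat q x y c d * triMat q x y e f) 0 1 =
      (if a = x ∧ b = y then 1 else 0) * (if c = d then if c = max x y then (q : ℂ) else 1 else 0) *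
        (if e = f then if e = max x y then (q : ℂ) else 1 else 0) +
      (if a = b then if a = min x y then (q : ℂ) else 1 else 0) * (if c = x ∧ d = y then 1 else 0) *
        (if e = f then if e = max x y then (q : ℂ) else 1 else 0) +
      (if a = b then if a = min x y then (q : ℂ) else 1 else 0) *
        (if c = d then if c = min x y then (q : ℂ) else 1 else 0) *
        (if e = x ∧ f = y then 1 else 0) := by
    intro a b c d e f
    simp only [triMat, Matrix.mul_fin_two, Matrix.of_apply, Matrix.cons_val', Matrix.cons_val_zero,
      Matrix.cons_val_one, Matrix.cons_val_fin_one]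
    ring
  refine Eq.trans ?_ h1
  generalize (max x y) = mx at h3 ⊢
  generalize (min x y) = mn at h3 ⊢
  simp only [h3, Fintype.sum_prod_type, mul_add, Finset.sum_add_distrib, mul_ite, ite_mul, mul_zero,
    zero_mul, ite_and, mul_one, one_mul, Finset.sum_ite_eq, Finset.sum_ite_eq', Finset.mem_univ,
    if_true, Finset.sum_ite_irrel, Finset.sum_const_zero]
  split_ifs <;> ring

end QGroup

end Representations

/-! ### Spanning the commutant by products of braid matrices -/

section Centralizer

variable {q : ℂˣ} {M : Matrix Idx3 Idx3 ℂ}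

namespace QGroup

/-- An intertwiner is determined by its value on a vector of multiplicity-free weight. -/
theorem Intertwines.eq_zero (hM : (GLq.qGroup q).Intertwines M) (h012 : ∀ r, M r (0, 1, 2) = 0) :
    M = 0 := by
  have hq := q.ne_zero
  -- The operator for (x, y) replaces one index y by x. The order below is arranged so that each
  -- application involves only one new column, up to a nonzero factor, besides columns already known
  -- to vanish; starting from 012 all 27 columns are reached.
  have s01 := fun {j l o : Fin 3} => hM.ker_step (x := 0) (y := 1) (Or.inl ⟨rfl, rfl⟩) (j := j) (l := l) (o := o)
  have s10 := fun {j l o : Fin 3} => hM.ker_step (x := 1) (y := 0) (Or.inr (Or.inl ⟨rfl, rfl⟩)) (j := j) (l := l) (o := o)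
  have s12 := fun {j l o : Fin 3} => hM.ker_step (x := 1) (y := 2) (Or.inr (Or.inr (Or.inl ⟨rfl, rfl⟩))) (j := j) (l := l) (o := o)
  have s21 := fun {j l o : Fin 3} => hM.ker_step (x := 2) (y := 1) (Or.inr (Or.inr (Or.inr ⟨rfl, rfl⟩))) (j := j) (l := l) (o := o)
  have h112 : ∀ r, M r (1, 1, 2) = 0 := fun r => by
    simpa [hq] using s10 h012 r
  have h002 : ∀ r, M r (0, 0, 2) = 0 := fun r => by
    simpa [hq] using s01 h012 r
  have h022 : ∀ r, M r (0, 2, 2) = 0 := fun r => by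
    simpa [hq] using s21 h012 r
  have h011 : ∀ r, M r (0, 1, 1) = 0 := fun r => by
    simpa [hq] using s12 h012 r
  have h102 : ∀ r, M r (1, 0, 2) = 0 := fun r => by
    simpa [hq, h012 r] using s10 h002 r
  have h021 : ∀ r, M r (0, 2, 1) = 0 := fun r => by
    simpa [hq, h012 r] using s21 h011 r
  have h101 : ∀ r, M r (1, 0, 1) = 0 := fun r => by
    simpa [hq] using s12 h102 r
  have h202 : ∀ r, M r (2, 0, 2) = 0 := fun r => by
    simpa [hq] using s21 h102 r
  have h201 : ∀ r, M r (2, 0, 1) = 0 := fun r => by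
    simpa [hq, h102 r] using s12 h202 r
  have h020 : ∀ r, M r (0, 2, 0) = 0 := fun r => by
    simpa [hq] using s01 h021 r
  have h120 : ∀ r, M r (1, 2, 0) = 0 := fun r => by
    simpa [hq, h021 r] using s10 h020 r
  have h200 : ∀ r, M r (2, 0, 0) = 0 := fun r => by
    simpa [hq] using s01 h201 r
  have h210 : ∀ r, M r (2, 1, 0) = 0 := fun r => by
    simpa [hq, h201 r] using s10 h200 r
  have h110 : ∀ r, M r (1, 1, 0) = 0 := fun r => by
    simpa [hq] using s12 h120 r
  have h121 : ∀ r, M r (1, 2, 1) = 0 := fun r => by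
    simpa [hq] using s10 h021 r
  have h211 : ∀ r, M r (2, 1, 1) = 0 := fun r => by
    simpa [hq] using s10 h201 r
  have h220 : ∀ r, M r (2, 2, 0) = 0 := fun r => by
    simpa [hq] using s21 h210 r
  have h001 : ∀ r, M r (0, 0, 1) = 0 := fun r => by
    simpa [hq] using s12 h002 r
  have h010 : ∀ r, M r (0, 1, 0) = 0 := fun r => by
    simpa [hq] using s12 h020 r
  have h100 : ∀ r, M r (1, 0, 0) = 0 := fun r => by
    simpa [hq] using s12 h200 r
  have h221 : ∀ r, M r (2, 2, 1) = 0 := fun r => by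
    simpa [hq] using s10 h220 r
  have h212 : ∀ r, M r (2, 1, 2) = 0 := fun r => by
    simpa [hq] using s10 h202 r
  have h122 : ∀ r, M r (1, 2, 2) = 0 := fun r => by
    simpa [hq] using s10 h022 r
  have h000 : ∀ r, M r (0, 0, 0) = 0 := fun r => by
    simpa [hq] using s01 h001 r
  have h111 : ∀ r, M r (1, 1, 1) = 0 := fun r => by
    simpa [hq] using s10 h011 r
  have h222 : ∀ r, M r (2, 2, 2) = 0 := fun r => by
    simpa [hq] using s21 h122 r
  ext r ⟨j, l, o⟩
  rcases QMatrix.fin3 j with rfl | rfl | rfl <;> rcases QMatrix.fin3 l with rfl | rfl | rfl <;>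
    rcases QMatrix.fin3 o with rfl | rfl | rfl <;> apply_assumption

/-- For s = q the diagonal entry at an increasing pair is zero, so there the braid matrix is the
plain flip. -/
theorem leg12_column {a b : Fin 3} (hab : a < b) (c : Fin 3) (r : Idx3) :
    leg12 ℂ (braid q q) r (a, b, c) = if r = (b, a, c) then 1 else 0 := by
  obtain ⟨i, k, w⟩ := r
  simp only [leg12, braid, Algebra.algebraMap_self, RingHom.id_apply, Prod.mk.injEq]
  by_cases h1 : i = a ∧ k = b
  · obtain ⟨rfl, rfl⟩ := h1
    simp [hab, hab.ne]
  · by_cases h2 : i = b ∧ k = a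
    · obtain ⟨rfl, rfl⟩ := h2
      simp [hab.ne, hab.ne']
    · have h3 : ¬ (i ≠ k ∧ i = b ∧ k = a) := fun h => h2 h.2
      have h4 : ¬ (i = b ∧ k = a ∧ w = c) := fun h => h2 ⟨h.1, h.2.1⟩
      simp [h1, h3, h4]

theorem leg23_column {a b : Fin 3} (hab : a < b) (c : Fin 3) (r : Idx3) :
    leg23 ℂ (braid q q) r (c, a, b) = if r = (c, b, a) then 1 else 0 := by
  obtain ⟨w, i, k⟩ := r
  simp only [leg23, braid, Algebra.algebraMap_self, RingHom.id_apply, Prod.mk.injEq]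
  by_cases h1 : i = a ∧ k = b
  · obtain ⟨rfl, rfl⟩ := h1
    simp [hab, hab.ne]
  · by_cases h2 : i = b ∧ k = a
    · obtain ⟨rfl, rfl⟩ := h2
      simp [hab.ne, hab.ne']
    · have h3 : ¬ (i ≠ k ∧ i = b ∧ k = a) := fun h => h2 h.2
      have h4 : ¬ (w = c ∧ i = b ∧ k = a) := fun h => h2 h.2
      simp [h1, h3, h4]

theorem mul_column {A B : Matrix Idx3 Idx3 ℂ} {x y : Idx3}
    (hB : ∀ r, B r x = if r = y then 1 else 0) (r : Idx3) : (A * B) r x = A r y := by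
  simp [Matrix.mul_apply, hB]

/-- The intertwiners of the threefold tensor power are spanned by the products of the braid
matrices. -/
theorem Intertwines.exists_eq (hM : (GLq.qGroup q).Intertwines M) : ∃ c : Fin 6 → ℂ,
    M = c 0 • (1 : Matrix Idx3 Idx3 ℂ) + c 1 • leg12 ℂ (braid q q) + c 2 • leg23 ℂ (braid q q) +
      c 3 • (leg12 ℂ (braid q q) * leg23 ℂ (braid q q)) +
      c 4 • (leg23 ℂ (braid q q) * leg12 ℂ (braid q q)) +
      c 5 • (leg12 ℂ (braid q q) * (leg23 ℂ (braid q q) * leg12 ℂ (braid q q))) := by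
  have k1 := (GLq.qGroup q).intertwines_leg12 q
  have k2 := (GLq.qGroup q).intertwines_leg23 q
  -- In column 012 every flip acts on an increasing pair, so the six products give the six permuted
  -- basis vectors and the coefficients can be read off there.
  refine ⟨![M (0, 1, 2) (0, 1, 2), M (1, 0, 2) (0, 1, 2), M (0, 2, 1) (0, 1, 2),
    M (2, 0, 1) (0, 1, 2), M (1, 2, 0) (0, 1, 2), M (2, 1, 0) (0, 1, 2)], ?_⟩
  rw [← sub_eq_zero]
  refine Intertwines.eq_zero (hM.sub ((((((GLq.qGroup q).intertwines_one.smul _).add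
    (k1.smul _)).add (k2.smul _)).add ((k1.mul k2).smul _)).add ((k2.mul k1).smul _) |>.add
    ((k1.mul (k2.mul k1)).smul _))) fun r => ?_
  have h1 := leg12_column (q := q) (show (0 : Fin 3) < 1 by decide) 2
  have h2 := leg23_column (q := q) (show (1 : Fin 3) < 2 by decide) 0
  have h12 := fun r => (mul_column (A := leg12 ℂ (braid q q)) h2 r).trans
    (leg12_column (show (0 : Fin 3) < 2 by decide) 1 r)
  have h21 := fun r => (mul_column (A := leg23 ℂ (braid q q)) h1 r).trans
    (leg23_column (show (0 : Fin 3) < 2 by decide) 1 r)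
  have h121 := fun r => (mul_column (A := leg12 ℂ (braid q q)) h21 r).trans
    (leg12_column (show (1 : Fin 3) < 2 by decide) 0 r)
  simp only [Matrix.sub_apply, Matrix.add_apply, Matrix.smul_apply, h1, h2, h12, h21, h121,
    Matrix.one_apply]
  obtain ⟨i, k, w⟩ := r
  -- Rows that are not permutations of 012 vanish by weight.
  have hw := hM.weight i k w 0 1 2
  rcases QMatrix.fin3 i with rfl | rfl | rfl <;> rcases QMatrix.fin3 k with rfl | rfl | rfl <;>
    rcases QMatrix.fin3 w with rfl | rfl | rfl <;> simp <;> exact hw (by simp <;> norm_num)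

end QGroup

end Centralizer

/-! ### From intertwiners back to structure constants -/

section BraidContraction

variable {q : ℂˣ}

theorem leg12_mul_leg23_apply (g h : Fin 3 → Fin 3 → Fin 3 → Fin 3 → ℂ) (i k w j l y : Fin 3) :
    (leg12 ℂ g * leg23 ℂ h) (i, k, w) (j, l, y) = ∑ n, g i k j n * h n w l y := by
  simp [Matrix.mul_apply, leg12, leg23, Fintype.sum_prod_type]

theorem leg23_mul_leg12_apply (g h : Fin 3 → Fin 3 → Fin 3 → Fin 3 → ℂ) (i k w j l y : Fin 3) :
    (leg23 ℂ h * leg12 ℂ g) (i, k, w) (j, l, y) = ∑ r, h k w r y * g i r j l := by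
  simp [Matrix.mul_apply, leg12, leg23, Fintype.sum_prod_type]

theorem leg12_mul_apply (g : Fin 3 → Fin 3 → Fin 3 → Fin 3 → ℂ) (M : Matrix Idx3 Idx3 ℂ)
    (i k w : Fin 3) (x : Idx3) :
    (leg12 ℂ g * M) (i, k, w) x = ∑ a, ∑ n, g i k a n * M (a, n, w) x := by
  simp [Matrix.mul_apply, leg12, Fintype.sum_prod_type]

/-- Contraction of a tensor with the braid matrix. -/
noncomputable def braidContract (q : ℂˣ)
    (C : Fin 3 → Fin 3 → Fin 3 → Fin 3 → Fin 3 → Fin 3 → ℂ) :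
    Matrix Idx3 Idx3 ℂ := fun x y =>
  ∑ n, ∑ r, C x.1 y.1 x.2.1 y.2.1 n r * braid q q n x.2.2 r y.2.2

/-- The partially transposed braid matrix is invertible: off-diagonal entries are recovered one at a
time, and the diagonal ones satisfy a triangular system solved from index 2 downwards. -/
theorem braid_contraction_injective {f g : Fin 3 → Fin 3 → ℂ}
    (h : ∀ w y, ∑ n, ∑ r, f n r * braid q q n w r y = ∑ n, ∑ r, g n r * braid q q n w r y) :
    f = g := by
  have hq := q.ne_zero
  have e : ∀ w y, ∑ n, ∑ r, (f n r - g n r) * braid q q n w r y = 0 := fun w y => by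
    simp only [sub_mul, Finset.sum_sub_distrib, h, sub_self]
  have h0 : ∀ x : ℂ, (q : ℂ)⁻¹ * x = 0 → x = 0 := fun x hx =>
    (mul_eq_zero.mp hx).resolve_left (inv_ne_zero hq)
  have h22 : f 2 2 - g 2 2 = 0 := h0 _ (by simpa [braid, Fin.sum_univ_three, mul_comm] using e 2 2)
  have h11 : f 1 1 - g 1 1 = 0 := h0 _ (by
    simpa [braid, Fin.sum_univ_three, h22, mul_comm] using e 1 1)
  have h00 : f 0 0 - g 0 0 = 0 := h0 _ (by
    simpa [braid, Fin.sum_univ_three, h22, h11, mul_comm] using e 0 0)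
  have hne : ∀ n r, n ≠ r → f n r - g n r = 0 := by
    intro n r hnr
    have h1 := e r n
    simp only [Fin.sum_univ_three, braid] at h1
    rcases QMatrix.fin3 n with rfl | rfl | rfl <;> rcases QMatrix.fin3 r with rfl | rfl | rfl <;>
      first
      | exact absurd rfl hnr
      | simpa using h1
  funext n r
  rw [← sub_eq_zero]
  rcases eq_or_ne n r with rfl | hnr
  · rcases QMatrix.fin3 n with rfl | rfl | rfl <;> assumption
  · exact hne n r hnr

theorem braidContract_injective {C C' : Fin 3 → Fin 3 → Fin 3 → Fin 3 → Fin 3 → Fin 3 → ℂ}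
    (h : braidContract q C = braidContract q C') : C = C' := by
  funext i j k l
  exact braid_contraction_injective fun w y => congrFun (congrFun h (i, k, w)) (j, l, y)

/-- The tensors that arise from the intertwiners of the threefold tensor power. -/
noncomputable def braidTensor (q : ℂˣ) (x₁ x₂ x₃ x₄ y₀ y₁ : ℂ) (i j k l n r : Fin 3) : ℂ :=
  (if i = j then if n = k then if r = l then x₁ else 0 else 0 else 0) +
    (if r = l then x₂ * braid q q i k j n else 0) +
    (if n = k then x₃ * braid q q i r j l else 0) +
    x₄ * ∑ a, braid q q i k a n * braid q q a r j l +
    if n = r then qWeight q n * ((if i = j then if k = l then y₀ else 0 else 0) +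
      y₁ * braid q q i k j l) else 0

/-- The partial quantum trace of the braid matrix is the scalar q⁻¹. Hence the trace terms of
`braidTensor` contract to intertwiners without a factor on the last leg. -/
theorem sum_qWeight_braid (w y : Fin 3) :
    ∑ n, qWeight q n * braid q q n w n y = if w = y then (q : ℂ)⁻¹ else 0 := by
  have hq := q.ne_zero
  rcases QMatrix.fin3 w with rfl | rfl | rfl <;> rcases QMatrix.fin3 y with rfl | rfl | rfl <;>
    simp [Fin.sum_univ_three, braid, qWeight] <;> field_simp <;> ring

/-- The six terms of the tensor correspond one by one to the six products of braid matrices. The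
factors q before y₀ and y₁ cancel the partial trace q⁻¹. -/
theorem braidContract_braidTensor (x₁ x₂ x₃ x₄ y₀ y₁ : ℂ) :
    braidContract q (braidTensor q x₁ x₂ x₃ x₄ ((q : ℂ) * y₀) ((q : ℂ) * y₁)) =
      y₀ • (1 : Matrix Idx3 Idx3 ℂ) + y₁ • leg12 ℂ (braid q q) + x₁ • leg23 ℂ (braid q q) +
      x₂ • (leg12 ℂ (braid q q) * leg23 ℂ (braid q q)) +
      x₃ • (leg23 ℂ (braid q q) * leg12 ℂ (braid q q)) +
      x₄ • (leg12 ℂ (braid q q) * (leg23 ℂ (braid q q) * leg12 ℂ (braid q q))) := by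
  have hq := q.ne_zero
  ext ⟨i, k, w⟩ ⟨j, l, y⟩
  simp only [Matrix.add_apply, Matrix.smul_apply, leg12_mul_leg23_apply]
  simp only [leg12_mul_apply, leg23_mul_leg12_apply, braidContract, braidTensor, add_mul, Finset.sum_add_distrib]
  have h1 : ∑ n, ∑ r, (if i = j then if n = k then if r = l then x₁ else 0 else 0 else 0) *
      braid q q n w r y = x₁ • leg23 ℂ (braid q q) (i, k, w) (j, l, y) := by
    simp [leg23, ite_mul]
  have h2 : ∑ n, ∑ r, (if r = l then x₂ * braid q q i k j n else 0) * braid q q n w r y =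
      x₂ • ∑ n, braid q q i k j n * braid q q n w l y := by
    simp [ite_mul, Finset.mul_sum, mul_assoc]
  have h3 : ∑ n, ∑ r, (if n = k then x₃ * braid q q i r j l else 0) * braid q q n w r y =
      x₃ • ∑ r, braid q q k w r y * braid q q i r j l := by
    simp only [ite_mul, zero_mul, smul_eq_mul, Finset.mul_sum]
    rw [Finset.sum_comm]
    refine Finset.sum_congr rfl fun r _ => ?_
    rw [Finset.sum_ite_eq' Finset.univ k, if_pos (Finset.mem_univ _)]
    ring
  have h4 : ∑ n, ∑ r, (x₄ * ∑ a, braid q q i k a n * braid q q a r j l) * braid q q n w r y =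
      x₄ • ∑ a, ∑ n, braid q q i k a n * ∑ r, braid q q n w r y * braid q q a r j l := by
    simp only [smul_eq_mul, Finset.mul_sum, Finset.sum_mul]
    symm
    rw [Finset.sum_comm]
    refine Finset.sum_congr rfl fun n _ => ?_
    rw [Finset.sum_comm]
    refine Finset.sum_congr rfl fun r _ => Finset.sum_congr rfl fun a _ => ?_
    ring
  have h5 : ∑ n, ∑ r, (if n = r then qWeight q n * ((if i = j then if k = l then (q : ℂ) * y₀
      else 0 else 0) + (q : ℂ) * y₁ * braid q q i k j l) else 0) * braid q q n w r y =
      y₀ • (1 : Matrix Idx3 Idx3 ℂ) (i, k, w) (j, l, y) +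
        y₁ • leg12 ℂ (braid q q) (i, k, w) (j, l, y) := by
    simp only [ite_mul, zero_mul, Finset.sum_ite_eq, Finset.mem_univ, if_true]
    have h6 : ∀ c : ℂ, ∑ n, qWeight q n * c * braid q q n w n y =
        if w = y then c * (q : ℂ)⁻¹ else 0 := fun c => by
      rw [← mul_ite_zero, ← sum_qWeight_braid, Finset.mul_sum]
      exact Finset.sum_congr rfl fun _ _ => by ring
    rw [h6]
    by_cases hw : w = y
    · by_cases hi : i = j
      · by_cases hk : k = l
        · subst hw hi hk
          simp [leg12]
          field_simp
        · simp [hw, hi, hk, leg12]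
          field_simp
      · simp [hw, hi, leg12]
        field_simp
    · simp [hw, leg12]
  rw [h1, h2, h3, h4, h5]
  ring

namespace QGroup

variable {H : Type} [Ring H] [Bialgebra ℂ H] {G : QGroup q H} {Γ : FODC H}
  {φ : Fin 3 × Fin 3 → Γ.Form →ₗ[ℂ] ℂ}

/-- Right covariance relates its two sides through S and Z. After contraction with the braid matrix
and one more Z, the commutation of B with Z ⊗ Z moves a Z next to S, where the two cancel; the
antipode is thus eliminated. -/
theorem sum_braid_of_eq_conj (X Y : Fin 3 → Fin 3 → H)
    (h : ∀ n r, X n r = ∑ v, (∑ u, Y u v * G.S u n) * G.z r v) (w y : Fin 3) :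
    ∑ n, ∑ r, ∑ y', braid q q n w r y' • (X n r * G.z y' y) =
      ∑ u, ∑ v, ∑ b, braid q q u b v y • (Y u v * G.z w b) := by
  have h1 : ∀ u v, ∑ n, G.S u n * ∑ r, ∑ y', braid q q n w r y' • (G.z r v * G.z y' y) =
      ∑ b, braid q q u b v y • G.z w b := by
    intro u v
    simp only [G.isQMatrix.braid_mul q, Finset.mul_sum, mul_smul_comm, ← mul_assoc]
    rw [sum_rotate, sum_rotate]
    have h2 : ∀ a b, ∑ n, braid q q a b v y • (G.S u n * G.z n a * G.z w b) =
        if u = a then braid q q a b v y • G.z w b else 0 := fun a b => by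
      rw [← Finset.smul_sum, ← Finset.sum_mul, G.S_mul]
      split_ifs <;> simp
    simp only [h2]
    rw [Finset.sum_comm]
    simp
  have h3 : ∑ u, ∑ v, ∑ b, braid q q u b v y • (Y u v * G.z w b) = ∑ u, ∑ v, Y u v *
      ∑ n, G.S u n * ∑ r, ∑ y', braid q q n w r y' • (G.z r v * G.z y' y) := by
    simp only [h1]
    simp only [Finset.mul_sum, mul_smul_comm]
  rw [h3]
  simp only [h, Finset.mul_sum, Finset.sum_mul, Finset.smul_sum, mul_smul_comm, mul_assoc]
  symm
  rw [sum_rotate₅]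
  exact Finset.sum_congr rfl fun n _ => Finset.sum_congr rfl fun r _ => Finset.sum_congr rfl
    fun y' _ => Finset.sum_comm

/-- Without the antipode, right covariance is a relation between scalars and cubic monomials in Z,
that is, commutation with the threefold tensor power. -/
theorem IsDual.intertwines (h : G.IsDual Γ φ) (hc : Γ.Bicovariant)
    (hg : Γ.GeneratedBy G.entries) :
    G.Intertwines (braidContract q fun i j k l n r => φ (n, r) (Γ.d (G.z i j) <• G.z k l)) := by
  rw [Intertwines]
  ext ⟨i, k, w⟩ ⟨j, l, y⟩
  have h1 := sum_braid_of_eq_conj _ _ (fun n r => h.right_covariance hc hg i j k l n r) w y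
  simp only [Matrix.mul_apply, Fintype.sum_prod_type, Matrix.map_apply, braidContract, zzz,
    ← Algebra.smul_def, ← Algebra.commutes]
  simp only [Finset.sum_smul, Finset.sum_mul, Finset.smul_sum, smul_mul_assoc, smul_smul] at h1 ⊢
  refine Eq.trans ?_ (h1.trans ?_)
  · refine (sum_rotate₅ _).trans (Eq.trans ?_ (sum_rotate _).symm)
    refine Finset.sum_congr rfl fun b _ => Finset.sum_congr rfl fun n _ => Finset.sum_congr rfl
      fun r _ => Finset.sum_congr rfl fun e _ => Finset.sum_congr rfl fun m _ => ?_
    rw [mul_comm (braid _ _ _ _ _ _)]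
  · refine (sum_rotate₅ _).trans (Eq.trans ?_ (sum_rotate _).symm)
    refine Finset.sum_congr rfl fun b _ => Finset.sum_congr rfl fun n _ => Finset.sum_congr rfl
      fun r _ => Finset.sum_congr rfl fun e _ => Finset.sum_congr rfl fun m _ => ?_
    rw [mul_comm (braid _ _ _ _ _ _)]

end QGroup

/-- The structure constants of a bicovariant calculus with dual functionals. -/
theorem QGroup.IsDual.exists_braidTensor {Γ : FODC (GLq q)}
    {φ : Fin 3 × Fin 3 → Γ.Form →ₗ[ℂ] ℂ} (h : (GLq.qGroup q).IsDual Γ φ)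
    (hc : Γ.Bicovariant) (hg : Γ.GeneratedBy (GLq.qGroup q).entries) :
    ∃ x₁ x₂ x₃ x₄ y₀ y₁ : ℂ, ∀ i j k l n r, φ (n, r) (Γ.d (GLq.z q i j) <• GLq.z q k l) =
      braidTensor q x₁ x₂ x₃ x₄ y₀ y₁ i j k l n r := by
  obtain ⟨c, hM⟩ := (h.intertwines hc hg).exists_eq
  refine ⟨c 2, c 3, c 4, c 5, q * c 0, q * c 1, fun i j k l n r => ?_⟩
  rw [← braidContract_braidTensor] at hM
  exact congrFun (congrFun (congrFun (congrFun (congrFun (congrFun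
    (braidContract_injective hM) i) j) k) l) n) r

end BraidContraction

/-! ### Polynomial equations for the structure constants -/

section Classification

variable {q s : ℂˣ} {t : ℂ}

theorem braid_eq_add (q s : ℂˣ) (a b x y : Fin 3) : braid q s a b x y =
    braid q q a b x y + if a = x then if b = y then (s : ℂ)⁻¹ - (q : ℂ)⁻¹ else 0 else 0 := by
  by_cases h : a = x
  · by_cases h' : b = y
    · simp only [braid, h, h', and_self, if_true]
      ring
    · simp [braid, h, h']
  · simp [braid, h]

/-- The Hecke relation (B - q⁻¹)(B + q) = 0 in coordinates. -/
theorem braid_sq (i k j l : Fin 3) : ∑ a, ∑ b, braid q q i k a b * braid q q a b j l =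
    (if i = j then if k = l then 1 else 0 else 0) - ((q : ℂ) - (q : ℂ)⁻¹) * braid q q i k j l := by
  have hq := q.ne_zero
  have h := braid_sum_right (q := q) q (fun a b => braid q q a b j l) i k
  simp only [smul_eq_mul] at h
  rw [h]
  rcases QMatrix.fin3 i with rfl | rfl | rfl <;> rcases QMatrix.fin3 k with rfl | rfl | rfl <;>
    rcases QMatrix.fin3 j with rfl | rfl | rfl <;> rcases QMatrix.fin3 l with rfl | rfl | rfl <;>
    simp [braid] <;> field_simp <;> ring

theorem sum_braid_mul_braid (i k j l n r : Fin 3) :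
    ∑ a, braid q s i k a n * braid q s a r j l =
      ∑ a, braid q q i k a n * braid q q a r j l +
      ((s : ℂ)⁻¹ - (q : ℂ)⁻¹) * ((if r = l then braid q q i k j n else 0) +
        (if n = k then braid q q i r j l else 0) +
        if i = j then if n = k then if r = l then (s : ℂ)⁻¹ - (q : ℂ)⁻¹ else 0 else 0 else 0) := by
  simp only [braid_eq_add q s, add_mul, mul_add, Finset.sum_add_distrib, ite_mul, mul_ite,
    zero_mul, mul_zero, Finset.sum_ite_eq, Finset.sum_ite_eq', Finset.mem_univ, if_true]
  simp only [eq_comm (a := k) (b := n)]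
  by_cases hr : r = l
  · by_cases hk : n = k
    · by_cases hi : i = j
      · simp [hr, hk, hi]; ring
      · simp [hr, hk, hi]; ring
    · simp [hr, hk]; ring
  · by_cases hk : n = k
    · simp [hr, hk]
    · simp [hr, hk]

theorem braid_sq_add (i k j l : Fin 3) : ∑ a, ∑ b, braid q s i k a b * braid q s a b j l =
    (if i = j then if k = l then 1 + ((s : ℂ)⁻¹ - (q : ℂ)⁻¹) ^ 2 else 0 else 0) +
      (2 * ((s : ℂ)⁻¹ - (q : ℂ)⁻¹) - ((q : ℂ) - (q : ℂ)⁻¹)) * braid q q i k j l := by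
  rw [Finset.sum_comm]
  simp only [sum_braid_mul_braid (q := q) (s := s), Finset.sum_add_distrib, ← Finset.mul_sum]
  rw [Finset.sum_comm, braid_sq]
  simp only [Finset.sum_ite_eq, Finset.sum_ite_eq', Finset.mem_univ, if_true,
    Finset.sum_ite_irrel, Finset.sum_const_zero]
  by_cases hi : i = j
  · by_cases hk : k = l
    · simp [hi, hk]; ring
    · simp [hi, hk]; ring
  · simp [hi]; ring

/-- The arguments come from expanding `braid q s` as `braid q q` plus s⁻¹ - q⁻¹ times the identity
and from reducing the square by the Hecke relation. Here κ stands for the inverse of `familyDenom`.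
-/
theorem braidTensor_family (κ : ℂ) (i j k l n r : Fin 3) :
    braidTensor q (t * ((s : ℂ)⁻¹ - (q : ℂ)⁻¹) ^ 2 + (t - 1)) (t * ((s : ℂ)⁻¹ - (q : ℂ)⁻¹))
      (t * ((s : ℂ)⁻¹ - (q : ℂ)⁻¹)) t
      (κ * ((t - 1) * (1 - t * (1 + ((s : ℂ)⁻¹ - (q : ℂ)⁻¹) ^ 2))))
      (-(κ * ((t - 1) * t * (2 * ((s : ℂ)⁻¹ - (q : ℂ)⁻¹) - ((q : ℂ) - (q : ℂ)⁻¹))))) i j k l n r =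
    t * ∑ a, braid q s i k a n * braid q s a r j l +
      (if i = j then if n = k then if r = l then t - 1 else 0 else 0 else 0) +
      if n = r then qWeight q n * (κ * (t - 1) * ((if i = j then if k = l then 1 else 0 else 0) -
        t * ∑ a, ∑ b, braid q s i k a b * braid q s a b j l)) else 0 := by
  rw [sum_braid_mul_braid, braid_sq_add, braidTensor]
  have hY : ∀ V : ℂ, (if i = j then if k = l then
      κ * ((t - 1) * (1 - t * (1 + ((s : ℂ)⁻¹ - (q : ℂ)⁻¹) ^ 2))) else 0 else 0) +
      -(κ * ((t - 1) * t * (2 * ((s : ℂ)⁻¹ - (q : ℂ)⁻¹) - ((q : ℂ) - (q : ℂ)⁻¹)))) * V =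
      κ * (t - 1) * ((if i = j then if k = l then 1 else 0 else 0) -
        t * ((if i = j then if k = l then 1 + ((s : ℂ)⁻¹ - (q : ℂ)⁻¹) ^ 2 else 0 else 0) +
      (2 * ((s : ℂ)⁻¹ - (q : ℂ)⁻¹) - ((q : ℂ) - (q : ℂ)⁻¹)) * V)) := fun V => by
    split_ifs <;> ring
  rw [hY]
  congr 1
  by_cases hr : r = l
  · by_cases hk : n = k
    · by_cases hi : i = j
      · simp [hr, hk, hi]; ring
      · simp [hr, hk, hi]; ring
    · simp [hr, hk]; ring
  · by_cases hk : n = k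
    · simp [hr, hk]; ring
    · simp [hr, hk]

theorem QGroup.IsDual.mcRel {Γ : FODC (GLq q)} {φ : Fin 3 × Fin 3 → Γ.Form →ₗ[ℂ] ℂ}
    (h : (GLq.qGroup q).IsDual Γ φ) (hc : Γ.Bicovariant)
    (hg : Γ.GeneratedBy (GLq.qGroup q).entries) (κ : ℂ)
    (hC : ∀ i j k l n r, φ (n, r) (Γ.d (GLq.z q i j) <• GLq.z q k l) =
      braidTensor q (t * ((s : ℂ)⁻¹ - (q : ℂ)⁻¹) ^ 2 + (t - 1)) (t * ((s : ℂ)⁻¹ - (q : ℂ)⁻¹))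
      (t * ((s : ℂ)⁻¹ - (q : ℂ)⁻¹)) t
      (κ * ((t - 1) * (1 - t * (1 + ((s : ℂ)⁻¹ - (q : ℂ)⁻¹) ^ 2))))
      (-(κ * ((t - 1) * t * (2 * ((s : ℂ)⁻¹ - (q : ℂ)⁻¹) - ((q : ℂ) - (q : ℂ)⁻¹))))) i j k l n r) :
    (GLq.qGroup q).MCRel s t Γ (κ • (GLq.qGroup q).mcTr Γ) := by
  intro a j k l
  rw [h.mc_rsmul hc hg]
  refine Finset.sum_congr rfl fun m _ => congrArg _ ?_
  replace hC : ∀ i j k l n r, φ (n, r) (Γ.d ((GLq.qGroup q).z i j) <• (GLq.qGroup q).z k l) = _ := hC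
  rw [Fintype.sum_prod_type]
  simp only [hC, braidTensor_family, add_smul, Finset.sum_add_distrib]
  set Q : ℂ := ∑ a_1, ∑ b, braid q s a m a_1 b * braid q s a_1 b j l with hQ
  generalize hY : κ • (GLq.qGroup q).mcTr Γ = Y
  have h1 : ∑ n, ∑ r, (t * ∑ x, braid q s a m x n * braid q s x r j l) • (GLq.qGroup q).mc Γ (n, r) =
      t • ∑ x, ∑ b, ∑ d, (braid q s a m x b * braid q s x d j l) • (GLq.qGroup q).mc Γ (b, d) := by
    simp only [Finset.mul_sum, Finset.sum_smul, Finset.smul_sum, smul_smul]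
    exact sum_rotate _
  have h2 : ∑ x, ∑ b, ∑ d, (braid q s a m x b * braid q s x d j l) •
      (if b = d then (t - 1) • Y else 0) = Q • (t - 1) • Y := by
    simp only [smul_ite, smul_zero, Finset.sum_ite_eq, Finset.mem_univ, if_true, hQ,
      Finset.sum_smul]
  have h3 : ∑ n, ∑ r, (if a = j then if n = m then if r = l then t - 1 else 0 else 0 else 0) •
      (GLq.qGroup q).mc Γ (n, r) = if a = j then (t - 1) • (GLq.qGroup q).mc Γ (m, l) else 0 := by
    split_ifs
    · simp [ite_smul]
    · simp
  have h4 : ∑ n, ∑ r, (if n = r then qWeight q n * (κ * (t - 1) *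
      ((if a = j then if m = l then 1 else 0 else 0) - t * Q)) else 0) •
      (GLq.qGroup q).mc Γ (n, r) =
      ((t - 1) * ((if a = j then if m = l then 1 else 0 else 0) - t * Q)) • Y := by
    simp only [ite_smul, zero_smul, Finset.sum_ite_eq, Finset.mem_univ, if_true, ← hY, mcTr,
      Finset.smul_sum, smul_smul]
    exact Finset.sum_congr rfl fun n _ => congrArg (fun c : ℂ => c • _) (by ring)
  rw [h1, h3, h4]
  simp only [smul_sub, Finset.sum_sub_distrib, h2]
  split_ifs <;> module

/-- The coefficient matrix is multiplicative, so it satisfies the quantum matrix relations. Three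
entries of them suffice: the first leaves two possibilities for x₂, the others determine y₁ and y₀.
-/
theorem braidTensor_relations {x₁ x₂ x₃ x₄ y₀ y₁ : ℂ}
    {f : GLq q →ₐ[ℂ] Matrix (Fin 3 × Fin 3) (Fin 3 × Fin 3) ℂ}
    (hf : ∀ i j k l n r, f (GLq.z q k l) (i, j) (n, r) =
      braidTensor q x₁ x₂ x₃ x₄ y₀ y₁ i j k l n r) :
    (x₂ + x₄ * (q : ℂ)⁻¹) * x₂ = q * (x₂ * x₄) ∧
    (x₂ + x₄ * ((q : ℂ)⁻¹ - q) + (q : ℂ) ^ 4 * y₁) * (x₁ + x₃ * (q : ℂ)⁻¹) +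
      (x₃ + (q : ℂ) ^ 2 * y₁) * (x₁ + x₃ * ((q : ℂ)⁻¹ - q)) + y₁ * (x₁ + x₂ * (q : ℂ)⁻¹ +
        x₃ * ((q : ℂ)⁻¹ - q) + x₄ * ((q : ℂ)⁻¹ * ((q : ℂ)⁻¹ - q))) =
      q * (x₃ * (x₂ + x₄ * ((q : ℂ)⁻¹ - q))) ∧
    (x₁ + x₂ * (q : ℂ)⁻¹) * x₄ = (x₄ + (q : ℂ) ^ 4 * y₀) * (x₁ + x₂ * (q : ℂ)⁻¹) +
      (x₁ + (q : ℂ) ^ 2 * y₀) * (x₁ + x₂ * ((q : ℂ)⁻¹ - q)) + y₀ * (x₁ + x₂ * ((q : ℂ)⁻¹ - q) +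
        x₃ * (q : ℂ)⁻¹ + x₄ * (((q : ℂ)⁻¹ - q) * (q : ℂ)⁻¹)) := by
  have hrow := fun i j k h p r => congrFun (congrFun (congrArg f (GLq.isQMatrix.row i j k h)) p) r
  have hcol := fun i j k h p r => congrFun (congrFun (congrArg f (GLq.isQMatrix.col i j k h)) p) r
  have hcomm := fun i j k l h h' p r =>
    congrFun (congrFun (congrArg f (GLq.isQMatrix.comm i j k l h h')) p) r
  simp only [map_mul, map_smul, Matrix.smul_apply, Matrix.mul_apply, Fintype.sum_prod_type,
    hf] at hrow hcol hcomm
  have e1 := hrow 1 1 2 (by decide) (0, 1) (0, 2)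
  have e2 := hcol 1 0 2 (by decide) (0, 1) (2, 0)
  have e3 := hcomm 0 2 1 1 (by decide) (by decide) (0, 0) (0, 2)
  clear hrow hcol hcomm hf
  simp only [Fin.sum_univ_three, braidTensor, braid] at e1 e2 e3
  simp [qWeight, -mul_eq_mul_left_iff, -mul_eq_mul_right_iff, -mul_eq_zero, -zero_eq_mul]
    at e1 e2 e3
  exact ⟨e1, e2, e3⟩

/-- Differentiating a row and a column relation and applying the dual functionals gives linear
equations; the summand 1 comes from z dz' at the counit. -/
theorem braidTensor_cocycle {x₁ x₂ x₃ x₄ y₀ y₁ : ℂ} {φ : Fin 3 × Fin 3 → GLq q →ₗ[ℂ] ℂ}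
    (h : ∀ i j k l n r, φ (n, r) (GLq.z q i j * GLq.z q k l) =
      braidTensor q x₁ x₂ x₃ x₄ y₀ y₁ i j k l n r +
        if i = j then if (n, r) = (k, l) then 1 else 0 else 0) :
    x₁ + x₂ * (q : ℂ)⁻¹ + 1 = q * (x₃ + x₄ * (q : ℂ)⁻¹) ∧
      x₁ + x₃ * (q : ℂ)⁻¹ + 1 = q * (x₂ + x₄ * (q : ℂ)⁻¹) := by
  have e1 := congrArg (φ (0, 1)) (GLq.isQMatrix.row 0 0 1 (by decide))
  have e2 := congrArg (φ (1, 0)) (GLq.isQMatrix.col 0 0 1 (by decide))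
  rw [map_smul, h, h] at e1 e2
  simp only [Fin.sum_univ_three, braidTensor, braid] at e1 e2
  simp [qWeight, -mul_eq_mul_left_iff, -mul_eq_mul_right_iff, -mul_eq_zero, -zero_eq_mul] at e1 e2
  exact ⟨e1, e2⟩

end Classification

/-! ### Solution of the equations and the classification -/

section Classification

variable {q : ℂˣ}

/-- The solutions of the polynomial equations for the structure constants. -/
theorem braidTensor_solutions (hq : (q : ℂ) ^ 2 ≠ 1) (hq' : (q : ℂ) ^ 2 ≠ -1)
    {x₁ x₂ x₃ x₄ y₀ y₁ : ℂ}
    (h₁ : x₁ + x₂ * (q : ℂ)⁻¹ + 1 = q * (x₃ + x₄ * (q : ℂ)⁻¹))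
    (h₂ : x₁ + x₃ * (q : ℂ)⁻¹ + 1 = q * (x₂ + x₄ * (q : ℂ)⁻¹))
    (h₃ : (x₂ + x₄ * (q : ℂ)⁻¹) * x₂ = q * (x₂ * x₄))
    (h₄ : (x₂ + x₄ * ((q : ℂ)⁻¹ - q) + (q : ℂ) ^ 4 * y₁) * (x₁ + x₃ * (q : ℂ)⁻¹) +
      (x₃ + (q : ℂ) ^ 2 * y₁) * (x₁ + x₃ * ((q : ℂ)⁻¹ - q)) + y₁ * (x₁ + x₂ * (q : ℂ)⁻¹ +
        x₃ * ((q : ℂ)⁻¹ - q) + x₄ * ((q : ℂ)⁻¹ * ((q : ℂ)⁻¹ - q))) =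
      q * (x₃ * (x₂ + x₄ * ((q : ℂ)⁻¹ - q))))
    (h₅ : (x₁ + x₂ * (q : ℂ)⁻¹) * x₄ = (x₄ + (q : ℂ) ^ 4 * y₀) * (x₁ + x₂ * (q : ℂ)⁻¹) +
      (x₁ + (q : ℂ) ^ 2 * y₀) * (x₁ + x₂ * ((q : ℂ)⁻¹ - q)) + y₀ * (x₁ + x₂ * ((q : ℂ)⁻¹ - q) +
        x₃ * (q : ℂ)⁻¹ + x₄ * (((q : ℂ)⁻¹ - q) * (q : ℂ)⁻¹))) :
    ∃ s : ℂˣ, (s = q ∨ s = q⁻¹) ∧ familyDenom q s x₄ ≠ 0 ∧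
      x₁ = x₄ * ((s : ℂ)⁻¹ - (q : ℂ)⁻¹) ^ 2 + (x₄ - 1) ∧
      x₂ = x₄ * ((s : ℂ)⁻¹ - (q : ℂ)⁻¹) ∧ x₃ = x₄ * ((s : ℂ)⁻¹ - (q : ℂ)⁻¹) ∧
      y₀ = (familyDenom q s x₄)⁻¹ *
        ((x₄ - 1) * (1 - x₄ * (1 + ((s : ℂ)⁻¹ - (q : ℂ)⁻¹) ^ 2))) ∧
      y₁ = -((familyDenom q s x₄)⁻¹ * ((x₄ - 1) * x₄ *
        (2 * ((s : ℂ)⁻¹ - (q : ℂ)⁻¹) - ((q : ℂ) - (q : ℂ)⁻¹)))) := by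
  have hq0 := q.ne_zero
  -- The difference of the two linear equations is (x₂ - x₃)(q² + 1) = 0; here q² ≠ -1 is needed.
  have h23 : x₃ = x₂ := by
    have h6 : (x₂ - x₃) * ((q : ℂ) ^ 2 + 1) = 0 := by
      field_simp at h₁ h₂
      linear_combination h₁ - h₂
    rcases mul_eq_zero.mp h6 with h7 | h7
    · linear_combination -h7
    · exact absurd (by linear_combination h7) hq'
  subst h23
  have hx1 : x₁ = x₄ + ((q : ℂ) - (q : ℂ)⁻¹) * x₃ - 1 := by
    field_simp at h₁ ⊢
    linear_combination h₁
  subst hx1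
  -- The two factors correspond to the two families, with x₄ as the parameter t.
  have hu : x₃ * (x₃ - ((q : ℂ) - (q : ℂ)⁻¹) * x₄) = 0 := by linear_combination h₃
  rcases mul_eq_zero.mp hu with h7 | h7
  · subst h7
    have e1 : familyDenom q q x₄ * y₁ = (x₄ - 1) * x₄ * ((q : ℂ) - (q : ℂ)⁻¹) := by
      rw [familyDenom, familyA_self]
      field_simp at h₄ ⊢
      linear_combination h₄
    have e2 : familyDenom q q x₄ * y₀ = -(x₄ - 1) ^ 2 := by
      rw [familyDenom, familyA_self]
      field_simp at h₅ ⊢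
      linear_combination -h₅
    -- If the denominator vanished, the equation for y₀ would force x₄ = 1, where the denominator is
    -- q⁻² - 1.
    have ha : familyDenom q q x₄ ≠ 0 := by
      intro ha
      rw [ha, zero_mul] at e2
      have h8 : x₄ = 1 := by
        have : x₄ - 1 = 0 := pow_eq_zero_iff (two_ne_zero) |>.mp (by linear_combination e2)
        linear_combination this
      rw [h8, familyDenom, familyA_self] at ha
      field_simp at ha
      exact hq (by linear_combination -ha)
    refine ⟨q, Or.inl rfl, ha, by ring, by ring, by ring, ?_, ?_⟩
    · rw [eq_inv_mul_iff_mul_eq₀ ha]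
      linear_combination e2
    · rw [← mul_neg, eq_inv_mul_iff_mul_eq₀ ha]
      linear_combination e1
  · have hx3 : x₃ = ((q : ℂ) - (q : ℂ)⁻¹) * x₄ := by linear_combination h7
    subst hx3
    have e1 : familyDenom q q⁻¹ x₄ * y₁ = -((x₄ - 1) * x₄ * ((q : ℂ) - (q : ℂ)⁻¹)) := by
      rw [familyDenom, familyA_inv]
      field_simp at h₄ ⊢
      refine mul_left_cancel₀ (pow_ne_zero 2 hq0) ?_
      linear_combination h₄
    have e2 : familyDenom q q⁻¹ x₄ * y₀ =
        (x₄ - 1) * (1 - x₄ * (1 + ((q : ℂ) - (q : ℂ)⁻¹) ^ 2)) := by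
      rw [familyDenom, familyA_inv]
      field_simp at h₅ ⊢
      refine mul_left_cancel₀ (pow_ne_zero 2 hq0) ?_
      linear_combination -h₅
    have hs : (((q⁻¹ : ℂˣ) : ℂ))⁻¹ = q := by simp
    have hl : (q : ℂ) - (q : ℂ)⁻¹ ≠ 0 := by
      intro hl
      field_simp at hl
      exact hq (by linear_combination hl)
    -- A vanishing denominator leaves x₄ = 0 or 1 by the equation for y₁, and the equation for y₀
    -- excludes 0; at 1 the denominator is (q - q⁻¹) q⁵.
    have ha : familyDenom q q⁻¹ x₄ ≠ 0 := by
      intro ha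
      rw [ha, zero_mul] at e1 e2
      have hx : (x₄ - 1) * x₄ = 0 :=
        (mul_eq_zero.mp (neg_eq_zero.mp e1.symm)).resolve_right hl
      have h8 : x₄ = 1 := by
        linear_combination -e2 + (1 + ((q : ℂ) - (q : ℂ)⁻¹) ^ 2) * hx
      rw [h8, familyDenom, familyA_inv, sub_self, zero_mul, add_zero, one_mul] at ha
      exact (mul_ne_zero hl (pow_ne_zero 5 hq0)) ha
    refine ⟨q⁻¹, Or.inr rfl, ha, ?_, ?_, ?_, ?_, ?_⟩ <;> rw [hs]
    · ring
    · ring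
    · ring
    · rw [eq_inv_mul_iff_mul_eq₀ ha]
      linear_combination e2
    · rw [← mul_neg, eq_inv_mul_iff_mul_eq₀ ha]
      linear_combination e1

/-- Bicovariant calculi with dual functionals belong to one of the two families. -/
theorem QGroup.IsDual.dzRel (hq : (q : ℂ) ^ 2 ≠ 1) (hq' : (q : ℂ) ^ 2 ≠ -1) {Γ : FODC (GLq q)}
    {φ : Fin 3 × Fin 3 → Γ.Form →ₗ[ℂ] ℂ} (h : (GLq.qGroup q).IsDual Γ φ) (hc : Γ.Bicovariant)
    (hg : Γ.GeneratedBy (GLq.qGroup q).entries) :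
    ∃ (s : ℂˣ) (t : ℂ), (s = q ∨ s = q⁻¹) ∧ t ≠ 0 ∧ familyDenom q s t ≠ 0 ∧
      (GLq.qGroup q).DZRel s t Γ ((familyDenom q s t)⁻¹ • Γ.trTheta) := by
  obtain ⟨x₁, x₂, x₃, x₄, y₀, y₁, hC⟩ := h.exists_braidTensor hc hg
  have hf : ∀ i j k l n r, h.hom hg (GLq.z q k l) (i, j) (n, r) =
      braidTensor q x₁ x₂ x₃ x₄ y₀ y₁ i j k l n r := hC
  obtain ⟨h₃, h₄, h₅⟩ := braidTensor_relations hf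
  have hd : ∀ i j k l n r, (φ (n, r) ∘ₗ Γ.d) (GLq.z q i j * GLq.z q k l) =
      braidTensor q x₁ x₂ x₃ x₄ y₀ y₁ i j k l n r +
        if i = j then if (n, r) = (k, l) then 1 else 0 else 0 := fun i j k l n r => by
    rw [← hf]
    exact h.d_z_mul_z hg i j k l (n, r)
  obtain ⟨h₁, h₂⟩ := braidTensor_cocycle (φ := fun p => φ p ∘ₗ Γ.d) hd
  obtain ⟨s, hs, ha, e₁, e₂, e₃, e₄, e₅⟩ := braidTensor_solutions hq hq' h₁ h₂ h₃ h₄ h₅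
  -- For x₄ = 0 the row (0, 1) of the coefficient matrix would vanish on all generators z, hence on
  -- D, which is invertible.
  have hx : x₄ ≠ 0 := by
    rintro rfl
    have h0 : ∀ k l r, h.hom hg (GLq.z q k l) (0, 1) r = 0 := by
      rintro k l ⟨n, r⟩
      rw [hf, braidTensor, e₂, e₃, e₅]
      simp
    have h1 : ∀ (a : GLq q) k l r, h.hom hg (GLq.z q k l * a) (0, 1) r = 0 := fun a k l r => by
      rw [map_mul, Matrix.mul_apply]
      simp [h0]
    have h2 : ∀ r, h.hom hg (GLq.det q) (0, 1) r = 0 := fun r => by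
      simp only [GLq.det, qDet, map_add, map_sub, map_smul, Matrix.add_apply, Matrix.sub_apply,
        Matrix.smul_apply, mul_assoc, h1]
      simp
    have h3 := congrFun (congrFun (congrArg (h.hom hg) (GLq.det_mul_detInv (q := q))) (0, 1)) (0, 1)
    rw [map_mul, Matrix.mul_apply, map_one] at h3
    simp [h2] at h3
  refine ⟨s, x₄, hs, hx, ha, ?_⟩
  rw [← trTheta_eq]
  refine (h.mcRel hc hg _ fun i j k l n r => ?_).dzRel
  rw [hC]
  congr 1

/-- The calculi over `GL_q(3)` that descend to `SL_q(3)` are equivalent to model calculi. -/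
theorem FODC.DescendsToSL.exists_equivalent (hq : (q : ℂ) ^ 2 ≠ 1) (hq' : (q : ℂ) ^ 2 ≠ -1)
    {Γ : FODC (GLq q)} (h : Γ.DescendsToSL) (hc : Γ.Bicovariant)
    (hg : Γ.GeneratedBy (GLq.entries q)) :
    (∃ t : ℂ, FODC.Admissible₁ q t ∧ t ^ 3 = (q : ℂ) ^ 2 ∧ FODC.IsGamma₁ t Γ) ∨
      ∃ t : ℂ, FODC.Admissible₂ q t ∧ t ^ 3 = ((q : ℂ) ^ 2)⁻¹ ∧ FODC.IsGamma₂ t Γ := by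
  obtain ⟨φ, hφ⟩ := h.exists_isDual
  have hB : Γ.HasBasis (GLq.entries q) := hφ.hasBasis hc hg
  obtain ⟨s, t, hs, ht, ha, hR⟩ := hφ.dzRel hq hq' hc hg
  rcases hs with rfl | rfl
  · have hΓ : FODC.IsGamma₁ t Γ := isGamma₁_of_dzRel hc hB (admissible₁_iff.mpr ⟨ht, ha⟩) hR
    exact Or.inl ⟨t, admissible₁_iff.mpr ⟨ht, ha⟩, (descends_iff (Or.inl rfl) hq ht ha
      (hΓ.equivalent (glModel_isGamma₁ hq ht ha))).1.mp h, hΓ⟩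
  · have hΓ : FODC.IsGamma₂ t Γ := isGamma₂_of_dzRel hc hB (admissible₂_iff.mpr ⟨ht, ha⟩) hR
    refine Or.inr ⟨t, admissible₂_iff.mpr ⟨ht, ha⟩, ?_, hΓ⟩
    rw [(descends_iff (Or.inr rfl) hq ht ha
      (hΓ.equivalent (glModel_isGamma₂ hq ht ha))).1.mp h]
    simp

end Classification

/-! ### Counting the induced calculi -/

section Counting

variable {q : ℂˣ} {t : ℂ}

/-- Both calculi are quotients of the same calculus by the same kernel, because the maps onto them
are surjective. -/
theorem FODC.Induces.equivalent {Γ : FODC (GLq q)} {Γ' Γ'' : FODC (SLq q)} (h : Γ.Induces Γ')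
    (h' : Γ.Induces Γ'') : Γ'.Equivalent Γ'' := by
  obtain ⟨ρ, h1, h2, h3, h4⟩ := h
  obtain ⟨ρ', h1', h2', h3', h4'⟩ := h'
  have hs := FODC.Induces.surjective h1 h3
  have hs' := FODC.Induces.surjective h1' h3'
  let ζ : Γ'.Form ≃ₗ[ℂ] Γ''.Form := (ρ.quotKerEquivOfSurjective hs).symm ≪≫ₗ
    Submodule.quotEquivOfEq _ _ (h4.trans h4'.symm) ≪≫ₗ ρ'.quotKerEquivOfSurjective hs'
  have hζ : ∀ ω, ζ (ρ ω) = ρ' ω := fun ω => by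
    have h5 : (ρ.quotKerEquivOfSurjective hs).symm (ρ ω) = Submodule.Quotient.mk ω := by
      rw [LinearEquiv.symm_apply_eq]
      rfl
    simp only [ζ, LinearEquiv.trans_apply, h5]
    rfl
  refine ⟨{ ζ with map_smul' := fun a η => ?_ }, fun η a => ?_, fun a => ?_⟩
  · obtain ⟨a, rfl⟩ := SLq.proj_surjective a
    obtain ⟨ω, rfl⟩ := hs η
    change ζ (SLq.proj q a • ρ ω) = SLq.proj q a • ζ (ρ ω)
    rw [← h1, hζ, hζ, h1']
  · obtain ⟨a, rfl⟩ := SLq.proj_surjective a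
    obtain ⟨ω, rfl⟩ := hs η
    change ζ (ρ ω <• SLq.proj q a) = ζ (ρ ω) <• SLq.proj q a
    rw [← h2, hζ, hζ, h2']
  · obtain ⟨a, rfl⟩ := SLq.proj_surjective a
    change ζ (Γ'.d (SLq.proj q a)) = _
    rw [← h3, hζ, h3']

theorem FODC.HasBasis.exists_isDual {Γ' : FODC (SLq q)} (hB : Γ'.HasBasis (SLq.entries q)) :
    ∃ φ : Fin 3 × Fin 3 → Γ'.Form →ₗ[ℂ] ℂ, (SLq.qGroup q).IsDual Γ' φ := by
  let b := Module.Basis.mk hB.1 hB.2.ge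
  refine ⟨fun p => Coalgebra.counit ∘ₗ (b.coord p).restrictScalars ℂ, ?_, ?_⟩
  · intro p a ω
    simp only [LinearMap.comp_apply, LinearMap.restrictScalars_apply, map_smul, smul_eq_mul,
      Bialgebra.counit_mul]
  · intro p i j
    have h5 : Γ'.d ((SLq.qGroup q).z i j) = b (i, j) :=
      (Module.Basis.mk_apply hB.1 hB.2.ge (i, j)).symm
    simp only [LinearMap.comp_apply, LinearMap.restrictScalars_apply, h5, Module.Basis.coord_apply,
      Module.Basis.repr_self, Finsupp.single_apply]
    split_ifs with h6 h7 h7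
    · simp
    · exact absurd h6.symm h7
    · exact absurd h7.symm h6
    · simp

theorem QGroup.IsDual.of_equivalent {Γ' Γ'' : FODC (SLq q)}
    {φ : Fin 3 × Fin 3 → Γ''.Form →ₗ[ℂ] ℂ} (h : (SLq.qGroup q).IsDual Γ'' φ)
    (e : Γ'.Equivalent Γ'') : ∃ φ' : Fin 3 × Fin 3 → Γ'.Form →ₗ[ℂ] ℂ,
      (SLq.qGroup q).IsDual Γ' φ' ∧
        ∀ p (a b : SLq q), φ' p (Γ'.d a <• b) = φ p (Γ''.d a <• b) := by
  obtain ⟨ζ, h1, h2⟩ := e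
  refine ⟨fun p => φ p ∘ₗ ζ.toLinearMap.restrictScalars ℂ, ⟨fun p a ω => ?_, fun p i j => ?_⟩,
    fun p a b => ?_⟩
  · simp [h.smul]
  · simp [h2, h.d_z]
  · simp [h1, h2]

section Invariants

variable {Γ : FODC (GLq q)} {Γ' : FODC (SLq q)} {φ : Fin 3 × Fin 3 → Γ'.Form →ₗ[ℂ] ℂ}

theorem QGroup.IsDual.of_induces (h : (SLq.qGroup q).IsDual Γ' φ) (hΓ : Γ.Induces Γ') :
    ∃ ψ : Fin 3 × Fin 3 → Γ.Form →ₗ[ℂ] ℂ, (GLq.qGroup q).IsDual Γ ψ ∧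
      ∀ p i j k l, ψ p (Γ.d (GLq.z q i j) <• GLq.z q k l) =
        φ p (Γ'.d (SLq.z q i j) <• SLq.z q k l) := by
  obtain ⟨ρ, h1, h2, h3, -⟩ := hΓ
  refine ⟨fun p => φ p ∘ₗ ρ, ⟨fun p a ω => ?_, fun p i j => ?_⟩, fun p i j k l => ?_⟩
  · rw [LinearMap.comp_apply, LinearMap.comp_apply, h1, h.smul, SLq.counit_proj]
  · exact (congrArg (φ p) (h3 _)).trans (h.d_z p i j)
  · exact congrArg (φ p) ((h2 _ _).trans (by rw [h3]; rfl))

/-- These numbers are read off from the calculus over SL and are unchanged under an equivalence that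
transports the dual functionals. The first recovers t; their ratio, q⁻¹ here and q in the second
family, recovers the family. -/
theorem FODC.IsGamma₁.invariants (hΓ : FODC.IsGamma₁ t Γ) (hi : Γ.Induces Γ')
    (h : (SLq.qGroup q).IsDual Γ' φ) :
    φ (0, 2) (Γ'.d (SLq.z q 0 2) <• SLq.z q 1 1) = t ∧
      φ (0, 1) (Γ'.d (SLq.z q 0 1) <• SLq.z q 1 1) = t / q := by
  obtain ⟨ψ, hψ, h1⟩ := h.of_induces hi
  have hz : ∀ p i j, ψ p (Γ.d (GLq.z q i j)) = if p = (i, j) then 1 else 0 := hψ.d_z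
  have hε : ∀ i j, Coalgebra.counit (R := ℂ) (GLq.z q i j) = if i = j then 1 else 0 :=
    GLq.counit_z
  have hs := hψ.smul
  rw [← h1, ← h1]
  have e1 := hΓ.antidiag 0 2 1 1 (by decide) (by decide)
  have e2 := hΓ.col 0 1 1 (by decide)
  refine ⟨(congrArg (ψ (0, 2)) e1).trans ?_, (congrArg (ψ (0, 1)) e2).trans ?_⟩
  · simp [hs, hz, hε, Bialgebra.counit_mul]
  · simp [hs, hz, hε, Bialgebra.counit_mul]

theorem FODC.IsGamma₂.invariants (hΓ : FODC.IsGamma₂ t Γ) (hi : Γ.Induces Γ')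
    (h : (SLq.qGroup q).IsDual Γ' φ) :
    φ (0, 2) (Γ'.d (SLq.z q 0 2) <• SLq.z q 1 1) = t ∧
      φ (0, 1) (Γ'.d (SLq.z q 0 1) <• SLq.z q 1 1) = t * q := by
  obtain ⟨ψ, hψ, h1⟩ := h.of_induces hi
  have hz : ∀ p i j, ψ p (Γ.d (GLq.z q i j)) = if p = (i, j) then 1 else 0 := hψ.d_z
  have hε : ∀ i j, Coalgebra.counit (R := ℂ) (GLq.z q i j) = if i = j then 1 else 0 :=
    GLq.counit_z
  have hs := hψ.smul
  rw [← h1, ← h1]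
  have e1 := hΓ.antidiag 0 2 1 1 (by decide) (by decide)
  have e2 := hΓ.col 0 1 1 (by decide)
  refine ⟨(congrArg (ψ (0, 2)) e1).trans ?_, (congrArg (ψ (0, 1)) e2).trans ?_⟩
  · simp [hs, hz, hε, Bialgebra.counit_mul]
  · simp [hs, hz, hε, Bialgebra.counit_mul]

end Invariants

theorem finite_cube_eq (c : ℂ) : {t : ℂ | t ^ 3 = c}.Finite := by
  refine (Polynomial.nthRoots 3 c).toFinset.finite_toSet.subset fun t ht => ?_
  simpa [Polynomial.mem_nthRoots] using ht

theorem ncard_cube_eq {c : ℂ} (hc : c ≠ 0) : {t : ℂ | t ^ 3 = c}.ncard = 3 := by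
  have hζ := Complex.isPrimitiveRoot_exp 3 (by norm_num)
  have h1 : {t : ℂ | t ^ 3 = c} = (Polynomial.nthRoots 3 c).toFinset := by
    ext t
    simp [Polynomial.mem_nthRoots]
  rw [h1, Set.ncard_coe_finset, Multiset.toFinset_card_of_nodup (hζ.nthRoots_nodup hc),
    hζ.card_nthRoots, if_pos]
  exact IsAlgClosed.exists_pow_nat_eq c (by norm_num)

end Counting

/-! ### The count by parameters and the generic case -/

section Counting

variable {q : ℂˣ}

/-- The parameters of the calculi of the first family that descend to `SL_q(3)`. -/
def slParams₁ (q : ℂˣ) : Set ℂ := {t : ℂ | FODC.Admissible₁ q t ∧ t ^ 3 = (q : ℂ) ^ 2}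

/-- The parameters of the calculi of the second family that descend to `SL_q(3)`. -/
def slParams₂ (q : ℂˣ) : Set ℂ := {t : ℂ | FODC.Admissible₂ q t ∧ t ^ 3 = ((q : ℂ) ^ 2)⁻¹}

theorem FODC.IsGamma₁.descends_iff (hq : (q : ℂ) ^ 2 ≠ 1) {t : ℂ} (ht : FODC.Admissible₁ q t)
    {Γ : FODC (GLq q)} (hΓ : FODC.IsGamma₁ t Γ) : (Γ.DescendsToSL ↔ t ^ 3 = (q : ℂ) ^ 2) ∧
      (t ^ 3 ≠ (q : ℂ) ^ 2 → ∀ Γ' : FODC (SLq q), Γ.Induces Γ' → Subsingleton Γ'.Form) := by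
  obtain ⟨ht0, ha⟩ := admissible₁_iff.mp ht
  exact _root_.descends_iff (Or.inl rfl) hq ht0 ha
    (hΓ.equivalent (glModel_isGamma₁ hq ht0 ha))

theorem FODC.IsGamma₂.descends_iff (hq : (q : ℂ) ^ 2 ≠ 1) {t : ℂ} (ht : FODC.Admissible₂ q t)
    {Γ : FODC (GLq q)} (hΓ : FODC.IsGamma₂ t Γ) : (Γ.DescendsToSL ↔ t ^ 3 = ((q : ℂ) ^ 2)⁻¹) ∧
      (t ^ 3 ≠ ((q : ℂ) ^ 2)⁻¹ → ∀ Γ' : FODC (SLq q), Γ.Induces Γ' → Subsingleton Γ'.Form) := by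
  obtain ⟨ht0, ha⟩ := admissible₂_iff.mp ht
  have h : ((q : ℂ) ^ 2)⁻¹ = ((q⁻¹ : ℂˣ) : ℂ) ^ 2 := by simp
  rw [h]
  exact _root_.descends_iff (Or.inr rfl) hq ht0 ha
    (hΓ.equivalent (glModel_isGamma₂ hq ht0 ha))

theorem exists_isGamma₁ (hq : (q : ℂ) ^ 2 ≠ 1) {t : ℂ} (ht : FODC.Admissible₁ q t) :
    ∃ Γ : FODC (GLq q), FODC.IsGamma₁ t Γ :=
  ⟨_, glModel_isGamma₁ hq (admissible₁_iff.mp ht).1 (admissible₁_iff.mp ht).2⟩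

theorem exists_isGamma₂ (hq : (q : ℂ) ^ 2 ≠ 1) {t : ℂ} (ht : FODC.Admissible₂ q t) :
    ∃ Γ : FODC (GLq q), FODC.IsGamma₂ t Γ :=
  ⟨_, glModel_isGamma₂ hq (admissible₂_iff.mp ht).1 (admissible₂_iff.mp ht).2⟩

theorem FODC.DescendsToSL.exists_mem {Γ : FODC (GLq q)} (h : Γ.DescendsToSL)
    (hc : Γ.Bicovariant) (hg : Γ.GeneratedBy (GLq.entries q)) :
    ∃ c : FODC.inducedSLCalculi q, ∃ Γ' : FODC (SLq q), Quotient.mk _ Γ' = c.1 ∧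
      Γ'.HasBasis (SLq.entries q) ∧ Γ.Induces Γ' := by
  obtain ⟨Γ', h1, h2, h3⟩ := h
  exact ⟨⟨_, Γ', rfl, h2, h3, Γ, hc, hg, h1⟩, Γ', rfl, h3, h1⟩

/-- The induced calculi on `SL_q(3)` are counted by their parameters. -/
theorem ncard_inducedSLCalculi (hq : (q : ℂ) ^ 2 ≠ 1) (hq' : (q : ℂ) ^ 2 ≠ -1) :
    (FODC.inducedSLCalculi q).ncard = (slParams₁ q).ncard + (slParams₂ q).ncard := by
  have hq0 := q.ne_zero
  have hS₁ : (slParams₁ q).Finite := (finite_cube_eq _).subset fun t ht => ht.2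
  have hS₂ : (slParams₂ q).Finite := (finite_cube_eq _).subset fun t ht => ht.2
  have h₁ : ∀ t : slParams₁ q, ∃ c : FODC.inducedSLCalculi q, ∃ Γ : FODC (GLq q),
      ∃ Γ' : FODC (SLq q), FODC.IsGamma₁ t.1 Γ ∧ Quotient.mk _ Γ' = c.1 ∧
        Γ'.HasBasis (SLq.entries q) ∧ Γ.Induces Γ' := fun t => by
    obtain ⟨Γ, hΓ⟩ := exists_isGamma₁ hq t.2.1
    obtain ⟨c, Γ', h⟩ := ((hΓ.descends_iff hq t.2.1).1.mpr t.2.2).exists_mem hΓ.bicovariant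
      hΓ.basis.2
    exact ⟨c, Γ, Γ', hΓ, h⟩
  have h₂ : ∀ t : slParams₂ q, ∃ c : FODC.inducedSLCalculi q, ∃ Γ : FODC (GLq q),
      ∃ Γ' : FODC (SLq q), FODC.IsGamma₂ t.1 Γ ∧ Quotient.mk _ Γ' = c.1 ∧
        Γ'.HasBasis (SLq.entries q) ∧ Γ.Induces Γ' := fun t => by
    obtain ⟨Γ, hΓ⟩ := exists_isGamma₂ hq t.2.1
    obtain ⟨c, Γ', h⟩ := ((hΓ.descends_iff hq t.2.1).1.mpr t.2.2).exists_mem hΓ.bicovariant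
      hΓ.basis.2
    exact ⟨c, Γ, Γ', hΓ, h⟩
  choose f₁ Γ₁ Γ₁' hΓ₁ hf₁ hB₁ hI₁ using h₁
  choose f₂ Γ₂ Γ₂' hΓ₂ hf₂ hB₂ hI₂ using h₂
  have hbij : Function.Bijective (Sum.elim f₁ f₂) := by
    constructor
    · refine Function.Injective.sumElim (fun t u htu => ?_) (fun t u htu => ?_) fun t u htu => ?_
      · have e : (Γ₁' t).Equivalent (Γ₁' u) := Quotient.exact ((hf₁ t).trans (htu ▸ (hf₁ u).symm))
        obtain ⟨φ, hφ⟩ := (hB₁ u).exists_isDual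
        obtain ⟨ψ, hψ, h⟩ := hφ.of_equivalent e
        exact Subtype.ext (((hΓ₁ t).invariants (hI₁ t) hψ).1.symm.trans ((h _ _ _).trans
          ((hΓ₁ u).invariants (hI₁ u) hφ).1))
      · have e : (Γ₂' t).Equivalent (Γ₂' u) := Quotient.exact ((hf₂ t).trans (htu ▸ (hf₂ u).symm))
        obtain ⟨φ, hφ⟩ := (hB₂ u).exists_isDual
        obtain ⟨ψ, hψ, h⟩ := hφ.of_equivalent e
        exact Subtype.ext (((hΓ₂ t).invariants (hI₂ t) hψ).1.symm.trans ((h _ _ _).trans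
          ((hΓ₂ u).invariants (hI₂ u) hφ).1))
      · have e : (Γ₁' t).Equivalent (Γ₂' u) := Quotient.exact ((hf₁ t).trans (htu ▸ (hf₂ u).symm))
        obtain ⟨φ, hφ⟩ := (hB₂ u).exists_isDual
        obtain ⟨ψ, hψ, h⟩ := hφ.of_equivalent e
        obtain ⟨e₁, e₂⟩ := (hΓ₁ t).invariants (hI₁ t) hψ
        obtain ⟨e₃, e₄⟩ := (hΓ₂ u).invariants (hI₂ u) hφ
        rw [h] at e₁ e₂
        -- A calculus lying in both families would have equal ratios q⁻¹ = q.
        have e₅ : t.1 / q = t.1 * q := by rw [← e₂, e₄, ← e₃, e₁]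
        have ht0 : t.1 ≠ 0 := t.2.1.1
        field_simp at e₅
        exact hq e₅.symm
    · rintro ⟨c, Γ', rfl, hc, hB, Γ, hcΓ, hg, hI⟩
      rcases FODC.DescendsToSL.exists_equivalent hq hq' ⟨Γ', hI, hc, hB⟩ hcΓ hg with
        ⟨t, ha, ht, hΓ⟩ | ⟨t, ha, ht, hΓ⟩
      · refine ⟨Sum.inl ⟨t, ha, ht⟩, Subtype.ext ((hf₁ _).symm.trans (Quotient.sound ?_))⟩
        exact ((hI₁ ⟨t, ha, ht⟩).of_equivalent (hΓ.equivalent (hΓ₁ ⟨t, ha, ht⟩))).equivalent hI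
      · refine ⟨Sum.inr ⟨t, ha, ht⟩, Subtype.ext ((hf₂ _).symm.trans (Quotient.sound ?_))⟩
        exact ((hI₂ ⟨t, ha, ht⟩).of_equivalent (hΓ.equivalent (hΓ₂ ⟨t, ha, ht⟩))).equivalent hI
  have := hS₁.to_subtype
  have := hS₂.to_subtype
  rw [← Nat.card_coe_set_eq, ← Nat.card_coe_set_eq, ← Nat.card_coe_set_eq, ← Nat.card_sum,
    Nat.card_eq_of_bijective _ hbij]

open Polynomial in
theorem eventually_units_eval_ne_zero {p : ℂ[X]} (hp : p ≠ 0) :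
    ∀ᶠ q : ℂˣ in Filter.cofinite, p.eval (q : ℂ) ≠ 0 := by
  have h : {x : ℂ | p.eval x = 0}.Finite :=
    p.roots.toFinset.finite_toSet.subset fun x hx => by simpa [hp] using hx
  rw [Filter.eventually_cofinite]
  refine (h.preimage Units.val_injective.injOn).subset fun q hq => ?_
  simpa using hq

-- A cube root t of q² that violates admissibility satisfies a linear equation over the polynomials
-- in q. Cubing it and replacing t³ by q² gives a nonzero polynomial equation for q alone, which
-- excludes finitely many values.
open Polynomial in
theorem eventually_slParams₁ : ∀ᶠ q : ℂˣ in Filter.cofinite, (slParams₁ q).ncard = 3 := by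
  have hp : ((X ^ 6 + X ^ 4 + 1) ^ 3 * X ^ 2 - (X ^ 6 + X ^ 4 + X ^ 2) ^ 3 : ℂ[X]) ≠ 0 := fun h => by
    have h1 := congrArg (eval 2) h
    norm_num at h1
  filter_upwards [eventually_units_eval_ne_zero hp] with q hq
  have hq0 := q.ne_zero
  rw [← ncard_cube_eq (pow_ne_zero 2 hq0)]
  congr 1
  ext t
  refine ⟨fun h => h.2, fun h => ⟨⟨?_, fun h1 => hq ?_⟩, h⟩⟩
  · rintro rfl
    exact pow_ne_zero 2 hq0 (by simpa using (show (0 : ℂ) ^ 3 = _ from h).symm)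
  · replace h : t ^ 3 = (q : ℂ) ^ 2 := h
    have h2 := congrArg (· ^ 3) (sub_eq_zero.mp h1)
    simp only [mul_pow, h] at h2
    simp only [eval_sub, eval_mul, eval_pow, eval_add, eval_X, eval_one]
    linear_combination h2

open Polynomial in
theorem eventually_slParams₂ : ∀ᶠ q : ℂˣ in Filter.cofinite, (slParams₂ q).ncard = 3 := by
  have hp : ((X ^ 6 + X ^ 2 + 1) ^ 3 - (X ^ 4 + X ^ 2 + 1) ^ 3 * X ^ 2 : ℂ[X]) ≠ 0 := fun h => by
    have h1 := congrArg (eval 0) h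
    norm_num at h1
  filter_upwards [eventually_units_eval_ne_zero hp] with q hq
  have hq0 := q.ne_zero
  rw [← ncard_cube_eq (inv_ne_zero (pow_ne_zero 2 hq0))]
  congr 1
  ext t
  refine ⟨fun h => h.2, fun h => ⟨⟨?_, fun h1 => hq ?_⟩, h⟩⟩
  · rintro rfl
    exact inv_ne_zero (pow_ne_zero 2 hq0) (by simpa using (show (0 : ℂ) ^ 3 = _ from h).symm)
  · replace h : t ^ 3 = ((q : ℂ) ^ 2)⁻¹ := h
    have h2 := congrArg (· ^ 3) (sub_eq_zero.mp h1)
    simp only [mul_pow, h] at h2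
    rw [← div_eq_mul_inv, div_eq_iff (pow_ne_zero 2 hq0)] at h2
    simp only [eval_sub, eval_mul, eval_pow, eval_add, eval_X, eval_one]
    linear_combination h2

open Polynomial in
theorem eventually_ncard_inducedSLCalculi :
    ∀ᶠ q : ℂˣ in Filter.cofinite, (FODC.inducedSLCalculi q).ncard = 6 := by
  -- The roots of this polynomial are the excluded values ±1 and ±i.
  have hp : (X ^ 4 - 1 : ℂ[X]) ≠ 0 := fun h => by
    have h1 := congrArg (eval 0) h
    norm_num at h1
  filter_upwards [eventually_slParams₁, eventually_slParams₂, eventually_units_eval_ne_zero hp] with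
    q h1 h2 h3
  simp only [eval_sub, eval_pow, eval_X, eval_one] at h3
  rw [ncard_inducedSLCalculi (fun h => h3 ?_) (fun h => h3 ?_), h1, h2]
  · linear_combination ((q : ℂ) ^ 2 + 1) * h
  · linear_combination ((q : ℂ) ^ 2 - 1) * h

end Counting

/-! ### The main theorem -/

theorem mainTheorem4 :
    (∀ q : ℂˣ, (q : ℂ) ∉ ({1, -1, Complex.I, -Complex.I} : Set ℂ) →
      -- the first family: `Γ₁(t)` exists, is unique, and gives a calculus on `SL_q(3)` iff `t³ = q²`
      (∀ t : ℂ, FODC.Admissible₁ q t →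
        (∃ Γ : FODC (GLq q), FODC.IsGamma₁ t Γ) ∧
        (∀ Γ Γ' : FODC (GLq q), FODC.IsGamma₁ t Γ → FODC.IsGamma₁ t Γ' → Γ.Equivalent Γ') ∧
        ∀ Γ : FODC (GLq q), FODC.IsGamma₁ t Γ →
          (Γ.DescendsToSL ↔ t ^ 3 = (q : ℂ) ^ 2) ∧
          (t ^ 3 ≠ (q : ℂ) ^ 2 →
            ∀ Γ' : FODC (SLq q), Γ.Induces Γ' → Subsingleton Γ'.Form)) ∧
      -- the second family, with `t³ = q⁻²`
      (∀ t : ℂ, FODC.Admissible₂ q t →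
        (∃ Γ : FODC (GLq q), FODC.IsGamma₂ t Γ) ∧
        (∀ Γ Γ' : FODC (GLq q), FODC.IsGamma₂ t Γ → FODC.IsGamma₂ t Γ' → Γ.Equivalent Γ') ∧
        ∀ Γ : FODC (GLq q), FODC.IsGamma₂ t Γ →
          (Γ.DescendsToSL ↔ t ^ 3 = ((q : ℂ) ^ 2)⁻¹) ∧
          (t ^ 3 ≠ ((q : ℂ) ^ 2)⁻¹ →
            ∀ Γ' : FODC (SLq q), Γ.Induces Γ' → Subsingleton Γ'.Form)) ∧
      -- the calculi on `GL_q(3)` that descend to `SL_q(3)` are exactly these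
      (∀ Γ : FODC (GLq q), Γ.Bicovariant → Γ.GeneratedBy (GLq.entries q) →
        (Γ.DescendsToSL ↔
          (∃ t : ℂ, FODC.Admissible₁ q t ∧ t ^ 3 = (q : ℂ) ^ 2 ∧ FODC.IsGamma₁ t Γ) ∨
          (∃ t : ℂ, FODC.Admissible₂ q t ∧ t ^ 3 = ((q : ℂ) ^ 2)⁻¹ ∧ FODC.IsGamma₂ t Γ))) ∧
      -- the number of induced calculi on `SL_q(3)`
      (FODC.inducedSLCalculi q).ncard =
        {t : ℂ | FODC.Admissible₁ q t ∧ t ^ 3 = (q : ℂ) ^ 2}.ncard +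
        {t : ℂ | FODC.Admissible₂ q t ∧ t ^ 3 = ((q : ℂ) ^ 2)⁻¹}.ncard) ∧
    -- for generic `q` there are six
    (∀ᶠ q : ℂˣ in Filter.cofinite, (FODC.inducedSLCalculi q).ncard = 6) := by
  refine ⟨fun q hq => ?_, eventually_ncard_inducedSLCalculi⟩
  simp only [Set.mem_insert_iff, Set.mem_singleton_iff, not_or] at hq
  obtain ⟨h1, h2, h3, h4⟩ := hq
  have hq1 : (q : ℂ) ^ 2 ≠ 1 := fun h => (mul_self_eq_one_iff.mp ((sq _).symm.trans h)).elim h1 h2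
  have hq2 : (q : ℂ) ^ 2 ≠ -1 := fun h => by
    rw [← Complex.I_sq, sq_eq_sq_iff_eq_or_eq_neg] at h
    exact h.elim h3 h4
  refine ⟨fun t ht => ⟨exists_isGamma₁ hq1 ht, fun _ _ h h' => h.equivalent h',
      fun _ h => h.descends_iff hq1 ht⟩,
    fun t ht => ⟨exists_isGamma₂ hq1 ht, fun _ _ h h' => h.equivalent h',
      fun _ h => h.descends_iff hq1 ht⟩,
    fun Γ hc hg => ⟨fun h => h.exists_equivalent hq1 hq2 hc hg, ?_⟩,
    ncard_inducedSLCalculi hq1 hq2⟩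
  rintro (⟨t, ha, ht, h⟩ | ⟨t, ha, ht, h⟩)
  · exact (h.descends_iff hq1 ha).1.mpr ht
  · exact (h.descends_iff hq1 ha).1.mpr ht
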